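/- Let $M$ be a topological space with a fundamental class of dimension $d\ge 0$; by this we mean that $H^i(M;\mathbb Z)=0$ for all $i>d$ and that a class $[M]\in H_d(M;\mathbb Z)$ is given (for example, $M$ is a closed oriented $d$-manifold). Let $N\to M$ be a complex vector bundle of rank $r$, with Chern classes $c_i(N)\in H^{2i}(M;\mathbb Z)$, and let $s_j(N)\in H^{2j}(M;\mathbb Z)$ be its Segre classes, i.e. the components of the inverse of the total Chern class: $\big(\sum_j s_j(N)\big)\big(\sum_i c_i(N)\big)=1$. Let $ES^1\to BS^1=ES^1/S^1$ be a universal circle bundle (a principal circle bundle with contractible total space), and let $\mathbf c\in H^2(BS^1;\mathbb Z)$ be the universal first Chern class, i.e. the first Chern class of the complex line bundle associated to the circle bundle $ES^1\to BS^1$ (in which $(\lambda e,z)$ is identified with $(e,\lambda z)$). Let $ES^1\times_{S^1}N$ be the quotient of $ES^1\times N$ by the diagonal action $\lambda(e,v)=(\lambda e,\lambda v)$, where $S^1$ acts on $N$ by scalar multiplication on the fibres, with projections $\pi_B:ES^1\times_{S^1}N\to BS^1$ and $\pi_M:ES^1\times_{S^1}N\to M$. Let $N^0\subset N$ be the complement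 of the zero section, let $\mathrm{Th}_{S^1}(N)\in H^{2r}(ES^1\times_{S^1}N,\,ES^1\times_{S^1}N^0;\mathbb Z)$ be the Thom class of the complex vector bundle $\pi_B\times\pi_M:ES^1\times_{S^1}N\to BS^1\times M$, and let $\iota_N^*$ denote restriction from the cohomology of this pair to $H^*(ES^1\times_{S^1}N;\mathbb Z)$. Then for all integers $0\le k\le\lfloor d/2\rfloor$, all $\alpha\in H^{d-2k}(M;\mathbb Z)$ and all integers $m\ge k+r$: $$\pi_B^*\mathbf c^{m}\smile\pi_M^*\alpha=\iota_N^*\mathrm{Th}_{S^1}(N)\smile\Big(\sum_{j=0}^{k}(-1)^{r+j}\,\pi_B^*\mathbf c^{m-r-j}\smile\pi_M^*\big(\alpha\smile s_j(N)\big)\Big),$$ and $$\pi_{B,*}\big(\pi_B^*\mathbf c^{m}\smile\pi_M^*\alpha\big)=(-1)^{k+r}\,\big\langle\alpha\smile s_k(N),[M]\big\rangle\,\mathbf c^{m-r-k}.$$ Here the pushforward $\pi_{B,*}$ is the composition of division by the Thom class and integration over $M$: the second formula means that there is exactly one class $y\in H^*(BS^1\times M;\mathbb Z)$ with $\pi_B^*\mathbf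 c^{m}\smile\pi_M^*\alpha=\iota_N^*\mathrm{Th}_{S^1}(N)\smile(\pi_B\times\pi_M)^*y$, and that its slant product $y/[M]\in H^*(BS^1;\mathbb Z)$ is the right-hand side. -/

import Mathlib

noncomputable section

namespace S1Loc

/-! ### Singular simplices, chains and cochains -/

/-- Singular `n`-simplices of `X`. -/
abbrev Simp (n : ℕ) (X : Type*) [TopologicalSpace X] := C(stdSimplex ℝ (Fin (n + 1)), X)

/-- All singular simplices of `X`, in all dimensions. -/
abbrev Sing (X : Type*) [TopologicalSpace X] := Σ n : ℕ, Simp n X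

/-- The vertex map `i ↦ a i` (truncated at `n`) from `{0, …, m}` to `{0, …, n}`. -/
def vtx (m n : ℕ) (a : ℕ → ℕ) (i : Fin (m + 1)) : Fin (n + 1) :=
  ⟨min (a i) n, Nat.lt_succ_of_le (min_le_right _ _)⟩

/-- The composite of `σ` with the affine map `Δ^m → Δ^n` sending vertex `i` to vertex `a i`. -/
def Simp.pull {X : Type*} [TopologicalSpace X] {n : ℕ} (σ : Simp n X) (m : ℕ) (a : ℕ → ℕ) :
    Simp m X :=
  σ.comp ⟨stdSimplex.map (vtx m n a), stdSimplex.continuous_map _⟩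

/-- The increasing map `ℕ → ℕ` that omits the value `i`. -/
def skip (i : ℕ) (x : ℕ) : ℕ := if x < i then x else x + 1

variable {X Y Z : Type*} [TopologicalSpace X] [TopologicalSpace Y] [TopologicalSpace Z]

theorem Simp.pull_pull {n : ℕ} (σ : Simp n X) {m l : ℕ} (a b : ℕ → ℕ) (h : ∀ i ≤ l, b i ≤ m) :
    (Simp.pull σ m a).pull l b = σ.pull l (a ∘ b) := by
  have : vtx m n a ∘ vtx l m b = vtx l n (a ∘ b) := by
    funext i
    have := h i (Nat.le_of_lt_succ i.2)
    simp [vtx, this]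
  ext x
  simp only [Simp.pull, ContinuousMap.comp_apply, ContinuousMap.coe_mk]
  rw [stdSimplex.map_comp_apply, this]

theorem Simp.pull_congr {n : ℕ} (σ : Simp n X) {m : ℕ} {a b : ℕ → ℕ}
    (h : ∀ i ≤ m, min (a i) n = min (b i) n) : σ.pull m a = σ.pull m b := by
  have : vtx m n a = vtx m n b := by
    funext i
    simp [vtx, h i (Nat.le_of_lt_succ i.2)]
  simp only [Simp.pull, this]

theorem Simp.pull_id {n : ℕ} (σ : Simp n X) {a : ℕ → ℕ} (h : ∀ i ≤ n, a i = i) :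
    σ.pull n a = σ := by
  have : vtx n n a = id := by
    funext i
    have := h i (Nat.le_of_lt_succ i.2)
    ext
    simp [vtx, this, Nat.le_of_lt_succ i.2]
  ext x
  simp [Simp.pull, this]

/-- The image of a singular simplex under a continuous map. -/
def Sing.push (f : C(X, Y)) (σ : Sing X) : Sing Y := ⟨σ.1, f.comp σ.2⟩

/-- The boundary of a singular simplex. -/
def bdrySimp : Sing X → (Sing X →₀ ℤ)
  | ⟨0, _⟩ => 0
  | ⟨n + 1, σ⟩ => ∑ i ∈ Finset.range (n + 2),
      Finsupp.single (⟨n, σ.pull n (skip i)⟩ : Sing X) ((-1) ^ i)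

/-- The boundary operator on singular chains (of all degrees). -/
def bdry (X : Type*) [TopologicalSpace X] : (Sing X →₀ ℤ) →ₗ[ℤ] (Sing X →₀ ℤ) :=
  Finsupp.linearCombination ℤ bdrySimp

/-- Integral singular cochains: families, over all degrees `n`, of functions on the singular
`n`-simplices. -/
def Cochain (X : Type*) [TopologicalSpace X] : Type _ := Sing X → ℤ

namespace Cochain

instance : AddCommGroup (Cochain X) := inferInstanceAs (AddCommGroup (Sing X → ℤ))

@[ext] theorem ext {f g : Cochain X} (h : ∀ n (σ : Simp n X), f ⟨n, σ⟩ = g ⟨n, σ⟩) : f = g :=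
  funext fun ⟨n, σ⟩ => h n σ

/-- The value of a cochain on a chain. -/
def eval (f : Cochain X) : (Sing X →₀ ℤ) →ₗ[ℤ] ℤ := Finsupp.linearCombination ℤ fun σ => f σ

/-- The coboundary `δf = f ∘ ∂`. -/
def d (f : Cochain X) : Cochain X := fun σ => eval f (bdrySimp σ)

/-- The cup product: front face times back face. -/
instance : Mul (Cochain X) where
  mul f g := fun σ => ∑ p ∈ Finset.HasAntidiagonal.antidiagonal σ.1,
    f ⟨p.1, σ.2.pull p.1 id⟩ * g ⟨p.2, σ.2.pull p.2 (p.1 + ·)⟩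

instance : One (Cochain X) where
  one := fun σ => if σ.1 = 0 then 1 else 0

theorem add_val (f g : Cochain X) (σ : Sing X) : (f + g) σ = f σ + g σ := rfl
theorem zero_val (σ : Sing X) : (0 : Cochain X) σ = 0 := rfl
theorem neg_val (f : Cochain X) (σ : Sing X) : (-f) σ = -f σ := rfl
theorem one_val (σ : Sing X) : (1 : Cochain X) σ = if σ.1 = 0 then 1 else 0 := rfl
theorem mul_val (f g : Cochain X) (σ : Sing X) : (f * g) σ =
    ∑ p ∈ Finset.HasAntidiagonal.antidiagonal σ.1, f ⟨p.1, σ.2.pull p.1 id⟩ * g ⟨p.2, σ.2.pull p.2 (p.1 + ·)⟩ := rfl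

theorem d_zero_dim (f : Cochain X) (σ : Simp 0 X) : d f ⟨0, σ⟩ = 0 := by
  simp [d, bdrySimp]

theorem d_succ (f : Cochain X) {n : ℕ} (σ : Simp (n + 1) X) :
    d f ⟨n + 1, σ⟩ = ∑ i ∈ Finset.range (n + 2), (-1) ^ i * f ⟨n, σ.pull n (skip i)⟩ := by
  simp [d, bdrySimp, eval, Finsupp.linearCombination_single]

theorem eval_d (f : Cochain X) (c : Sing X →₀ ℤ) : eval (d f) c = eval f (bdry X c) := by
  induction c using Finsupp.induction_linear with
  | zero => simp
  | add a b ha hb => simp [ha, hb]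
  | single σ k => simp [eval, bdry, Finsupp.linearCombination_single, d]

theorem eval_add (f g : Cochain X) (c : Sing X →₀ ℤ) : eval (f + g) c = eval f c + eval g c := by
  simp [eval, Finsupp.linearCombination_apply, Finsupp.sum, add_val, mul_add,
    Finset.sum_add_distrib]

theorem eval_neg (f : Cochain X) (c : Sing X →₀ ℤ) : eval (-f) c = - eval f c := by
  simp [eval, Finsupp.linearCombination_apply, Finsupp.sum, neg_val]

theorem d_add (f g : Cochain X) : d (f + g) = d f + d g := funext fun _ => eval_add _ _ _
theorem d_neg (f : Cochain X) : d (-f) = - d f := funext fun _ => eval_neg _ _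
theorem d_zero : d (0 : Cochain X) = 0 := by
  have := d_add (0 : Cochain X) 0
  simpa using this

protected theorem mul_assoc (f g h : Cochain X) : f * g * h = f * (g * h) := by
  ext n σ
  simp only [mul_val, Finset.sum_mul, Finset.mul_sum]
  rw [Finset.sum_sigma', Finset.sum_sigma']
  refine Finset.sum_nbij' (fun x => ⟨(x.2.1, x.2.2 + x.1.2), (x.2.2, x.1.2)⟩)
    (fun x => ⟨(x.1.1 + x.2.1, x.2.2), (x.1.1, x.2.1)⟩) ?_ ?_ ?_ ?_ ?_
  · rintro ⟨⟨i, j⟩, ⟨k, l⟩⟩ hx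
    simp only [Finset.mem_sigma, Finset.HasAntidiagonal.mem_antidiagonal, and_true] at hx ⊢
    omega
  · rintro ⟨⟨i, j⟩, ⟨k, l⟩⟩ hx
    simp only [Finset.mem_sigma, Finset.HasAntidiagonal.mem_antidiagonal, and_true] at hx ⊢
    omega
  · rintro ⟨⟨i, j⟩, ⟨k, l⟩⟩ hx
    simp only [Finset.mem_sigma, Finset.HasAntidiagonal.mem_antidiagonal] at hx ⊢
    obtain ⟨h1, rfl⟩ := hx
    rfl
  · rintro ⟨⟨i, j⟩, ⟨k, l⟩⟩ hx
    simp only [Finset.mem_sigma, Finset.HasAntidiagonal.mem_antidiagonal] at hx ⊢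
    obtain ⟨h1, rfl⟩ := hx
    rfl
  · rintro ⟨⟨i, j⟩, ⟨k, l⟩⟩ hx
    simp only [Finset.mem_sigma, Finset.HasAntidiagonal.mem_antidiagonal] at hx ⊢
    rw [Simp.pull_pull _ _ _ (by intro x hx; simp; omega),
      Simp.pull_pull _ _ _ (by intro x hx; omega),
      Simp.pull_pull _ _ _ (by intro x hx; simp; omega),
      Simp.pull_pull _ _ _ (by intro x hx; omega), mul_assoc]
    have e : σ.pull j (i + ·) = σ.pull j ((k + ·) ∘ (l + ·)) := by
      apply Simp.pull_congr
      intro x hx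
      simp only [Function.comp]
      congr 1
      omega
    rw [e]
    rfl

protected theorem one_mul (f : Cochain X) : 1 * f = f := by
  ext n σ
  rw [mul_val, Finset.sum_eq_single (0, n)]
  · rw [one_val, Simp.pull_id _ (by simp)]
    simp
  · rintro ⟨p, q⟩ h h'
    have : p ≠ 0 := by
      rintro rfl
      simp at h h'
      exact h' h
    simp [one_val, this]
  · simp

protected theorem mul_one (f : Cochain X) : f * 1 = f := by
  ext n σ
  rw [mul_val, Finset.sum_eq_single (n, 0)]
  · rw [one_val, Simp.pull_id _ (by simp)]
    simp
  · rintro ⟨p, q⟩ h h'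
    have : q ≠ 0 := by
      rintro rfl
      simp at h h'
      exact h' h
    simp [one_val, this]
  · simp

instance : Ring (Cochain X) :=
  { (inferInstance : AddCommGroup (Cochain X)) with
    mul := (· * ·)
    one := 1
    mul_assoc := Cochain.mul_assoc
    one_mul := Cochain.one_mul
    mul_one := Cochain.mul_one
    zero_mul := fun f => by ext n σ; simp [mul_val, zero_val]
    mul_zero := fun f => by ext n σ; simp [mul_val, zero_val]
    left_distrib := fun f g h => by
      ext n σ; simp [mul_val, add_val, mul_add, Finset.sum_add_distrib]
    right_distrib := fun f g h => by
      ext n σ; simp [mul_val, add_val, add_mul, Finset.sum_add_distrib] }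

/-- The grading involution: multiplication by `(-1)^n` in degree `n`. -/
def inv (f : Cochain X) : Cochain X := fun σ => (-1) ^ σ.1 * f σ

theorem inv_val (f : Cochain X) (σ : Sing X) : inv f σ = (-1) ^ σ.1 * f σ := rfl

theorem inv_zero : inv (0 : Cochain X) = 0 := by
  ext n σ
  simp [inv_val, zero_val]

theorem inv_inv (f : Cochain X) : inv (inv f) = f := by
  ext n σ
  simp [inv_val, ← mul_assoc, ← mul_pow]

theorem d_inv (f : Cochain X) : d (inv f) = - inv (d f) := by
  ext n σ
  cases n with
  | zero => simp [d_zero_dim, inv_val, neg_val]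
  | succ n =>
    simp only [d_succ, inv_val, neg_val, Finset.mul_sum, ← Finset.sum_neg_distrib]
    refine Finset.sum_congr rfl fun i _ => ?_
    rw [pow_succ]; ring

/-- The Leibniz rule. -/
theorem d_mul (f g : Cochain X) : d (f * g) = d f * g + inv f * d g := by
  ext n σ
  cases n with
  | zero => simp [add_val, mul_val, d_zero_dim]
  | succ n =>
    rw [d_succ, add_val, mul_val, mul_val, Finset.Nat.sum_antidiagonal_succ,
      Finset.Nat.sum_antidiagonal_succ']
    simp only [d_zero_dim, zero_mul, mul_zero, zero_add, mul_val, Finset.mul_sum]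
    rw [Finset.sum_comm, ← Finset.sum_add_distrib]
    refine Finset.sum_congr rfl fun ⟨p, q⟩ hp => ?_
    simp only [Finset.HasAntidiagonal.mem_antidiagonal] at hp
    subst hp
    simp only [d_succ, inv_val]
    have e1 : p + q + 2 = (p + 1) + (q + 1) := by ring
    rw [e1, Finset.sum_range_add, Finset.sum_range_succ _ (p + 1),
      Finset.sum_range_succ' _ (q + 1), add_mul, mul_add, Finset.sum_mul, Finset.mul_sum]
    have h1 : ∀ i ∈ Finset.range (p + 1),
        (-1) ^ i * (f ⟨p, (σ.pull (p + q) (skip i)).pull p id⟩ *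
          g ⟨q, (σ.pull (p + q) (skip i)).pull q (p + ·)⟩) =
        (-1) ^ i * f ⟨p, (σ.pull (p + 1) id).pull p (skip i)⟩ *
          g ⟨q, σ.pull q (p + 1 + ·)⟩ := by
      intro i hi
      rw [Finset.mem_range] at hi
      rw [Simp.pull_pull _ _ _ (by intro j hj; simp; omega),
        Simp.pull_pull _ _ _ (by intro j hj; simp; omega),
        Simp.pull_pull _ _ _ (by intro j hj; simp [skip]; split_ifs <;> omega), mul_assoc]
      congr 4
      apply Simp.pull_congr
      intro j hj
      simp only [Function.comp, skip]
      split_ifs <;> omega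
    have h2 : ∀ i ∈ Finset.range (q + 1),
        (-1) ^ (p + 1 + i) * (f ⟨p, (σ.pull (p + q) (skip (p + 1 + i))).pull p id⟩ *
          g ⟨q, (σ.pull (p + q) (skip (p + 1 + i))).pull q (p + ·)⟩) =
        (-1) ^ p * f ⟨p, σ.pull p id⟩ *
          ((-1) ^ (i + 1) * g ⟨q, (σ.pull (q + 1) (p + ·)).pull q (skip (i + 1))⟩) := by
      intro i hi
      rw [Finset.mem_range] at hi
      rw [Simp.pull_pull _ _ _ (by intro j hj; simp; omega),
        Simp.pull_pull _ _ _ (by intro j hj; simp; omega),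
        Simp.pull_pull _ _ _ (by intro j hj; simp [skip]; split_ifs <;> omega)]
      have a1 : σ.pull p (skip (p + 1 + i) ∘ id) = σ.pull p id := by
        apply Simp.pull_congr
        intro j hj
        simp only [Function.comp, skip, id]
        split_ifs <;> omega
      have a2 : σ.pull q (skip (p + 1 + i) ∘ (p + ·)) = σ.pull q ((p + ·) ∘ skip (i + 1)) := by
        apply Simp.pull_congr
        intro j hj
        simp only [Function.comp, skip]
        split_ifs <;> omega
      rw [a1, a2]
      ring
    rw [Finset.sum_congr rfl h1, Finset.sum_congr rfl h2]
    have h3 : (σ.pull (p + 1) id).pull p (skip (p + 1)) = σ.pull p id := by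
      rw [Simp.pull_pull _ _ _ (by intro j hj; simp [skip]; split_ifs <;> omega)]
      apply Simp.pull_congr
      intro j hj
      simp only [Function.comp, skip, id]
      split_ifs <;> omega
    have h4 : (σ.pull (q + 1) (p + ·)).pull q (skip 0) = σ.pull q (p + 1 + ·) := by
      rw [Simp.pull_pull _ _ _ (by intro j hj; simp [skip]; omega)]
      apply Simp.pull_congr
      intro j hj
      simp only [Function.comp, skip]
      split_ifs <;> omega
    rw [h3, h4, pow_succ]
    ring

/-- Pull-back of cochains along a continuous map. -/
def pullback (f : C(X, Y)) (c : Cochain Y) : Cochain X := fun σ => c (σ.push f)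

theorem pullback_apply (f : C(X, Y)) (c : Cochain Y) (n : ℕ) (σ : Simp n X) :
    pullback f c ⟨n, σ⟩ = c ⟨n, f.comp σ⟩ := rfl

theorem d_pullback (f : C(X, Y)) (c : Cochain Y) : d (pullback f c) = pullback f (d c) := by
  ext n σ
  cases n with
  | zero => simp [d_zero_dim, pullback_apply]
  | succ n => simp only [d_succ, pullback_apply]; rfl

theorem pullback_mul (f : C(X, Y)) (a b : Cochain Y) :
    pullback f (a * b) = pullback f a * pullback f b := rfl

theorem d_one : d (1 : Cochain X) = 0 := by
  have h := d_mul (1 : Cochain X) 1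
  have hi : inv (1 : Cochain X) = 1 := by
    ext n σ
    rw [inv_val, one_val]
    split_ifs with h0
    · simp at h0; simp [h0]
    · simp
  rw [hi, mul_one, mul_one, one_mul] at h
  simpa using h

end Cochain

/-! ### Singular cohomology -/

/-- The ring of singular cocycles. -/
def cocycles (X : Type*) [TopologicalSpace X] : Subring (Cochain X) where
  carrier := {f | f.d = 0}
  mul_mem' {f g} hf hg := by
    simp only [Set.mem_ofPred_eq] at hf hg ⊢
    simp [Cochain.d_mul, hf, hg]
  one_mem' := Cochain.d_one
  add_mem' {f g} hf hg := by
    simp only [Set.mem_ofPred_eq] at hf hg ⊢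
    simp [Cochain.d_add, hf, hg]
  zero_mem' := Cochain.d_zero
  neg_mem' {f} hf := by
    simp only [Set.mem_ofPred_eq] at hf ⊢
    simp [Cochain.d_neg, hf]

theorem cocycles_d (f : cocycles X) : (f : Cochain X).d = 0 := f.2

/-- The ideal of coboundaries in the ring of cocycles. -/
def coboundaries (X : Type*) [TopologicalSpace X] : TwoSidedIdeal (cocycles X) :=
  TwoSidedIdeal.mk' {f | ∃ g : Cochain X, g.d = f}
    ⟨0, Cochain.d_zero⟩
    (by rintro x y ⟨f, hf⟩ ⟨g, hg⟩; exact ⟨f + g, by simp [Cochain.d_add, hf, hg]⟩)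
    (by rintro x ⟨f, hf⟩; exact ⟨-f, by simp [Cochain.d_neg, hf]⟩)
    (by
      rintro x y ⟨g, hg⟩
      refine ⟨Cochain.inv x * g, ?_⟩
      simp [Cochain.d_mul, Cochain.d_inv, cocycles_d, Cochain.inv_inv, hg, Cochain.inv_zero])
    (by
      rintro x y ⟨g, hg⟩
      refine ⟨g * y, ?_⟩
      simp [Cochain.d_mul, cocycles_d, hg])

/-- Integral singular cohomology of `X`, with the cup product; all degrees together, that is,
the product over `n` of the groups `H^n(X; ℤ)`. -/
abbrev Coh (X : Type*) [TopologicalSpace X] : Type _ := (coboundaries X).ringCon.Quotient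

/-- The class of a cocycle. -/
def Coh.mk : cocycles X →+* Coh X := (coboundaries X).ringCon.mk'

theorem Coh.mk_eq_iff {f g : cocycles X} :
    Coh.mk f = Coh.mk g ↔ ∃ h : Cochain X, h.d = (f : Cochain X) - g := by
  refine (RingCon.eq _).trans ?_
  rfl

/-- `a` lies in `H^n(X; ℤ)`. -/
def Coh.InDegree (n : ℕ) (a : Coh X) : Prop :=
  ∃ f : cocycles X, Coh.mk f = a ∧ ∀ σ : Sing X, σ.1 ≠ n → (f : Cochain X) σ = 0

/-- Pull-back of cocycles. -/
def cocyclesPullback (φ : C(X, Y)) : cocycles Y →+* cocycles X where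
  toFun f := ⟨Cochain.pullback φ f, by
    change Cochain.d _ = 0
    rw [Cochain.d_pullback, cocycles_d]
    rfl⟩
  map_one' := rfl
  map_mul' _ _ := rfl
  map_zero' := rfl
  map_add' _ _ := rfl

/-- The homomorphism `φ^*` on cohomology. -/
def Coh.map (φ : C(X, Y)) : Coh Y →+* Coh X :=
  (coboundaries Y).ringCon.lift (Coh.mk.comp (cocyclesPullback φ)) (by
    rintro f g ⟨h, hh⟩
    refine Coh.mk_eq_iff.2 ⟨Cochain.pullback φ h, ?_⟩
    rw [Cochain.d_pullback, hh]
    rfl)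

/-! ### Relative cohomology of a pair `(X, A)` -/

/-- The cochains of `X` that vanish on the simplices contained in `A`. -/
def relCochains (A : Set X) : AddSubgroup (Cochain X) where
  carrier := {f | ∀ σ : Sing X, Set.range σ.2 ⊆ A → f σ = 0}
  zero_mem' _ _ := rfl
  add_mem' {f g} hf hg σ h := by rw [Cochain.add_val, hf σ h, hg σ h, add_zero]
  neg_mem' {f} hf σ h := by rw [Cochain.neg_val, hf σ h, neg_zero]

/-- The relative cocycles. -/
def relCocycles (A : Set X) : AddSubgroup (Cochain X) :=
  relCochains A ⊓ (cocycles X).toAddSubgroup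

/-- The coboundaries of relative cochains, inside the relative cocycles. -/
def relCoboundaries (A : Set X) : AddSubgroup (relCocycles A) where
  carrier := {f | ∃ g ∈ relCochains A, Cochain.d g = f}
  zero_mem' := ⟨0, zero_mem _, Cochain.d_zero⟩
  add_mem' := by
    rintro x y ⟨f, hf, hf'⟩ ⟨g, hg, hg'⟩
    exact ⟨f + g, add_mem hf hg, by simp [Cochain.d_add, hf', hg']⟩
  neg_mem' := by
    rintro x ⟨f, hf, hf'⟩
    exact ⟨-f, neg_mem hf, by simp [Cochain.d_neg, hf']⟩

/-- Integral singular cohomology of the pair `(X, A)`, all degrees together. -/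
abbrev RelCoh (A : Set X) : Type _ := relCocycles A ⧸ relCoboundaries A

/-- `u` lies in `H^n(X, A; ℤ)`. -/
def RelCoh.InDegree {A : Set X} (n : ℕ) (u : RelCoh A) : Prop :=
  ∃ f : relCocycles A, QuotientAddGroup.mk f = u ∧
    ∀ σ : Sing X, σ.1 ≠ n → (f : Cochain X) σ = 0

/-- The restriction `H^*(X, A; ℤ) → H^*(X; ℤ)`, induced by the inclusion `(X, ∅) → (X, A)`. -/
def RelCoh.toCoh {A : Set X} : RelCoh A →+ Coh X :=
  QuotientAddGroup.lift (relCoboundaries A)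
    ((Coh.mk : cocycles X →+* Coh X).toAddMonoidHom.comp
      (AddSubgroup.inclusion (inf_le_right : relCocycles A ≤ (cocycles X).toAddSubgroup))) (by
    rintro f ⟨g, -, hg⟩
    rw [AddMonoidHom.mem_ker, ← map_zero (Coh.mk : cocycles X →+* Coh X).toAddMonoidHom]
    exact Coh.mk_eq_iff.2 ⟨g, by rw [hg]; exact (sub_zero _).symm⟩)

/-! ### Homology and the pairings -/

/-- Integral singular homology of `X`, all degrees together. -/
abbrev Hml (X : Type*) [TopologicalSpace X] : Type _ :=
  LinearMap.ker (bdry X) ⧸ (LinearMap.range (bdry X)).comap (LinearMap.ker (bdry X)).subtype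

/-- `z` lies in `H_n(X; ℤ)`. -/
def Hml.InDegree (n : ℕ) (z : Hml X) : Prop :=
  ∃ c : LinearMap.ker (bdry X), Submodule.Quotient.mk c = z ∧
    ∀ σ : Sing X, σ.1 ≠ n → (c : Sing X →₀ ℤ) σ = 0

theorem eval_bdry_of_cocycle (f : cocycles X) (b : Sing X →₀ ℤ) :
    Cochain.eval (f : Cochain X) (bdry X b) = 0 := by
  rw [← Cochain.eval_d, cocycles_d]
  simp [Cochain.eval, Finsupp.linearCombination_apply, Cochain.zero_val]

/-- The pairing `⟨a, z⟩` of a cohomology class with a homology class. -/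
def pairing (a : Coh X) (z : Hml X) : ℤ :=
  Quotient.liftOn₂' a z
    (fun (f : cocycles X) (c : LinearMap.ker (bdry X)) =>
      Cochain.eval (f : Cochain X) (c : Sing X →₀ ℤ)) (by
    rintro f c f' c' ⟨g, hg⟩ hc
    obtain ⟨b, hb⟩ := QuotientAddGroup.leftRel_apply.1 hc
    have h1 : Cochain.eval (f : Cochain X) (c : Sing X →₀ ℤ) =
        Cochain.eval (f : Cochain X) (c' : Sing X →₀ ℤ) := by
      have := eval_bdry_of_cocycle f b
      rw [hb] at this
      simp at this
      linarith
    have h2 : (f : Cochain X) = f' + g.d := by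
      rw [hg]
      change (f : Cochain X) = f' + (f - f')
      abel
    change Cochain.eval (f : Cochain X) (c : Sing X →₀ ℤ) =
      Cochain.eval (f' : Cochain X) (c' : Sing X →₀ ℤ)
    rw [h1, h2, Cochain.eval_add, Cochain.eval_d, LinearMap.mem_ker.1 c'.2, map_zero, add_zero])

/-! ### The slant product -/

/-- The signed sum of `F` over all lattice paths from `(0, 0)` to `(p, q)` with unit steps to the
right or upwards, a path being given by the list of its vertices. The sign of a path is `-1` to the
number of pairs consisting of an upward step and a later step to the right, which is the sign
of the corresponding `(p, q)`-shuffle. -/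
def pathSum : ℕ → ℕ → (List (ℕ × ℕ) → ℤ) → ℤ
  | 0, 0, F => F [(0, 0)]
  | p + 1, 0, F => pathSum p 0 fun l => F ((0, 0) :: l.map (Prod.map Nat.succ id))
  | 0, q + 1, F => pathSum 0 q fun l => F ((0, 0) :: l.map (Prod.map id Nat.succ))
  | p + 1, q + 1, F =>
      (pathSum p (q + 1) fun l => F ((0, 0) :: l.map (Prod.map Nat.succ id))) +
      (-1) ^ (p + 1) * pathSum (p + 1) q fun l => F ((0, 0) :: l.map (Prod.map id Nat.succ))

theorem pathSum_congr (p q : ℕ) (F G : List (ℕ × ℕ) → ℤ)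
    (h : ∀ l : List (ℕ × ℕ), l ≠ [] → (∀ v ∈ l, v.1 ≤ p ∧ v.2 ≤ q) → F l = G l) :
    pathSum p q F = pathSum p q G := by
  have key1 : ∀ (p q : ℕ) (l : List (ℕ × ℕ)), (∀ v ∈ l, v.1 ≤ p ∧ v.2 ≤ q) →
      ∀ v ∈ (0, 0) :: l.map (Prod.map Nat.succ id), v.1 ≤ p + 1 ∧ v.2 ≤ q := by
    intro p q l hl v hv
    rcases List.mem_cons.1 hv with rfl | hv
    · simp
    · obtain ⟨w, hw, rfl⟩ := List.mem_map.1 hv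
      have := hl w hw
      simp; omega
  have key2 : ∀ (p q : ℕ) (l : List (ℕ × ℕ)), (∀ v ∈ l, v.1 ≤ p ∧ v.2 ≤ q) →
      ∀ v ∈ (0, 0) :: l.map (Prod.map id Nat.succ), v.1 ≤ p ∧ v.2 ≤ q + 1 := by
    intro p q l hl v hv
    rcases List.mem_cons.1 hv with rfl | hv
    · simp
    · obtain ⟨w, hw, rfl⟩ := List.mem_map.1 hv
      have := hl w hw
      simp; omega
  induction p, q, F using pathSum.induct generalizing G with
  | case1 F => rw [pathSum, pathSum]; exact h [(0, 0)] (by simp) (by simp)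
  | case2 p F ih =>
    rw [pathSum, pathSum]
    exact ih _ fun l _ hl => h _ (by simp) (key1 _ _ _ hl)
  | case3 q F ih =>
    rw [pathSum, pathSum]
    exact ih _ fun l _ hl => h _ (by simp) (key2 _ _ _ hl)
  | case4 p q F ih1 ih2 =>
    rw [pathSum, pathSum, ih1 _ fun l _ hl => h _ (by simp) (key1 _ _ _ hl),
      ih2 _ fun l _ hl => h _ (by simp) (key2 _ _ _ hl)]

theorem pathSum_add (p q : ℕ) (F G : List (ℕ × ℕ) → ℤ) :
    (pathSum p q fun l => F l + G l) = pathSum p q F + pathSum p q G := by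
  induction p, q, F using pathSum.induct generalizing G with
  | case1 F => simp only [pathSum]
  | case2 p F ih => simp only [pathSum, ih]
  | case3 q F ih => simp only [pathSum, ih]
  | case4 p q F ih1 ih2 => simp only [pathSum, ih1, ih2]; ring

theorem pathSum_mul (p q : ℕ) (k : ℤ) (F : List (ℕ × ℕ) → ℤ) :
    (pathSum p q fun l => k * F l) = k * pathSum p q F := by
  induction p, q, F using pathSum.induct with
  | case1 F => simp only [pathSum]
  | case2 p F ih => simp only [pathSum, ih]
  | case3 q F ih => simp only [pathSum, ih]
  | case4 p q F ih1 ih2 => simp only [pathSum, ih1, ih2]; ring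

theorem pathSum_sub (p q : ℕ) (F G : List (ℕ × ℕ) → ℤ) :
    (pathSum p q fun l => F l - G l) = pathSum p q F - pathSum p q G := by
  have := pathSum_add p q F fun l => (-1) * G l
  rw [pathSum_mul] at this
  simpa [sub_eq_add_neg] using this

theorem pathSum_sum {ι : Type*} (p q : ℕ) (s : Finset ι) (F : ι → List (ℕ × ℕ) → ℤ) :
    (pathSum p q fun l => ∑ i ∈ s, F i l) = ∑ i ∈ s, pathSum p q (F i) := by
  classical
  induction s using Finset.induction_on with
  | empty => simpa using pathSum_mul p q 0 fun _ => 0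
  | insert a s ha ih => simp only [Finset.sum_insert ha, pathSum_add, ih]

/-- The alternating sum of `F` over the lists obtained by omitting one entry. -/
def dList : (List (ℕ × ℕ) → ℤ) → List (ℕ × ℕ) → ℤ
  | _, [] => 0
  | F, v :: l => F l - dList (fun l => F (v :: l)) l

theorem dList_eq_sum (F : List (ℕ × ℕ) → ℤ) (l : List (ℕ × ℕ)) :
    dList F l = ∑ i ∈ Finset.range l.length, (-1) ^ i * F (l.eraseIdx i) := by
  induction l generalizing F with
  | nil => simp [dList]
  | cons v l ih =>
    rw [dList, ih, List.length_cons, Finset.sum_range_succ']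
    simp [pow_succ]
    ring

theorem dList_map (F : List (ℕ × ℕ) → ℤ) (s : ℕ × ℕ → ℕ × ℕ) (l : List (ℕ × ℕ)) :
    dList F (l.map s) = dList (fun l => F (l.map s)) l := by
  induction l generalizing F with
  | nil => rfl
  | cons v l ih => simp only [List.map_cons, dList, ih]

/-- Sum over the faces of the first factor. -/
def sumFst : ℕ → ℕ → (List (ℕ × ℕ) → ℤ) → ℤ
  | 0, _, _ => 0
  | p + 1, q, F => ∑ i ∈ Finset.range (p + 2),
      (-1) ^ i * pathSum p q fun l => F (l.map (Prod.map (skip i) id))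

/-- Sum over the faces of the second factor. -/
def sumSnd : ℕ → ℕ → (List (ℕ × ℕ) → ℤ) → ℤ
  | _, 0, _ => 0
  | p, q + 1, F => ∑ j ∈ Finset.range (q + 2),
      (-1) ^ j * pathSum p q fun l => F (l.map (Prod.map id (skip j)))

theorem map_skip_zero_fst (l : List (ℕ × ℕ)) :
    l.map (Prod.map (skip 0) id) = l.map (Prod.map Nat.succ id) := by
  congr 2

theorem map_skip_zero_snd (l : List (ℕ × ℕ)) :
    l.map (Prod.map id (skip 0)) = l.map (Prod.map id Nat.succ) := by
  congr 2

theorem skip_succ_succ (i x : ℕ) : skip (i + 1) (x + 1) = skip i x + 1 := by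
  simp only [skip]
  split_ifs <;> omega

theorem skip_succ_zero (i : ℕ) : skip (i + 1) 0 = 0 := by simp [skip]

theorem face_fst_fst (i : ℕ) (l : List (ℕ × ℕ)) :
    ((0, 0) :: l.map (Prod.map Nat.succ id)).map (Prod.map (skip (i + 1)) id) =
      (0, 0) :: (l.map (Prod.map (skip i) id)).map (Prod.map Nat.succ id) := by
  simp [skip_succ_zero, skip_succ_succ, Function.comp_def]

theorem face_fst_snd (i : ℕ) (l : List (ℕ × ℕ)) :
    ((0, 0) :: l.map (Prod.map id Nat.succ)).map (Prod.map (skip (i + 1)) id) =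
      (0, 0) :: (l.map (Prod.map (skip (i + 1)) id)).map (Prod.map id Nat.succ) := by
  simp [skip_succ_zero, Function.comp_def]

theorem face_snd_snd (i : ℕ) (l : List (ℕ × ℕ)) :
    ((0, 0) :: l.map (Prod.map id Nat.succ)).map (Prod.map id (skip (i + 1))) =
      (0, 0) :: (l.map (Prod.map id (skip i))).map (Prod.map id Nat.succ) := by
  simp [skip_succ_zero, skip_succ_succ, Function.comp_def]

theorem face_snd_fst (i : ℕ) (l : List (ℕ × ℕ)) :
    ((0, 0) :: l.map (Prod.map Nat.succ id)).map (Prod.map id (skip (i + 1))) =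
      (0, 0) :: (l.map (Prod.map id (skip (i + 1)))).map (Prod.map Nat.succ id) := by
  simp [skip_succ_zero, Function.comp_def]

theorem map_succ_comm (l : List (ℕ × ℕ)) :
    (l.map (Prod.map id Nat.succ)).map (Prod.map Nat.succ id) =
      (l.map (Prod.map Nat.succ id)).map (Prod.map id Nat.succ) := by
  simp [Function.comp_def]

theorem pathSum_dList_cons (p q : ℕ) (F : List (ℕ × ℕ) → ℤ) (s : ℕ × ℕ → ℕ × ℕ) :
    (pathSum p q fun l => dList F ((0, 0) :: l.map s)) =
      (pathSum p q fun l => F (l.map s)) -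
        pathSum p q (dList fun l => F ((0, 0) :: l.map s)) := by
  simp only [dList, pathSum_sub]
  congr 2
  funext l
  rw [dList_map]

theorem sumFst_succ (p q : ℕ) (F : List (ℕ × ℕ) → ℤ) :
    sumFst (p + 1) q F = (∑ i ∈ Finset.range (p + 1), (-1) ^ (i + 1) *
      pathSum p q fun l => F (l.map (Prod.map (skip (i + 1)) id))) +
      pathSum p q fun l => F (l.map (Prod.map Nat.succ id)) := by
  simp only [sumFst, Finset.sum_range_succ' _ (p + 1), map_skip_zero_fst, pow_zero, one_mul]

theorem sumSnd_succ (p q : ℕ) (F : List (ℕ × ℕ) → ℤ) :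
    sumSnd p (q + 1) F = (∑ i ∈ Finset.range (q + 1), (-1) ^ (i + 1) *
      pathSum p q fun l => F (l.map (Prod.map id (skip (i + 1))))) +
      pathSum p q fun l => F (l.map (Prod.map id Nat.succ)) := by
  simp only [sumSnd, Finset.sum_range_succ' _ (q + 1), map_skip_zero_snd, pow_zero, one_mul]

/-- The boundary formula for the sum over lattice paths. -/
theorem pathSum_dList (p q : ℕ) (F : List (ℕ × ℕ) → ℤ) (h : p ≠ 0 ∨ q ≠ 0) :
    pathSum p q (dList F) = sumFst p q F + (-1) ^ p * sumSnd p q F := by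
  induction p, q, F using pathSum.induct with
  | case1 F => simp at h
  | case2 p F ih =>
    rw [pathSum, pathSum_dList_cons]
    cases p with
    | zero =>
      simp [sumFst, sumSnd, Finset.sum_range_succ, pathSum, dList, skip]
      ring
    | succ p =>
      have H : ∑ i ∈ Finset.range (p + 1 + 1), (-1) ^ (i + 1) *
          (pathSum (p + 1) 0 fun l => F (l.map (Prod.map (skip (i + 1)) id))) =
          - sumFst (p + 1) 0 (fun l => F ((0, 0) :: l.map (Prod.map Nat.succ id))) := by
        rw [sumFst, ← Finset.sum_neg_distrib]
        refine Finset.sum_congr rfl fun i _ => ?_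
        rw [pathSum]
        simp only [face_fst_fst]
        ring
      rw [ih (by simp), sumFst_succ (p + 1), H, sumSnd, sumSnd]
      ring
  | case3 q F ih =>
    rw [pathSum, pathSum_dList_cons]
    cases q with
    | zero =>
      simp [sumFst, sumSnd, Finset.sum_range_succ, pathSum, dList, skip]
      ring
    | succ q =>
      have H : ∑ i ∈ Finset.range (q + 1 + 1), (-1) ^ (i + 1) *
          (pathSum 0 (q + 1) fun l => F (l.map (Prod.map id (skip (i + 1))))) =
          - sumSnd 0 (q + 1) (fun l => F ((0, 0) :: l.map (Prod.map id Nat.succ))) := by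
        rw [sumSnd, ← Finset.sum_neg_distrib]
        refine Finset.sum_congr rfl fun i _ => ?_
        rw [pathSum]
        simp only [face_snd_snd]
        ring
      rw [ih (by simp), sumSnd_succ _ (q + 1), H, sumFst, sumFst]
      ring
  | case4 p q F ih1 ih2 =>
    have H1 : ∑ i ∈ Finset.range (p + 1), (-1) ^ (i + 1) *
          (pathSum p (q + 1) fun l => F (l.map (Prod.map (skip (i + 1)) id))) =
        - sumFst p (q + 1) (fun l => F ((0, 0) :: l.map (Prod.map Nat.succ id))) +
        (-1) ^ p * ∑ i ∈ Finset.range (p + 1), (-1) ^ (i + 1) * (pathSum p q fun l =>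
          F ((0, 0) :: (l.map (Prod.map (skip (i + 1)) id)).map (Prod.map id Nat.succ))) := by
      cases p with
      | zero =>
        simp only [zero_add, Finset.sum_range_one, sumFst, neg_zero, pow_zero, one_mul]
        rw [pathSum]
        simp only [face_fst_snd]
      | succ p =>
        rw [Finset.sum_congr rfl fun i _ => by rw [pathSum], sumFst]
        simp only [face_fst_snd, face_fst_fst, mul_add, Finset.sum_add_distrib, Finset.mul_sum,
          ← Finset.sum_neg_distrib]
        congr 1 <;> refine Finset.sum_congr rfl fun i _ => by ring
    have H2 : ∑ j ∈ Finset.range (q + 1), (-1) ^ (j + 1) *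
          (pathSum (p + 1) q fun l => F (l.map (Prod.map id (skip (j + 1))))) =
        (∑ j ∈ Finset.range (q + 1), (-1) ^ (j + 1) * (pathSum p q fun l =>
          F ((0, 0) :: (l.map (Prod.map id (skip (j + 1)))).map (Prod.map Nat.succ id)))) -
        (-1) ^ (p + 1) *
          sumSnd (p + 1) q (fun l => F ((0, 0) :: l.map (Prod.map id Nat.succ))) := by
      cases q with
      | zero =>
        simp only [zero_add, Finset.sum_range_one, sumSnd, mul_zero, sub_zero]
        rw [pathSum]
        simp only [face_snd_fst, zero_add]
      | succ q =>
        rw [Finset.sum_congr rfl fun i _ => by rw [pathSum], sumSnd]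
        simp only [face_snd_fst, face_snd_snd, mul_add, Finset.sum_add_distrib, Finset.mul_sum,
          sub_eq_add_neg, ← Finset.sum_neg_distrib]
        congr 1; refine Finset.sum_congr rfl fun i _ => by ring
    rw [pathSum, pathSum_dList_cons, pathSum_dList_cons, ih1 (by simp), ih2 (by simp)]
    rw [sumFst_succ p (q + 1), sumSnd_succ (p + 1) q, sumSnd_succ p q, sumFst_succ p q, H1, H2]
    simp only [map_succ_comm]
    rw [pow_succ]
    ring

/-- The simplex of `X × Y` with components `σ` and `τ`, precomposed with the affine maps sending the
`i`-th vertex to the first, respectively second, coordinate of the `i`-th entry of `l`. -/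
def prodSimp {p q : ℕ} (σ : Simp p X) (τ : Simp q Y) (l : List (ℕ × ℕ)) : Sing (X × Y) :=
  ⟨l.length - 1, (σ.pull (l.length - 1) fun i => (l.getD i (0, 0)).1).prodMk
    (τ.pull (l.length - 1) fun i => (l.getD i (0, 0)).2)⟩

/-- The slant product `f / τ` of a cochain on `X × Y` with a simplex `τ` of `Y`: its value on `σ` is
the value of `f` on the Eilenberg–Zilber shuffle product of `σ` and `τ`. -/
def slantSimp (f : Cochain (X × Y)) (τ : Sing Y) : Cochain X :=
  fun σ => pathSum σ.1 τ.1 fun l => f (prodSimp σ.2 τ.2 l)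

theorem d_prodSimp {p q : ℕ} (f : Cochain (X × Y)) (σ : Simp p X) (τ : Simp q Y)
    (l : List (ℕ × ℕ)) (hl : l ≠ []) :
    f.d (prodSimp σ τ l) = dList (fun l => if l = [] then 0 else f (prodSimp σ τ l)) l := by
  rw [dList_eq_sum]
  match l, hl with
  | [v], _ =>
    rw [prodSimp]
    simp [Cochain.d_zero_dim]
  | v :: w :: l, _ =>
    have h0 : prodSimp σ τ (v :: w :: l) = ⟨l.length + 1,
      (σ.pull (l.length + 1) fun i => ((v :: w :: l).getD i (0, 0)).1).prodMk
      (τ.pull (l.length + 1) fun i => ((v :: w :: l).getD i (0, 0)).2)⟩ := rfl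
    rw [h0, Cochain.d_succ]
    refine Finset.sum_congr rfl fun i hi => ?_
    have hi : i < (v :: w :: l).length := Finset.mem_range.1 hi
    have hlen : ((v :: w :: l).eraseIdx i).length = l.length + 1 := by
      rw [List.length_eraseIdx_of_lt hi]; rfl
    have hne : (v :: w :: l).eraseIdx i ≠ [] := by
      intro h; rw [h] at hlen; simp at hlen
    rw [if_neg hne]
    congr 2
    have gen : ∀ n, n = l.length →
        (⟨l.length, Simp.pull ((σ.pull (l.length + 1) fun i => ((v :: w :: l).getD i (0, 0)).1).prodMk
          (τ.pull (l.length + 1) fun i => ((v :: w :: l).getD i (0, 0)).2)) l.length (skip i)⟩ :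
            Sing (X × Y)) =
        ⟨n, (σ.pull n fun j => (((v :: w :: l).eraseIdx i).getD j (0, 0)).1).prodMk
          (τ.pull n fun j => (((v :: w :: l).eraseIdx i).getD j (0, 0)).2)⟩ := by
      rintro n rfl
      have hg : ∀ j ≤ l.length, (v :: w :: l).getD (skip i j) (0, 0) =
          ((v :: w :: l).eraseIdx i).getD j (0, 0) := by
        intro j hj
        rw [List.getD_eq_getElem?_getD, List.getD_eq_getElem?_getD, List.getElem?_eraseIdx, skip]
        split_ifs <;> rfl
      have hs : ∀ j ≤ l.length, skip i j ≤ l.length + 1 := by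
        intro j hj; rw [skip]; split_ifs <;> omega
      have e1 := Simp.pull_pull σ (fun i => ((v :: w :: l).getD i (0, 0)).1) (skip i) hs
      have e2 := Simp.pull_pull τ (fun i => ((v :: w :: l).getD i (0, 0)).2) (skip i) hs
      have e1' := σ.pull_congr (m := l.length)
        (a := (fun i => ((v :: w :: l).getD i (0, 0)).1) ∘ skip i)
        (b := fun j => (((v :: w :: l).eraseIdx i).getD j (0, 0)).1)
        (fun j hj => by simp only [Function.comp, hg j hj])
      have e2' := τ.pull_congr (m := l.length)
        (a := (fun i => ((v :: w :: l).getD i (0, 0)).2) ∘ skip i)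
        (b := fun j => (((v :: w :: l).eraseIdx i).getD j (0, 0)).2)
        (fun j hj => by simp only [Function.comp, hg j hj])
      rw [← e1', ← e2', ← e1, ← e2]
      rfl
    exact gen _ (by rw [hlen]; rfl)

theorem prodSimp_map {p q p' q' : ℕ} (σ : Simp p X) (τ : Simp q Y) (a b : ℕ → ℕ)
    (l : List (ℕ × ℕ)) (hl : l ≠ []) (hl' : ∀ v ∈ l, v.1 ≤ p' ∧ v.2 ≤ q') :
    prodSimp σ τ (l.map (Prod.map a b)) = prodSimp (σ.pull p' a) (τ.pull q' b) l := by
  have hpos : 0 < l.length := List.length_pos_iff.2 hl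
  have hg : ∀ i ≤ l.length - 1, ∃ v ∈ l, l.getD i (0, 0) = v ∧
      (l.map (Prod.map a b)).getD i (0, 0) = (a v.1, b v.2) := by
    intro i hi
    have hi' : i < l.length := by omega
    refine ⟨l[i], List.getElem_mem _, ?_, ?_⟩
    · rw [List.getD_eq_getElem _ _ hi']
    · rw [List.getD_eq_getElem _ _ (by simpa using hi')]
      simp [Prod.map]
  have gen : ∀ n, n = l.length - 1 →
      (⟨n, (σ.pull n fun i => ((l.map (Prod.map a b)).getD i (0, 0)).1).prodMk
        (τ.pull n fun i => ((l.map (Prod.map a b)).getD i (0, 0)).2)⟩ : Sing (X × Y)) =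
      prodSimp (σ.pull p' a) (τ.pull q' b) l := by
    rintro n rfl
    rw [prodSimp, Simp.pull_pull, Simp.pull_pull]
    · rw [σ.pull_congr (m := l.length - 1) (b := a ∘ fun i => (l.getD i (0, 0)).1),
        τ.pull_congr (m := l.length - 1) (b := b ∘ fun i => (l.getD i (0, 0)).2)]
      · intro i hi
        obtain ⟨v, -, h1, h2⟩ := hg i hi
        simp only [Function.comp, h1, h2]
      · intro i hi
        obtain ⟨v, -, h1, h2⟩ := hg i hi
        simp only [Function.comp, h1, h2]
    · intro i hi
      obtain ⟨v, hv, h1, -⟩ := hg i hi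
      rw [h1]; exact (hl' v hv).2
    · intro i hi
      obtain ⟨v, hv, h1, -⟩ := hg i hi
      rw [h1]; exact (hl' v hv).1
  exact gen _ (by simp)

/-- The coboundary of a slant product. -/
theorem slantSimp_d (f : Cochain (X × Y)) (σ : Sing X) (τ : Sing Y) :
    slantSimp f.d τ σ = (slantSimp f τ).d σ +
      (-1) ^ σ.1 * Finsupp.linearCombination ℤ (fun τ' => slantSimp f τ' σ) (bdrySimp τ) := by
  obtain ⟨p, σ⟩ := σ
  obtain ⟨q, τ⟩ := τ
  set F : List (ℕ × ℕ) → ℤ := fun l => if l = [] then 0 else f (prodSimp σ τ l) with hF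
  have h0 : slantSimp f.d ⟨q, τ⟩ ⟨p, σ⟩ = pathSum p q (dList F) :=
    pathSum_congr _ _ _ _ fun l hl _ => d_prodSimp f σ τ l hl
  have h1 : sumFst p q F = (slantSimp f ⟨q, τ⟩).d ⟨p, σ⟩ := by
    cases p with
    | zero => rw [Cochain.d_zero_dim, sumFst]
    | succ p =>
      rw [Cochain.d_succ, sumFst]
      refine Finset.sum_congr rfl fun i _ => ?_
      congr 1
      refine pathSum_congr _ _ _ _ fun l hl hl' => ?_
      simp only [hF, List.map_eq_nil_iff, hl, if_false]
      rw [prodSimp_map (p' := p) (q' := q) σ τ _ _ l hl hl', Simp.pull_id τ (by simp)]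
  have h2 : sumSnd p q F =
      Finsupp.linearCombination ℤ (fun τ' => slantSimp f τ' ⟨p, σ⟩) (bdrySimp ⟨q, τ⟩) := by
    cases q with
    | zero => simp [bdrySimp, sumSnd]
    | succ q =>
      simp only [bdrySimp, map_sum, Finsupp.linearCombination_single, smul_eq_mul, sumSnd]
      refine Finset.sum_congr rfl fun i _ => ?_
      congr 1
      refine pathSum_congr _ _ _ _ fun l hl hl' => ?_
      simp only [hF, List.map_eq_nil_iff, hl, if_false]
      rw [prodSimp_map (p' := p) (q' := q) σ τ _ _ l hl hl', Simp.pull_id σ (by simp)]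
  rw [h0, ← h1, ← h2]
  by_cases h : p ≠ 0 ∨ q ≠ 0
  · exact pathSum_dList p q F h
  · push Not at h
    obtain ⟨rfl, rfl⟩ := h
    simp [pathSum, dList, sumFst, sumSnd, hF]

/-- The slant product of a cochain on `X × Y` with a chain on `Y`. -/
def slantChain (f : Cochain (X × Y)) (z : Sing Y →₀ ℤ) : Cochain X :=
  fun σ => Finsupp.linearCombination ℤ (fun τ => slantSimp f τ σ) z

theorem slantChain_d (f : Cochain (X × Y)) (z : Sing Y →₀ ℤ) :
    slantChain f.d z = (slantChain f z).d + (slantChain f (bdry Y z)).inv := by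
  induction z using Finsupp.induction_linear with
  | zero =>
    have h (g : Cochain (X × Y)) : slantChain g 0 = 0 := by
      funext σ; exact map_zero (Finsupp.linearCombination ℤ (fun τ => slantSimp g τ σ))
    simp [h, Cochain.d_zero, Cochain.inv_zero]
  | add a b ha hb =>
    have h (g : Cochain (X × Y)) (a b) : slantChain g (a + b) = slantChain g a + slantChain g b := by
      funext σ; exact map_add (Finsupp.linearCombination ℤ (fun τ => slantSimp g τ σ)) _ _
    have hi (u v : Cochain X) : (u + v).inv = u.inv + v.inv := by
      funext σ; exact mul_add _ _ _
    rw [h, h, map_add, h, ha, hb, hi, Cochain.d_add]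
    abel
  | single τ k =>
    funext σ
    have h (g : Cochain (X × Y)) : slantChain g (Finsupp.single τ k) = k • slantSimp g τ := by
      funext σ
      exact Finsupp.linearCombination_single ℤ k τ
    have hd : (k • slantSimp f τ).d σ = k * (slantSimp f τ).d σ := by
      simp only [Cochain.d, Cochain.eval, Finsupp.linearCombination_apply, Finsupp.sum,
        Finset.mul_sum]
      refine Finset.sum_congr rfl fun x _ => ?_
      change _ • (k * _) = k * (_ • _)
      simp only [smul_eq_mul]
      ring
    have hb : bdry Y (Finsupp.single τ k) = k • bdrySimp τ :=
      Finsupp.linearCombination_single ℤ k τ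
    rw [h, h, Cochain.add_val, hd, hb, Cochain.inv_val]
    change k * slantSimp f.d τ σ = _ + _ * Finsupp.linearCombination ℤ _ (k • _)
    rw [slantSimp_d, map_smul, smul_eq_mul]
    ring

theorem slantChain_add_left (f g : Cochain (X × Y)) (z : Sing Y →₀ ℤ) :
    slantChain (f + g) z = slantChain f z + slantChain g z := by
  funext σ
  change Finsupp.linearCombination ℤ (fun τ => slantSimp (f + g) τ σ) z =
    Finsupp.linearCombination ℤ (fun τ => slantSimp f τ σ) z +
      Finsupp.linearCombination ℤ (fun τ => slantSimp g τ σ) z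
  simp only [Finsupp.linearCombination_apply, Finsupp.sum, ← Finset.sum_add_distrib, ← smul_add]
  refine Finset.sum_congr rfl fun τ _ => ?_
  congr 1
  exact pathSum_add _ _ _ _

theorem slantChain_add_right (f : Cochain (X × Y)) (z w : Sing Y →₀ ℤ) :
    slantChain f (z + w) = slantChain f z + slantChain f w := by
  funext σ
  exact map_add (Finsupp.linearCombination ℤ (fun τ => slantSimp f τ σ)) _ _

theorem slantChain_zero_left (z : Sing Y →₀ ℤ) : slantChain (0 : Cochain (X × Y)) z = 0 := by
  have := slantChain_add_left (0 : Cochain (X × Y)) 0 z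
  simpa using this

theorem slantChain_zero_right (f : Cochain (X × Y)) : slantChain f 0 = 0 := by
  have := slantChain_add_right f 0 0
  simpa using this

theorem slantChain_mem (f : cocycles (X × Y)) (z : LinearMap.ker (bdry Y)) :
    slantChain (f : Cochain (X × Y)) (z : Sing Y →₀ ℤ) ∈ cocycles X := by
  have h := slantChain_d (f : Cochain (X × Y)) (z : Sing Y →₀ ℤ)
  rw [cocycles_d, LinearMap.mem_ker.1 z.2, slantChain_zero_left, slantChain_zero_right,
    Cochain.inv_zero, add_zero] at h
  exact h.symm

/-- The slant product of a cocycle on `X × Y` with a cycle on `Y`. -/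
def slantCocycle (f : cocycles (X × Y)) (z : LinearMap.ker (bdry Y)) : cocycles X :=
  ⟨slantChain (f : Cochain (X × Y)) (z : Sing Y →₀ ℤ), slantChain_mem f z⟩

/-- The slant product `y / z ∈ H^{n-q}(X)` of a class `y ∈ H^n(X × Y)` with a homology class
`z ∈ H_q(Y)`, that is, integration of `y` over `z` along the fibres of `X × Y → X`. -/
def slant (y : Coh (X × Y)) (z : Hml Y) : Coh X :=
  Quotient.liftOn₂' y z
    (fun (f : cocycles (X × Y)) (c : LinearMap.ker (bdry Y)) => Coh.mk (slantCocycle f c)) (by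
    rintro f c f' c' ⟨g, hg⟩ hc
    obtain ⟨b, hb⟩ := QuotientAddGroup.leftRel_apply.1 hc
    refine Coh.mk_eq_iff.2
      ⟨slantChain g (c : Sing Y →₀ ℤ) - (slantChain (f' : Cochain (X × Y)) b).inv, ?_⟩
    have h1 : (f : Cochain (X × Y)) = f' + g.d := by
      rw [hg]
      change (f : Cochain (X × Y)) = f' + (f - f')
      abel
    have h2 : (c' : Sing Y →₀ ℤ) = c + bdry Y b := by
      rw [hb]
      simp
    have h3 := slantChain_d g (c : Sing Y →₀ ℤ)
    rw [LinearMap.mem_ker.1 c.2, slantChain_zero_right, Cochain.inv_zero, add_zero] at h3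
    have h4 := slantChain_d (f' : Cochain (X × Y)) b
    rw [cocycles_d, slantChain_zero_left] at h4
    have h5 : (slantChain (f' : Cochain (X × Y)) b).inv.d =
        slantChain (f' : Cochain (X × Y)) (bdry Y b) := by
      have h6 := congrArg Cochain.inv (eq_neg_of_add_eq_zero_right h4.symm)
      rw [Cochain.inv_inv] at h6
      rw [h6, Cochain.d_inv]
      funext σ
      simp [Cochain.neg_val, Cochain.inv_val]
    change _ = slantChain (f : Cochain (X × Y)) (c : Sing Y →₀ ℤ) -
      slantChain (f' : Cochain (X × Y)) (c' : Sing Y →₀ ℤ)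
    rw [h1, h2, slantChain_add_left, slantChain_add_right, sub_eq_add_neg, Cochain.d_add,
      Cochain.d_neg, h3, h5]
    abel)

/-! ### Thom classes and Euler classes of complex vector bundles -/

/-- The affine simplex in `ℂ^r` with barycentre `0` and vertices `v₀ = -∑ⱼ wⱼ`, `vⱼ = wⱼ`, where
`w₁, …, w₂ᵣ` is the real basis `e₁, i e₁, …, e_r, i e_r`. It is positively oriented for the complex
orientation of `ℂ^r`, hence represents the preferred generator of `H_{2r}(ℂ^r, ℂ^r ∖ 0; ℤ)`. -/
def orientedSimp (r : ℕ) : Simp (2 * r) (Fin r → ℂ) where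
  toFun t := fun a =>
    ((t ⟨2 * a + 1, by omega⟩ - t 0 : ℝ) : ℂ) + ((t ⟨2 * a + 2, by omega⟩ - t 0 : ℝ) : ℂ) * Complex.I
  continuous_toFun := by
    have h : ∀ i : Fin (2 * r + 1), Continuous fun t : stdSimplex ℝ (Fin (2 * r + 1)) => t i :=
      fun i => (continuous_apply i).comp continuous_subtype_val
    exact continuous_pi fun a => ((Complex.continuous_ofReal.comp ((h _).sub (h _))).add
      ((Complex.continuous_ofReal.comp ((h _).sub (h _))).mul continuous_const))

/-- Let `T` be the total space of a complex vector bundle of rank `r`, `T₀` the complement of the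
zero section, and `frames` the set of all continuous maps `ℂ^r → T` that are linear isomorphisms onto
some fibre. `u` is the Thom class: it has degree `2r`, and its restriction to each fibre is
the generator given by the complex orientation. -/
def IsThomClass {T : Type*} [TopologicalSpace T] (r : ℕ) (T₀ : Set T)
    (frames : Set C(Fin r → ℂ, T)) (u : RelCoh T₀) : Prop :=
  RelCoh.InDegree (2 * r) u ∧
    ∀ f : relCocycles T₀, QuotientAddGroup.mk f = u →
      ∀ φ ∈ frames, (f : Cochain T) ⟨2 * r, φ.comp (orientedSimp r)⟩ = 1

/-- `e ∈ H^{2r}(B; ℤ)` is the Euler class (top Chern class) of the complex vector bundle `p : T → B`: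
the class with `p^* e = u|_T`, where `u` is the Thom class. -/
def IsEulerClass {T B : Type*} [TopologicalSpace T] [TopologicalSpace B] (r : ℕ) (p : C(T, B))
    (T₀ : Set T) (frames : Set C(Fin r → ℂ, T)) (e : Coh B) : Prop :=
  ∃ u : RelCoh T₀, IsThomClass r T₀ frames u ∧ Coh.map p e = RelCoh.toCoh u

/-! ### Chern classes and Segre classes -/

section Chern

open Bundle

/-- Scalar multiplication on the total space. -/
def scale {M : Type*} (F : Type*) (N : M → Type*) [∀ x, AddCommGroup (N x)] [∀ x, Module ℂ (N x)]
    (z : ℂ) (v : TotalSpace F N) : TotalSpace F N := ⟨v.proj, z • v.snd⟩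

theorem scale_one {M : Type*} (F : Type*) (N : M → Type*) [∀ x, AddCommGroup (N x)]
    [∀ x, Module ℂ (N x)] (v : TotalSpace F N) : scale F N 1 v = v := by
  simp [scale]

theorem scale_scale {M : Type*} (F : Type*) (N : M → Type*) [∀ x, AddCommGroup (N x)]
    [∀ x, Module ℂ (N x)] (z w : ℂ) (v : TotalSpace F N) :
    scale F N z (scale F N w v) = scale F N (z * w) v := by
  change (⟨v.proj, z • (w • v.snd)⟩ : TotalSpace F N) = ⟨v.proj, (z * w) • v.snd⟩
  rw [mul_smul]

variable {M : Type*} [TopologicalSpace M] (F : Type*) [NormedAddCommGroup F] [NormedSpace ℂ F]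
  (N : M → Type*) [TopologicalSpace (TotalSpace F N)] [∀ x, AddCommGroup (N x)]
  [∀ x, Module ℂ (N x)]

/-- The complement of the zero section. -/
def nonzero : Set (TotalSpace F N) := {v | v.snd ≠ 0}

/-- Two nonzero vectors are identified if they span the same line. -/
def projSetoid : Setoid (nonzero F N) where
  r v w := ∃ z : ℂ, z ≠ 0 ∧ (w : TotalSpace F N) = scale F N z v
  iseqv :=
    { refl := fun v => ⟨1, one_ne_zero, (scale_one F N _).symm⟩
      symm := by
        rintro v w ⟨z, hz, h⟩
        refine ⟨z⁻¹, inv_ne_zero hz, ?_⟩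
        rw [h, scale_scale, inv_mul_cancel₀ hz, scale_one]
      trans := by
        rintro u v w ⟨z, hz, h⟩ ⟨z', hz', h'⟩
        refine ⟨z' * z, mul_ne_zero hz' hz, ?_⟩
        rw [h', h, scale_scale] }

/-- The projective bundle `P(N)` of lines in the fibres of `N`. -/
abbrev ProjBundle : Type _ := Quotient (projSetoid F N)

/-- The total space of the tautological line bundle over `P(N)`: pairs of a line and a vector on that
line. -/
def Taut : Set (ProjBundle F N × TotalSpace F N) :=
  {q | ∃ (v : nonzero F N) (z : ℂ), q = (Quotient.mk _ v, scale F N z v)}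

/-- The projection of the tautological line bundle. -/
def tautProj : C(Taut F N, ProjBundle F N) :=
  ⟨fun q => q.1.1, continuous_fst.comp continuous_subtype_val⟩

/-- The complement of the zero section of the tautological line bundle. -/
def tautNonzero : Set (Taut F N) := {q | q.1.2.snd ≠ 0}

/-- The linear isomorphisms from `ℂ` to the fibres of the tautological line bundle. -/
def tautFrames : Set C(Fin 1 → ℂ, Taut F N) :=
  {φ | ∃ v : nonzero F N, ∀ z, (φ z : ProjBundle F N × TotalSpace F N) =
    (Quotient.mk _ v, scale F N (z 0) v)}

variable [∀ x, TopologicalSpace (N x)] [FiberBundle F N]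

/-- The projection `P(N) → M`. -/
def projBundleProj : C(ProjBundle F N, M) where
  toFun := Quotient.lift (fun v : nonzero F N => (v : TotalSpace F N).proj) (by
    rintro v w ⟨z, -, h⟩
    rw [h]
    rfl)
  continuous_toFun :=
    ((FiberBundle.continuous_proj F N).comp continuous_subtype_val).quotient_lift _

/-- `c i` is the `i`-th Chern class of the complex vector bundle `N` of rank `r`, for all `i`: one has
`c 0 = 1`, `c i = 0` for `i > r`, and `∑ c_i(N) ζ^{r-i} = 0` in `H^*(P(N); ℤ)`, where
`ζ = -c₁(L)` for the tautological line bundle `L`. -/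
structure IsChernClasses (r : ℕ) (c : ℕ → Coh M) : Prop where
  zero : c 0 = 1
  degree : ∀ i, Coh.InDegree (2 * i) (c i)
  vanish : ∀ i, r < i → c i = 0
  relation : ∃ e : Coh (ProjBundle F N),
    IsEulerClass 1 (tautProj F N) (tautNonzero F N) (tautFrames F N) e ∧
    ∑ i ∈ Finset.range (r + 1), Coh.map (projBundleProj F N) (c i) * (-e) ^ (r - i) = 0

end Chern

/-- The Segre classes: the components of the inverse of the total Chern class `∑ c i`. -/
def segre {R : Type*} [Ring R] (c : ℕ → R) : ℕ → R
  | 0 => 1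
  | n + 1 => - ∑ i : Fin (n + 1), segre c i * c (n + 1 - i)

theorem sum_segre_mul {R : Type*} [Ring R] (c : ℕ → R) (h : c 0 = 1) (n : ℕ) :
    ∑ i ∈ Finset.range (n + 1), segre c i * c (n - i) = if n = 0 then 1 else 0 := by
  cases n with
  | zero => simp [segre, h]
  | succ n =>
    rw [Finset.sum_range_succ, segre, Finset.sum_range]
    simp [h]

/-! ### The universal circle bundle and the Borel construction -/

/-- `E → E / S¹` is a universal circle bundle: it is a principal circle bundle (locally there is
an equivariant map to the circle) and `E` is contractible. -/
structure IsUniversalCircleBundle (E : Type*) [TopologicalSpace E] [MulAction Circle E] : Prop where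
  continuous_smul : Continuous fun q : Circle × E => q.1 • q.2
  contractible : ContractibleSpace E
  locally_trivial : ∀ e : E, ∃ U : Set E, IsOpen U ∧ e ∈ U ∧ (∀ g : Circle, ∀ x ∈ U, g • x ∈ U) ∧
    ∃ s : E → Circle, ContinuousOn s U ∧ ∀ g : Circle, ∀ x ∈ U, s (g • x) = g * s x

section Borel

open Bundle

variable (E : Type*) [TopologicalSpace E] [MulAction Circle E]

/-- The classifying space `BS¹ = ES¹ / S¹`. -/
abbrev BS : Type _ := Quotient (MulAction.orbitRel Circle E)

/-- For an action `ρ` of the circle on `Y`, the orbit relation of the diagonal action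
`g (e, y) = (g e, ρ(g) y)` on `E × Y`. -/
def borelSetoid {Y : Type*} (ρ : Circle →* Function.End Y) : Setoid (E × Y) where
  r a b := ∃ g : Circle, b = (g • a.1, ρ g a.2)
  iseqv :=
    { refl := fun a => ⟨1, by rw [map_one, one_smul]; rfl⟩
      symm := by
        rintro a b ⟨g, rfl⟩
        refine ⟨g⁻¹, ?_⟩
        have : ρ g⁻¹ (ρ g a.2) = (ρ g⁻¹ * ρ g) a.2 := rfl
        rw [this, ← map_mul, inv_mul_cancel, map_one, inv_smul_smul]
        rfl
      trans := by
        rintro a b c ⟨g, rfl⟩ ⟨g', rfl⟩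
        refine ⟨g' * g, ?_⟩
        rw [map_mul, mul_smul]
        rfl }

/-- The quotient `E ×_{S¹} Y` of `E × Y` by the diagonal action. -/
abbrev Borel {Y : Type*} (ρ : Circle →* Function.End Y) : Type _ := Quotient (borelSetoid E ρ)

variable {Y : Type*} [TopologicalSpace Y]

/-- The projection `E ×_{S¹} Y → BS¹`. -/
def borelProj (ρ : Circle →* Function.End Y) : C(Borel E ρ, BS E) where
  toFun := Quotient.lift (fun a : E × Y => (Quotient.mk _ a.1 : BS E)) (by
    rintro a b ⟨g, rfl⟩
    exact Quotient.sound' ⟨g⁻¹, by simp⟩)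
  continuous_toFun := (continuous_quotient_mk'.comp continuous_fst).quotient_lift _

/-- The action of the circle on `ℂ` for which `E ×_{S¹} ℂ` is the line bundle associated to the
circle bundle `E → BS¹`, that is, `(g e, z)` is identified with `(e, g z)`. -/
def assocAction : Circle →* Function.End ℂ where
  toFun g := fun z => (g⁻¹ : Circle) * z
  map_one' := by
    funext z
    change ((1⁻¹ : Circle) : ℂ) * z = z
    simp
  map_mul' g h := by
    funext z
    change ((g * h)⁻¹ : Circle) * z = (g⁻¹ : Circle) * ((h⁻¹ : Circle) * z)
    rw [mul_inv]
    push_cast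
    ring

/-- `c ∈ H²(BS¹; ℤ)` is the universal first Chern class: the first Chern class of the complex line
bundle over `BS¹` associated to the circle bundle `ES¹ → BS¹`. -/
def IsUniversalChernClass (c : Coh (BS E)) : Prop :=
  IsEulerClass 1 (borelProj E assocAction)
    {t | ∃ (e : E) (z : ℂ), z ≠ 0 ∧ t = Quotient.mk _ (e, z)}
    {φ | ∃ (e : E) (w : ℂ), w ≠ 0 ∧ ∀ z, φ z = Quotient.mk _ (e, z 0 * w)} c

variable {M : Type*} [TopologicalSpace M] (F : Type*) [NormedAddCommGroup F] [NormedSpace ℂ F]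
  (N : M → Type*) [TopologicalSpace (TotalSpace F N)] [∀ x, AddCommGroup (N x)]
  [∀ x, Module ℂ (N x)]

/-- The action of the circle on `N` by scalar multiplication in the fibres. -/
def scalarAction : Circle →* Function.End (TotalSpace F N) where
  toFun g := scale F N g
  map_one' := by
    funext v
    change scale F N _ v = v
    rw [Circle.coe_one, scale_one]
  map_mul' g h := by
    funext v
    change scale F N _ v = scale F N _ (scale F N _ v)
    rw [scale_scale, Circle.coe_mul]

/-- `ES¹ ×_{S¹} N`. -/
abbrev BorelBundle : Type _ := Borel E (scalarAction F N)

/-- `ES¹ ×_{S¹} N⁰`, where `N⁰` is the complement of the zero section. -/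
def borelNonzero : Set (BorelBundle E F N) :=
  {t | ∃ (e : E) (v : TotalSpace F N), v ∈ nonzero F N ∧ t = Quotient.mk _ (e, v)}

/-- The linear isomorphisms from `ℂ^r` to the fibres of `ES¹ ×_{S¹} N → BS¹ × M`. -/
def borelFrames (r : ℕ) : Set C(Fin r → ℂ, BorelBundle E F N) :=
  {φ | ∃ (e : E) (x : M) (b : (Fin r → ℂ) ≃ₗ[ℂ] N x), ∀ z, φ z = Quotient.mk _ (e, ⟨x, b z⟩)}

/-- `Th` is the equivariant Thom class of `N`, that is, the Thom class of
`ES¹ ×_{S¹} N → BS¹ × M`. -/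
def IsEquivariantThomClass (r : ℕ) (Th : RelCoh (borelNonzero E F N)) : Prop :=
  IsThomClass r (borelNonzero E F N) (borelFrames E F N r) Th

variable [∀ x, TopologicalSpace (N x)] [FiberBundle F N]

/-- The projection `π_B : ES¹ ×_{S¹} N → BS¹`. -/
abbrev piB : C(BorelBundle E F N, BS E) := borelProj E (scalarAction F N)

/-- The projection `π_M : ES¹ ×_{S¹} N → M`. -/
def piM : C(BorelBundle E F N, M) where
  toFun := Quotient.lift (fun a : E × TotalSpace F N => a.2.proj) (by
    rintro a b ⟨g, rfl⟩
    rfl)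
  continuous_toFun :=
    ((FiberBundle.continuous_proj F N).comp continuous_snd).quotient_lift _

variable {E F N}

/-- `w` is the push-forward `π_{B,*} x` of the class `x` of `ES¹ ×_{S¹} N`, the composition of
division by the Thom class and integration over `M`: there is exactly one class `y` of `BS¹ × M` with
`x = Th|_{ES¹ ×_{S¹} N} ⌣ (π_B × π_M)^* y`, and `w = y / [M]`. -/
def IsPushforward (Th : RelCoh (borelNonzero E F N)) (fund : Hml M)
    (x : Coh (BorelBundle E F N)) (w : Coh (BS E)) : Prop :=
  ∃ y : Coh (BS E × M),
    (∀ y' : Coh (BS E × M),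
      x = RelCoh.toCoh Th * Coh.map ((piB E F N).prodMk (piM E F N)) y' ↔ y' = y) ∧
    w = slant y fund

end Borel

end S1Loc
end

open S1Loc Bundle

noncomputable section
namespace S1Loc
variable {X Y Z : Type*} [TopologicalSpace X] [TopologicalSpace Y] [TopologicalSpace Z]

/-! ### Functions on lists: coboundary and cup product -/

/-! Everything reduces to one identity: the restriction of the equivariant Thom class is the
pull-back from BS¹ × M of e = ∑ c_i(N) (-c)^{r-i}, the element `chernPoly` (`toCoh_thom`). Given
this, the rest is algebra. Even-degree classes are central and ∑_j s_j c_{n-j} = 0 for n > 0, so the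
product of e with ∑_j (-1)^{r+j} c^{m-r-j} α s_j collapses to c^m α; the sum may stop at j = k
because α s_j has degree above d for j > k (`chernPoly_mul_sum`). The same computation with α = 1
shows that e divides c^{d+r}. As multiplication by c is injective on H^*(BS¹ × M)
(`eq_zero_of_chern_mul`), so is multiplication by e, and the quotient y is unique. Each summand of y
is a cross product, whose slant product with [M] is ⟨α s_j, [M]⟩ times a power of c
(`slant_pow_mul`), and for degree reasons only j = k contributes.

The identity is proved as follows. Off the zero section, the universal line bundle L is pulled back
from the tautological bundle over P(N), because (g⁻¹z)(gv) = zv (`exists_map_projBundle`). Hence the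
relation that defines the Chern classes kills e there, and e lifts to a relative class of degree 2r.
By the Thom isomorphism this lift is the Thom class as soon as its value on every fibre is 1. Over a
point x of M, a basis of N_x gives a map from E ×_{S¹} ℂ^r, the sum of r copies of the dual of L.
There e becomes (-c)^r, which is also what the Thom class of that sum restricts to
(`exists_thomCocycle_pi`). So the locally constant ratio a satisfies c^r (a - 1) = 0, and a = 1
(`value_eq_one_of_mk_eq_chernPoly`).

The topological input is built on singular cochains. Centrality of even classes comes from a cup-1
product (`Cochain.exists_d_eq_commutator`). Barycentric subdivision gives the theorem of small
simplices (`Cochain.exists_d_eq_of_small`), from which follow suspension and the Thom isomorphism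
for trivial bundles (`hasThomCocycle_prod`). It is globalised to an arbitrary base by Zorn's lemma
applied to primitives in a mapping cone (`coneAcyclic_univ`, `LocTriv.isThomIso`). Injectivity of c
is the Gysin argument, the complement of the zero section of L being contractible. The signs rest on
two orientation computations: conjugation reverses the orientation of ℂ (`swap_value`), and the Thom
class of ℂ × ℂ^r is the cross product (`cross_value`), tested on an explicit Sperner cocycle. -/

section Lists

variable {V : Type*}

/-- The alternating sum of `F` over the lists obtained by omitting one entry. -/
def dL : (List V → ℤ) → List V → ℤ
  | _, [] => 0
  | F, v :: l => F l - dL (fun l => F (v :: l)) l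

/-- The cup product of functions on lists. -/
def cupL : (List V → ℤ) → (List V → ℤ) → List V → ℤ
  | _, _, [] => 0
  | F, G, v :: l => F [v] * G (v :: l) + cupL (fun l => F (v :: l)) G l

theorem dL_nil (F : List V → ℤ) : dL F [] = 0 := rfl

theorem dL_cons (F : List V → ℤ) (v : V) (l : List V) :
    dL F (v :: l) = F l - dL (fun l => F (v :: l)) l := rfl

theorem cupL_nil (F G : List V → ℤ) : cupL F G [] = 0 := rfl

theorem cupL_cons (F G : List V → ℤ) (v : V) (l : List V) :
    cupL F G (v :: l) = F [v] * G (v :: l) + cupL (fun l => F (v :: l)) G l := rfl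

theorem dL_add (F G : List V → ℤ) (l : List V) :
    dL (fun l => F l + G l) l = dL F l + dL G l := by
  induction l generalizing F G with
  | nil => rfl
  | cons v l ih => simp only [dL_cons, ih]; ring

theorem dL_smul (k : ℤ) (F : List V → ℤ) (l : List V) :
    dL (fun l => k * F l) l = k * dL F l := by
  induction l generalizing F with
  | nil => simp [dL_nil]
  | cons v l ih => simp only [dL_cons, ih]; ring

theorem dL_sub (F G : List V → ℤ) (l : List V) :
    dL (fun l => F l - G l) l = dL F l - dL G l := by
  induction l generalizing F G with
  | nil => rfl
  | cons v l ih => simp only [dL_cons, ih]; ring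

/-- `dL F l` depends on the values of `F` on the faces of `l` only. -/
theorem dL_congr {F G : List V → ℤ} {l : List V}
    (h : ∀ l' : List V, l'.length + 1 = l.length → (∀ v ∈ l', v ∈ l) → F l' = G l') :
    dL F l = dL G l := by
  induction l generalizing F G with
  | nil => rfl
  | cons v l ih =>
    rw [dL_cons, dL_cons, h l rfl (fun w hw => List.mem_cons_of_mem _ hw)]
    congr 1
    refine ih fun l' h1 h2 => h (v :: l') (by simp [← h1]) fun w hw => ?_
    rcases List.mem_cons.1 hw with rfl | hw
    · simp
    · exact List.mem_cons_of_mem _ (h2 w hw)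

theorem dL_eq_zero {F : List V → ℤ} {l : List V}
    (h : ∀ l' : List V, l'.length + 1 = l.length → (∀ v ∈ l', v ∈ l) → F l' = 0) :
    dL F l = 0 := by
  rw [dL_congr (G := fun _ => 0) h]
  simpa using dL_smul 0 (fun _ => 0) l

theorem dL_dL (F : List V → ℤ) (l : List V) : dL (dL F) l = 0 := by
  induction l generalizing F with
  | nil => rfl
  | cons v l ih =>
    rw [dL_cons]
    simp only [dL_cons, dL_sub, ih]
    ring

theorem dL_map {W : Type*} (F : List W → ℤ) (s : V → W) (l : List V) :
    dL F (l.map s) = dL (fun l => F (l.map s)) l := by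
  induction l generalizing F with
  | nil => rfl
  | cons v l ih => simp only [List.map_cons, dL_cons, ih]

theorem dL_eq_sum (F : List V → ℤ) (l : List V) :
    dL F l = ∑ i ∈ Finset.range l.length, (-1) ^ i * F (l.eraseIdx i) := by
  induction l generalizing F with
  | nil => simp [dL_nil]
  | cons v l ih =>
    rw [dL_cons, ih, List.length_cons, Finset.sum_range_succ']
    simp [pow_succ]
    ring

theorem cupL_eq_sum (F G : List V → ℤ) (l : List V) :
    cupL F G l = ∑ i ∈ Finset.range l.length, F (l.take (i + 1)) * G (l.drop i) := by
  induction l generalizing F with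
  | nil => simp [cupL_nil]
  | cons v l ih =>
    rw [cupL_cons, ih, List.length_cons, Finset.sum_range_succ']
    simp
    ring

theorem cupL_sub_left (F F' G : List V → ℤ) (l : List V) :
    cupL (fun l => F l - F' l) G l = cupL F G l - cupL F' G l := by
  simp only [cupL_eq_sum, ← Finset.sum_sub_distrib, sub_mul]

theorem cupL_neg_left (F G : List V → ℤ) (l : List V) :
    cupL (fun l => - F l) G l = - cupL F G l := by
  simp only [cupL_eq_sum, ← Finset.sum_neg_distrib, neg_mul]

theorem cupL_sub_right (F G G' : List V → ℤ) (l : List V) :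
    cupL F (fun l => G l - G' l) l = cupL F G l - cupL F G' l := by
  simp only [cupL_eq_sum, ← Finset.sum_sub_distrib, mul_sub]

theorem cupL_neg_right (F G : List V → ℤ) (l : List V) :
    cupL F (fun l => - G l) l = - cupL F G l := by
  simp only [cupL_eq_sum, ← Finset.sum_neg_distrib, mul_neg]

theorem dL_sign (F : List V → ℤ) (l : List V) :
    dL (fun l => (-1) ^ l.length * F l) l = - ((-1) ^ l.length * dL F l) := by
  induction l generalizing F with
  | nil => simp [dL_nil]
  | cons v l ih =>
    have h := ih fun l => F (v :: l)
    have h2 := dL_smul (-1) (fun l => (-1) ^ l.length * F (v :: l)) l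
    simp only [dL_cons, List.length_cons, pow_succ]
    have e : (fun l : List V => (-1 : ℤ) ^ l.length * -1 * F (v :: l)) =
        fun l => -1 * ((-1) ^ l.length * F (v :: l)) := by
      funext l; ring
    rw [e, h2, h]
    ring

/-- The Leibniz rule for functions on lists, including the terms that come from the empty list. -/
theorem dL_cupL (A B : List V → ℤ) (l : List V) :
    dL (cupL A B) l + A [] * B l - (-1) ^ l.length * A l * B [] =
      cupL (dL A) B l - cupL (fun l => (-1) ^ l.length * A l) (dL B) l := by
  induction l generalizing A with
  | nil => simp [dL_nil, cupL_nil]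
  | cons v l ih =>
    have h := ih fun l => A (v :: l)
    have e : (fun l : List V => (-1 : ℤ) ^ l.length * -1 * A (v :: l)) =
        fun l => - ((-1) ^ l.length * A (v :: l)) := by
      funext l; ring
    simp only [cupL_cons, dL_cons, dL_nil, dL_add, dL_smul, cupL_sub_left, List.length_cons,
      List.length_nil, pow_succ, e, cupL_neg_left, zero_add, pow_zero] at h ⊢
    linear_combination -h

/-- The cup-1 product `F ⌣₁ G`, with the signs that are right for `G` of even degree. -/
def cupOne : (List V → ℤ) → (List V → ℤ) → List V → ℤ
  | _, _, [] => 0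
  -- These are the terms in which the block evaluated by `G` starts at the first vertex. In the
  -- remaining terms the first vertex is absorbed into `F` and the block starts later.
  | F, G, v :: l => cupL (fun l => G (v :: l)) (fun l => (-1) ^ l.length * F (v :: l)) l +
      cupOne (fun l => F (v :: l)) G l

theorem cupOne_nil (F G : List V → ℤ) : cupOne F G [] = 0 := rfl

theorem cupOne_cons (F G : List V → ℤ) (v : V) (l : List V) : cupOne F G (v :: l) =
    cupL (fun l => G (v :: l)) (fun l => (-1) ^ l.length * F (v :: l)) l +
      cupOne (fun l => F (v :: l)) G l := rfl


theorem cupOne_sub_left (F F' G : List V → ℤ) (l : List V) :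
    cupOne (fun l => F l - F' l) G l = cupOne F G l - cupOne F' G l := by
  induction l generalizing F F' with
  | nil => rfl
  | cons v l ih => simp only [cupOne_cons, ih, mul_sub, cupL_sub_right]; ring

/-- The coboundary of the cup-1 product with a cocycle of even degree. -/
theorem dL_cupOne (F G : List V → ℤ) (hd : ∀ l, dL G l = 0)
    (hG : ∀ l : List V, Even l.length → G l = 0) (l : List V) :
    dL (cupOne F G) l = cupOne (dL F) G l + cupL (fun l => (-1) ^ l.length * F l) G l -
      cupL G (fun l => (-1) ^ l.length * F l) l := by
  induction l generalizing F with
  | nil => simp [dL_nil, cupL_nil, cupOne_nil]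
  | cons v l ih =>
    have h := ih fun l => F (v :: l)
    have h2 := dL_cupL (fun l => G (v :: l)) (fun l => (-1) ^ l.length * F (v :: l)) l
    -- For a cocycle, `dL` undoes the prefixing of `v`. Hence the Leibniz rule for the first summand
    -- of `cupOne` produces a product with `G` itself.
    have e1 : dL (fun l => G (v :: l)) = G := by
      funext l
      have := hd (v :: l)
      rw [dL_cons] at this
      linarith
    -- `G` lives on lists of odd length, so `l` has even length wherever `G (v :: l)` is nonzero,
    -- and the sign is trivial.
    have e2 : (fun l : List V => (-1) ^ l.length * G (v :: l)) = fun l => G (v :: l) := by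
      funext l
      rcases Nat.even_or_odd l.length with h | h
      · rw [h.neg_one_pow, one_mul]
      · rw [hG (v :: l) (by simpa using h.add_one), mul_zero]
    have e3 : dL (fun l : List V => (-1) ^ l.length * F (v :: l)) =
        fun l => - ((-1) ^ l.length * dL (fun l => F (v :: l)) l) := by
      funext l; exact dL_sign _ l
    have e4 : (-1) ^ l.length * G (v :: l) = G (v :: l) := congrFun e2 l
    have e : (fun l : List V => (-1 : ℤ) ^ l.length * -1 * F (v :: l)) =
        fun l => - ((-1) ^ l.length * F (v :: l)) := by
      funext l; ring
    rw [e1, e2, e3, e4, cupL_neg_right] at h2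
    simp only [cupOne_cons, cupL_cons, dL_cons, dL_add, cupOne_sub_left, cupL_sub_right, mul_sub,
      List.length_cons, List.length_nil, pow_succ, e, cupL_neg_left, zero_add, pow_zero, one_mul]
      at h h2 ⊢
    linear_combination -h - h2

end Lists

/-! ### Affine simplices in a singular simplex -/

/-- The standard simplex with vertices `0, …, n`. -/
abbrev Dl (n : ℕ) : Type := stdSimplex ℝ (Fin (n + 1))

/-- The affine map `Δ^m → Δ^n` with vertices `a 0, …, a m`. -/
def aff (m : ℕ) {n : ℕ} (a : ℕ → Dl n) : C(Dl m, Dl n) where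
  toFun t := ⟨fun j => ∑ i : Fin (m + 1), t i * a i j,
    fun j => Finset.sum_nonneg fun i _ =>
      mul_nonneg (stdSimplex.zero_le t i) (stdSimplex.zero_le (a i) j), by
      rw [Finset.sum_comm]
      simp only [← Finset.mul_sum, stdSimplex.sum_eq_one, mul_one]⟩
  continuous_toFun := by
    refine Continuous.subtype_mk (continuous_pi fun j => continuous_finsetSum _ fun i _ => ?_) _
    exact ((continuous_apply i).comp continuous_subtype_val).mul continuous_const

theorem aff_apply (m : ℕ) {n : ℕ} (a : ℕ → Dl n) (t : Dl m) (j : Fin (n + 1)) :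
    aff m a t j = ∑ i : Fin (m + 1), t i * a i j := rfl

theorem aff_congr {m n : ℕ} {a b : ℕ → Dl n} (h : ∀ i ≤ m, a i = b i) : aff m a = aff m b := by
  ext t j
  change aff m a t j = aff m b t j
  simp only [aff_apply]
  exact Finset.sum_congr rfl fun i _ => by rw [h i (Nat.le_of_lt_succ i.2)]

theorem stdSimplex_map_apply {m n : ℕ} (v : Fin (m + 1) → Fin (n + 1)) (t : Dl m) (j : Fin (n + 1)) :
    stdSimplex.map v t j = ∑ i : Fin (m + 1), if v i = j then t i else 0 := by
  rw [stdSimplex.map_coe, FunOnFinite.linearMap_apply_apply, Finset.sum_filter]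

theorem aff_comp_map {k m n : ℕ} (a : ℕ → Dl n) (b : ℕ → ℕ) (h : ∀ i ≤ k, b i ≤ m) (t : Dl k) :
    aff m a (stdSimplex.map (vtx k m b) t) = aff k (a ∘ b) t := by
  ext j
  change aff m a _ j = aff k _ t j
  simp only [aff_apply, stdSimplex_map_apply, Finset.sum_mul]
  rw [Finset.sum_comm]
  refine Finset.sum_congr rfl fun i _ => ?_
  rw [Finset.sum_eq_single (vtx k m b i)]
  · simp [vtx, h i (Nat.le_of_lt_succ i.2)]
  · intro l _ hl
    rw [if_neg hl.symm, zero_mul]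
  · simp

/-- The singular simplex `σ ∘ [a 0, …, a m]`. -/
def affS {n : ℕ} (σ : Simp n X) (m : ℕ) (a : ℕ → Dl n) : Sing X := ⟨m, σ.comp (aff m a)⟩

theorem affS_congr {n : ℕ} (σ : Simp n X) {m m' : ℕ} {a b : ℕ → Dl n} (hm : m = m')
    (h : ∀ i ≤ m, a i = b i) : affS σ m a = affS σ m' b := by
  subst hm
  rw [affS, affS, aff_congr h]

theorem pull_aff {n : ℕ} (σ : Simp n X) {m k : ℕ} (a : ℕ → Dl n) (b : ℕ → ℕ)
    (h : ∀ i ≤ k, b i ≤ m) :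
    (⟨k, Simp.pull (σ.comp (aff m a)) k b⟩ : Sing X) = affS σ k (a ∘ b) := by
  rw [affS]
  congr 1
  ext t
  simp only [Simp.pull, ContinuousMap.comp_apply, ContinuousMap.coe_mk]
  rw [aff_comp_map a b h]

/-- The vertices of the standard simplex. -/
def vert (n : ℕ) (i : ℕ) : Dl n :=
  stdSimplex.vertex (⟨min i n, Nat.lt_succ_of_le (min_le_right _ _)⟩ : Fin (n + 1))

theorem vert_apply (n i : ℕ) (j : Fin (n + 1)) :
    vert n i j = if min i n = j then 1 else 0 := by
  rw [vert, stdSimplex.vertex_coe, Pi.single_apply]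
  simp only [Fin.ext_iff, eq_comm]

theorem aff_vert_comp (m n : ℕ) (b : ℕ → ℕ) (t : Dl m) :
    aff m (vert n ∘ b) t = stdSimplex.map (vtx m n b) t := by
  ext j
  change aff m _ t j = stdSimplex.map _ t j
  rw [aff_apply, stdSimplex_map_apply]
  refine Finset.sum_congr rfl fun i _ => ?_
  simp only [Function.comp, vert_apply, vtx, Fin.ext_iff]
  split_ifs <;> simp

theorem pull_eq_aff {n : ℕ} (σ : Simp n X) (m : ℕ) (b : ℕ → ℕ) :
    (⟨m, σ.pull m b⟩ : Sing X) = affS σ m (vert n ∘ b) := by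
  rw [affS]
  congr 1
  ext t
  simp only [Simp.pull, ContinuousMap.comp_apply, ContinuousMap.coe_mk, aff_vert_comp]

/-- The list of the vertices of the standard simplex. -/
def verts (n : ℕ) : List (Dl n) := (List.range (n + 1)).map (vert n)

theorem length_verts (n : ℕ) : (verts n).length = n + 1 := by simp [verts]

theorem verts_getD (n i : ℕ) (h : i ≤ n) : (verts n).getD i (vert n 0) = vert n i := by
  rw [List.getD_eq_getElem _ _ (by rw [length_verts]; omega)]
  simp [verts]

namespace Cochain

/-- The values of a cochain on the affine simplices in a singular simplex. -/
def onList (f : Cochain X) {n : ℕ} (σ : Simp n X) (l : List (Dl n)) : ℤ :=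
  if l = [] then 0 else f (affS σ (l.length - 1) fun i => l.getD i (vert n 0))

theorem onList_nil (f : Cochain X) {n : ℕ} (σ : Simp n X) : f.onList σ [] = 0 := rfl

theorem onList_of_ne (f : Cochain X) {n : ℕ} (σ : Simp n X) {l : List (Dl n)} (h : l ≠ []) :
    f.onList σ l = f (affS σ (l.length - 1) fun i => l.getD i (vert n 0)) := if_neg h

theorem onList_verts (f : Cochain X) {n : ℕ} (σ : Simp n X) : f.onList σ (verts n) = f ⟨n, σ⟩ := by
  rw [onList_of_ne _ _ (by simp [verts])]
  congr 1
  have h : (⟨n, σ⟩ : Sing X) = affS σ n (vert n ∘ id) := by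
    rw [← pull_eq_aff, Simp.pull_id _ (by simp)]
  rw [h]
  refine affS_congr σ (by rw [length_verts]; rfl) fun i hi => ?_
  rw [length_verts] at hi
  exact verts_getD n i hi

theorem onList_d (f : Cochain X) {n : ℕ} (σ : Simp n X) (l : List (Dl n)) :
    f.d.onList σ l = dL (f.onList σ) l := by
  match l with
  | [] => rfl
  | [v] =>
    rw [onList_of_ne _ _ (by simp)]
    exact d_zero_dim f _
  | v :: w :: l =>
    rw [onList_of_ne _ _ (by simp), dL_eq_sum]
    refine (d_succ f _).trans (Finset.sum_congr rfl fun i hi => ?_)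
    have hi : i < (v :: w :: l).length := Finset.mem_range.1 hi
    have hlen : ((v :: w :: l).eraseIdx i).length = l.length + 1 := by
      rw [List.length_eraseIdx_of_lt hi]; rfl
    rw [onList_of_ne _ _ (by intro h; rw [h] at hlen; simp at hlen)]
    congr 2
    refine (pull_aff σ _ (skip i) (by intro j hj; simp only [skip]; split_ifs <;> omega)).trans
      (affS_congr σ (by rw [hlen]; rfl) fun j hj => ?_)
    simp only [Function.comp]
    rw [List.getD_eq_getElem?_getD, List.getD_eq_getElem?_getD, List.getElem?_eraseIdx, skip]
    split_ifs <;> rfl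

theorem onList_mul (f g : Cochain X) {n : ℕ} (σ : Simp n X) (l : List (Dl n)) :
    (f * g).onList σ l = cupL (f.onList σ) (g.onList σ) l := by
  match l with
  | [] => rfl
  | v :: l =>
    rw [onList_of_ne _ _ (by simp), cupL_eq_sum, mul_val,
      Finset.Nat.sum_antidiagonal_eq_sum_range_succ_mk]
    refine Finset.sum_congr rfl fun i hi => ?_
    have hi : i < (v :: l).length := Finset.mem_range.1 hi
    have h1 : ((v :: l).take (i + 1)).length = i + 1 := by
      rw [List.length_take]; omega
    have h2 : ((v :: l).drop i).length = l.length - i + 1 := by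
      rw [List.length_drop, List.length_cons]
      simp only [List.length_cons] at hi
      omega
    simp only [List.length_cons] at hi
    rw [onList_of_ne _ _ (by intro h; rw [h] at h1; simp at h1),
      onList_of_ne _ _ (by intro h; rw [h] at h2; simp at h2)]
    congr 2
    · refine (pull_aff (m := l.length) (k := i) σ _ id (by intro j hj; simp; omega)).trans
        (affS_congr σ (by rw [h1]; rfl) fun j hj => ?_)
      simp only [Function.comp, id]
      rw [List.getD_eq_getElem?_getD, List.getD_eq_getElem?_getD, List.getElem?_take,
        if_pos (by omega)]
    · refine (pull_aff (m := l.length) (k := l.length - i) σ _ (i + ·) (by intro j hj; omega)).trans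
        (affS_congr σ (by rw [h2]; rfl) fun j hj => ?_)
      simp only [Function.comp]
      rw [List.getD_eq_getElem?_getD, List.getD_eq_getElem?_getD, List.getElem?_drop]

theorem onList_d' (f : Cochain X) {n : ℕ} (σ : Simp n X) :
    f.d.onList σ = dL (f.onList σ) := funext fun l => onList_d f σ l

theorem d_d (f : Cochain X) : f.d.d = 0 := by
  refine ext fun n σ => ?_
  rw [← onList_verts f.d.d σ, onList_d, onList_d', dL_dL, zero_val]

/-- Affine maps compose. This is the naturality that allows `d_of_natural` to compute a coboundary
inside a single simplex. -/
theorem onList_pull (f : Cochain X) {n m : ℕ} (σ : Simp n X) (b : ℕ → ℕ) (l : List (Dl m)) :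
    f.onList (σ.pull m b) l = f.onList σ (l.map (stdSimplex.map (vtx m n b))) := by
  by_cases hl : l = []
  · subst hl; rfl
  rw [onList_of_ne _ _ hl, onList_of_ne _ _ (by simpa using hl)]
  congr 1
  have hlen : 0 < l.length := List.length_pos_iff.2 hl
  have : affS (σ.pull m b) (l.length - 1) (fun i => l.getD i (vert m 0)) =
      affS σ (l.length - 1) (fun i => stdSimplex.map (vtx m n b) (l.getD i (vert m 0))) := by
    rw [affS, affS]
    congr 1
    ext t
    simp only [Simp.pull, ContinuousMap.comp_apply, ContinuousMap.coe_mk]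
    congr 1
    rw [← aff_vert_comp]
    ext j
    change aff m _ _ j = aff _ _ _ j
    simp only [aff_apply, ← aff_vert_comp, Finset.sum_mul, Finset.mul_sum]
    rw [Finset.sum_comm]
    simp only [mul_assoc]
  rw [this]
  refine affS_congr σ (by simp) fun i hi => ?_
  rw [List.getD_eq_getElem _ _ (by omega), List.getD_eq_getElem _ _ (by simp; omega)]
  simp

end Cochain

theorem map_vert_vtx {m n : ℕ} (b : ℕ → ℕ) (i : ℕ) (hi : i ≤ m) :
    stdSimplex.map (vtx m n b) (vert m i) = vert n (b i) := by
  rw [vert, stdSimplex.map_vertex, vert]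
  congr 1
  simp [vtx, hi]

theorem verts_map_skip (n i : ℕ) (hi : i ≤ n + 1) :
    (verts n).map (stdSimplex.map (vtx n (n + 1) (skip i))) = (verts (n + 1)).eraseIdx i := by
  have h : ((verts (n + 1)).eraseIdx i).length = n + 1 := by
    rw [List.length_eraseIdx_of_lt (by rw [length_verts]; omega), length_verts]; rfl
  refine List.ext_getElem (by rw [h, List.length_map, length_verts]) fun j h1 h2 => ?_
  rw [h] at h2
  rw [List.getElem_map, List.getElem_eraseIdx]
  simp only [verts, List.getElem_map, List.getElem_range]
  rw [map_vert_vtx _ _ (by omega), skip]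
  split_ifs <;> rfl

namespace Cochain

/-- The coboundary of a cochain that is given by a natural function of lists of points. -/
theorem d_of_natural (k : Cochain X) (Φ : ∀ {n : ℕ}, Simp n X → List (Dl n) → ℤ)
    (hk : ∀ n (σ : Simp n X), k ⟨n, σ⟩ = Φ σ (verts n)) (h0 : ∀ n (σ : Simp n X), Φ σ [] = 0)
    (hΦ : ∀ n m (σ : Simp n X) (b : ℕ → ℕ),
      Φ (σ.pull m b) (verts m) = Φ σ ((verts m).map (stdSimplex.map (vtx m n b))))
    (n : ℕ) (σ : Simp n X) : k.d ⟨n, σ⟩ = dL (Φ σ) (verts n) := by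
  cases n with
  | zero =>
    rw [d_zero_dim, show verts 0 = [vert 0 0] from rfl, dL_cons, dL_nil, h0, sub_zero]
  | succ n =>
    rw [d_succ, dL_eq_sum, length_verts]
    refine Finset.sum_congr rfl fun i hi => ?_
    rw [hk, hΦ, verts_map_skip _ _ (by have := Finset.mem_range.1 hi; omega)]

end Cochain

/-! ### Naturality of the list products -/

section Lists

variable {V W : Type*}

theorem cupL_map (F G : List W → ℤ) (s : V → W) (l : List V) :
    cupL F G (l.map s) = cupL (fun l => F (l.map s)) (fun l => G (l.map s)) l := by
  induction l generalizing F with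
  | nil => rfl
  | cons v l ih => simp only [List.map_cons, cupL_cons, ih, List.map_nil]

theorem cupOne_map (F G : List W → ℤ) (s : V → W) (l : List V) :
    cupOne F G (l.map s) = cupOne (fun l => F (l.map s)) (fun l => G (l.map s)) l := by
  induction l generalizing F with
  | nil => rfl
  | cons v l ih => simp only [List.map_cons, cupOne_cons, ih, cupL_map, List.length_map]

theorem cupOne_zero_left (G : List V → ℤ) (l : List V) : cupOne (fun _ => 0) G l = 0 := by
  simpa using cupOne_sub_left (fun _ => 0) (fun _ => 0) G l

end Lists

/-! ### Commutativity of the cup product in even degree -/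

namespace Cochain

/-- `f` vanishes outside degree `n`. -/
def Supp (n : ℕ) (f : Cochain X) : Prop := ∀ σ : Sing X, σ.1 ≠ n → f σ = 0

theorem onList_supp {n : ℕ} {f : Cochain X} (hf : f.Supp n) {k : ℕ} (σ : Simp k X)
    (l : List (Dl k)) (hl : l.length ≠ n + 1) : f.onList σ l = 0 := by
  by_cases h : l = []
  · subst h; rfl
  · rw [onList_of_ne _ _ h]
    refine hf _ ?_
    have := List.length_pos_iff.2 h
    change l.length - 1 ≠ n
    omega

/-- Cocycles of even degree commute with all cocycles, up to coboundaries. -/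
theorem exists_d_eq_commutator (f g : Cochain X) (n : ℕ) (hn : Even n) (hg : g.Supp n) (hg' : g.d = 0)
    (hf : f.d = 0) : ∃ h : Cochain X, h.d = f * g - g * f := by
  have hf' : f.inv.d = 0 := by rw [d_inv, hf, inv_zero, neg_zero]
  -- A list has one entry more than the degree of its simplex, so the sign `(-1) ^ l.length` in
  -- `dL_cupOne` turns `f.inv` into `-f`. This accounts for `inv` and for the overall minus sign.
  refine ⟨fun σ => - cupOne (f.inv.onList σ.2) (g.onList σ.2) (verts σ.1), ?_⟩
  refine ext fun k σ => ?_
  have h1 := d_of_natural (fun σ => - cupOne (f.inv.onList σ.2) (g.onList σ.2) (verts σ.1))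
    (fun {n} σ l => -1 * cupOne (f.inv.onList σ) (g.onList σ) l) (fun n σ => by simp)
    (fun n σ => by simp [cupOne_nil])
    (fun n m σ b => by
      rw [cupOne_map]
      simp only [← onList_pull]) k σ
  have h2 := dL_cupOne (f.inv.onList σ) (g.onList σ)
    (fun l => by
      rw [← onList_d, hg']
      by_cases h : l = []
      · subst h; rfl
      · rw [onList_of_ne _ _ h]; rfl)
    (fun l hl => onList_supp hg σ l (by rintro h; rw [h] at hl; exact (Nat.not_even_iff_odd.2 hn.add_one) hl))
    (verts k)
  have h3 : dL (f.inv.onList σ) = fun _ => 0 := by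
    rw [← onList_d', hf']
    funext l
    by_cases h : l = []
    · subst h; rfl
    · rw [onList_of_ne _ _ h]; rfl
  have h4 : (fun l : List (Dl k) => (-1) ^ l.length * f.inv.onList σ l) =
      fun l => - f.onList σ l := by
    funext l
    by_cases h : l = []
    · subst h; simp [onList_nil]
    · rw [onList_of_ne _ _ h, onList_of_ne _ _ h, inv_val]
      have : l.length = (l.length - 1) + 1 := by have := List.length_pos_iff.2 h; omega
      change _ * ((-1) ^ (l.length - 1) * _) = _
      rw [this, pow_succ]
      simp [← mul_assoc, ← mul_pow]
  rw [h1, dL_smul, h2, h3, h4, cupOne_zero_left, cupL_neg_left, cupL_neg_right, ← onList_mul,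
    ← onList_mul, onList_verts, onList_verts]
  change _ = (f * g) _ - (g * f) _
  ring

end Cochain

/-! ### Barycentric subdivision -/

section Subdivision

variable {V W : Type*}

/-- The subdivision of lists of length `n`, dualized; `b l` plays the role of the barycentre. -/
def sdN (b : List V → V) : ℕ → (List V → ℤ) → List V → ℤ
  | 0, F, _ => F []
  | n + 1, F, l => dL (sdN b n fun l' => F (b l :: l')) l

/-- The homotopy between the subdivision and the identity on lists of length `n`, dualized. -/
def hdN (b : List V → V) : ℕ → (List V → ℤ) → List V → ℤ
  | 0, _, _ => 0
  | n + 1, F, l => F (b l :: l) - dL (hdN b n fun l' => F (b l :: l')) l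

/-- The subdivision operator on functions of lists. -/
def Sd (b : List V → V) (F : List V → ℤ) (l : List V) : ℤ := sdN b l.length F l

/-- The homotopy operator between `Sd` and the identity. -/
def Hd (b : List V → V) (F : List V → ℤ) (l : List V) : ℤ := hdN b l.length F l

variable (b : List V → V)

theorem sdN_sub (n : ℕ) (F G : List V → ℤ) :
    sdN b n (fun l => F l - G l) = fun l => sdN b n F l - sdN b n G l := by
  induction n generalizing F G with
  | zero => rfl
  | succ n ih => funext l; simp only [sdN, ih, dL_sub]

theorem hdN_sub (n : ℕ) (F G : List V → ℤ) :
    hdN b n (fun l => F l - G l) = fun l => hdN b n F l - hdN b n G l := by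
  induction n generalizing F G with
  | zero => rfl
  | succ n ih => funext l; simp only [hdN, ih, dL_sub]; ring

/-- Dual to ∂(b·c) = c - b·∂c for cones: subdivision is the cone over the subdivided boundary, and
the second term is a cone over the subdivision of ∂∂ = 0. -/
theorem sdN_dL (n : ℕ) (F : List V → ℤ) (l : List V) (hl : l.length = n) :
    sdN b n (dL F) l = dL (sdN b (n - 1) F) l := by
  induction n generalizing F l with
  | zero =>
    rw [List.length_eq_zero_iff] at hl
    subst hl
    rfl
  | succ n ih =>
    simp only [sdN, dL_cons, sdN_sub, dL_sub, Nat.add_sub_cancel]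
    have : dL (sdN b n (dL fun l' => F (b l :: l'))) l =
        dL (dL (sdN b (n - 1) fun l' => F (b l :: l'))) l :=
      dL_congr fun l' h _ => ih _ l' (by omega)
    rw [this, dL_dL, sub_zero]

/-- Dual to the homotopy T[l] = b_l·([l] - T∂[l]). The boundary of a cone, together with the
identity already known for the faces, gives ∂T + T∂ = 1 - sd. -/
theorem sdN_homotopy (n : ℕ) (F : List V → ℤ) (l : List V) (hl : l.length = n) :
    F l - sdN b n F l = hdN b n (dL F) l + dL (hdN b (n - 1) F) l := by
  induction n generalizing F l with
  | zero =>
    rw [List.length_eq_zero_iff] at hl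
    subst hl
    simp [sdN, hdN, dL_nil]
  | succ n ih =>
    simp only [sdN, hdN, dL_cons, hdN_sub, dL_sub]
    have : dL (hdN b n (dL fun l' => F (b l :: l'))) l =
        dL (fun l' => F (b l :: l') - sdN b n (fun l' => F (b l :: l')) l' -
          dL (hdN b (n - 1) fun l' => F (b l :: l')) l') l :=
      dL_congr fun l' h _ => by
        have := ih (fun l' => F (b l :: l')) l' (by omega)
        linarith
    rw [this]
    simp only [dL_sub, dL_dL, Nat.add_sub_cancel]
    ring

theorem Sd_dL (F : List V → ℤ) : Sd b (dL F) = dL (Sd b F) := by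
  funext l
  rw [Sd, sdN_dL b _ _ _ rfl]
  exact dL_congr fun l' h _ => by rw [Sd, ← h]; rfl

theorem Sd_homotopy (F : List V → ℤ) (l : List V) :
    F l - Sd b F l = Hd b (dL F) l + dL (Hd b F) l := by
  rw [Sd, sdN_homotopy b _ _ _ rfl, Hd]
  congr 1
  exact dL_congr fun l' h _ => by rw [Hd, ← h]; rfl

theorem Sd_sub (F G : List V → ℤ) : Sd b (fun l => F l - G l) = fun l => Sd b F l - Sd b G l :=
  funext fun l => congrFun (sdN_sub b _ F G) l

theorem Hd_zero : Hd b (fun _ => 0) = fun _ => 0 := by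
  funext l
  simpa [Hd] using congrFun (hdN_sub b l.length (fun _ => 0) (fun _ => 0)) l

theorem Sd_iterate_dL (k : ℕ) (F : List V → ℤ) : (Sd b)^[k] (dL F) = dL ((Sd b)^[k] F) := by
  induction k with
  | zero => rfl
  | succ k ih => rw [Function.iterate_succ_apply', ih, Sd_dL, Function.iterate_succ_apply']

theorem Sd_iterate_sub (k : ℕ) (F G : List V → ℤ) :
    (Sd b)^[k] (fun l => F l - G l) = fun l => (Sd b)^[k] F l - (Sd b)^[k] G l := by
  induction k with
  | zero => rfl
  | succ k ih => simp only [Function.iterate_succ_apply', ih, Sd_sub]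

theorem Sd_iterate_zero (k : ℕ) : (Sd b)^[k] (fun _ => 0) = fun _ => 0 := by
  simpa using Sd_iterate_sub b k (fun _ => 0) (fun _ => 0)

/-- The differences of successive iterates telescope; the term `Hd b (dL F)` drops out because `F`
is a cocycle. -/
theorem Sd_iterate_homotopy (F : List V → ℤ) (hF : dL F = fun _ => 0) (k : ℕ) (l : List V) :
    F l - (Sd b)^[k] F l = dL (fun l => ∑ i ∈ Finset.range k, (Sd b)^[i] (Hd b F) l) l := by
  induction k with
  | zero => simpa using (dL_smul 0 (fun _ => 0) l).symm
  | succ k ih =>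
    have h : (fun l => F l - Sd b F l) = dL (Hd b F) := by
      funext l
      rw [Sd_homotopy, hF, Hd_zero, zero_add]
    have h2 := congrFun (Sd_iterate_sub b k F (Sd b F)) l
    rw [h, Sd_iterate_dL] at h2
    simp only [Finset.sum_range_succ, dL_add]
    rw [← ih, h2, Function.iterate_succ_apply]
    ring

theorem sdN_map (b' : List W → W) (s : V → W) (hs : ∀ l, l ≠ [] → b' (l.map s) = s (b l)) (n : ℕ)
    (F : List W → ℤ) (l : List V) (hl : l.length = n) :
    sdN b' n F (l.map s) = sdN b n (fun l => F (l.map s)) l := by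
  induction n generalizing F l with
  | zero => rfl
  | succ n ih =>
    simp only [sdN]
    rw [dL_map, hs l (by rintro rfl; simp at hl)]
    exact dL_congr fun l' h _ => ih _ l' (by omega)

theorem hdN_map (b' : List W → W) (s : V → W) (hs : ∀ l, l ≠ [] → b' (l.map s) = s (b l)) (n : ℕ)
    (F : List W → ℤ) (l : List V) (hl : l.length = n) :
    hdN b' n F (l.map s) = hdN b n (fun l => F (l.map s)) l := by
  induction n generalizing F l with
  | zero => rfl
  | succ n ih =>
    simp only [hdN]
    rw [dL_map, hs l (by rintro rfl; simp at hl)]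
    congr 1
    exact dL_congr fun l' h _ => ih _ l' (by omega)

theorem Sd_iterate_map (b' : List W → W) (s : V → W) (hs : ∀ l, l ≠ [] → b' (l.map s) = s (b l))
    (k : ℕ) (F : List W → ℤ) (l : List V) :
    (Sd b')^[k] F (l.map s) = (Sd b)^[k] (fun l => F (l.map s)) l := by
  induction k generalizing F with
  | zero => rfl
  | succ k ih =>
    have : (fun l => Sd b' F (l.map s)) = Sd b fun l => F (l.map s) := by
      funext l
      rw [Sd, sdN_map b b' s hs _ _ _ (by simp), Sd, List.length_map]
    rw [Function.iterate_succ_apply, ih, Function.iterate_succ_apply, this]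

theorem Hd_map (b' : List W → W) (s : V → W) (hs : ∀ l, l ≠ [] → b' (l.map s) = s (b l))
    (F : List W → ℤ) (l : List V) : Hd b' F (l.map s) = Hd b (fun l => F (l.map s)) l := by
  rw [Hd, hdN_map b b' s hs _ _ _ (by simp), Hd, List.length_map]

/-- If `F` vanishes on the lists in a convex set then so does `Hd F`. -/
theorem Hd_eq_zero (P : V → Prop) (hb : ∀ l, l ≠ [] → (∀ v ∈ l, P v) → P (b l)) (F : List V → ℤ)
    (hF : ∀ l : List V, (∀ v ∈ l, P v) → F l = 0) (l : List V) (hl : ∀ v ∈ l, P v) :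
    Hd b F l = 0 := by
  have : ∀ (n : ℕ) (F : List V → ℤ), (∀ l : List V, (∀ v ∈ l, P v) → F l = 0) →
      ∀ l : List V, l.length = n → (∀ v ∈ l, P v) → hdN b n F l = 0 := by
    intro n
    induction n with
    | zero => intros; rfl
    | succ n ih =>
      intro F hF l hn hl
      have hbl := hb l (by rintro rfl; simp at hn) hl
      have hc : ∀ l' : List V, (∀ v ∈ l', P v) → ∀ v ∈ b l :: l', P v := by
        intro l' h' v hv
        rcases List.mem_cons.1 hv with rfl | hv
        · exact hbl
        · exact h' v hv
      simp only [hdN]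
      rw [hF _ (hc l hl), zero_sub, neg_eq_zero]
      exact dL_eq_zero fun l' h1 h2 => ih _ (fun l'' h'' => hF _ (hc l'' h'')) l' (by omega)
        fun v hv => hl v (h2 v hv)
  exact this _ F hF l rfl hl

end Subdivision

/-! ### Diameters under iterated subdivision -/

section Mesh

variable {V : Type*} [PseudoMetricSpace V] (b : List V → V)

/-- `x` lies in all closed balls that contain the entries of `l`. -/
def MHull (l : List V) (x : V) : Prop := ∀ y ρ, (∀ v ∈ l, dist v y ≤ ρ) → dist x y ≤ ρ

/-- The new simplices have to be both shorter and inside the hull of the old vertices; the induction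
carries the two facts together. A vertex coming from a subdivided face lies in the hull of that
face, hence in the ball of radius `c * δ` about `b l`, which contains every entry of `l`. -/
theorem sdN_mesh (h1 : ∀ l, l ≠ [] → MHull l (b l)) {L : ℕ} {c : ℝ} (hc : 0 ≤ c)
    (h2 : ∀ (l : List V) (δ : ℝ), l.length ≤ L → (∀ v ∈ l, ∀ w ∈ l, dist v w ≤ δ) →
      ∀ v ∈ l, dist v (b l) ≤ c * δ) (n : ℕ) (hn : n ≤ L) (F : List V → ℤ) (l : List V)
    (hl : l.length = n) {δ : ℝ} (hδ : 0 ≤ δ) (hlδ : ∀ v ∈ l, ∀ w ∈ l, dist v w ≤ δ)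
    (hF : ∀ l' : List V, l'.length = n → (∀ v ∈ l', MHull l v) →
      (∀ v ∈ l', ∀ w ∈ l', dist v w ≤ c * δ) → F l' = 0) : sdN b n F l = 0 := by
  induction n generalizing F l with
  | zero => exact hF [] rfl (by simp) (by simp)
  | succ n ih =>
    have hne : l ≠ [] := by rintro rfl; simp at hl
    simp only [sdN]
    refine dL_eq_zero fun l' hl' hsub => ?_
    refine ih (by omega) _ l' (by omega) (fun v hv w hw => hlδ v (hsub v hv) w (hsub w hw)) ?_
    intro l'' hlen hM hd
    have hb : ∀ x ∈ l'', dist x (b l) ≤ c * δ := fun x hx =>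
      hM x hx _ _ fun v hv => h2 l δ (by omega) hlδ v (hsub v hv)
    refine hF _ (by simp [hlen]) (fun v hv => ?_) fun v hv w hw => ?_
    · rcases List.mem_cons.1 hv with rfl | hv
      · exact h1 l hne
      · exact fun y ρ h => hM v hv y ρ fun w hw => h w (hsub w hw)
    · rcases List.mem_cons.1 hv with rfl | hv <;> rcases List.mem_cons.1 hw with rfl | hw
      · rw [dist_self]; positivity
      · rw [dist_comm]; exact hb w hw
      · exact hb v hv
      · exact hd v hv w hw

theorem Sd_iterate_mesh (h1 : ∀ l, l ≠ [] → MHull l (b l)) {L : ℕ} {c : ℝ} (hc : 0 ≤ c)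
    (h2 : ∀ (l : List V) (δ : ℝ), l.length ≤ L → (∀ v ∈ l, ∀ w ∈ l, dist v w ≤ δ) →
      ∀ v ∈ l, dist v (b l) ≤ c * δ) (k : ℕ) (F : List V → ℤ) (l : List V)
    (hl : l.length ≤ L) {δ : ℝ} (hδ : 0 ≤ δ) (hlδ : ∀ v ∈ l, ∀ w ∈ l, dist v w ≤ δ)
    (hF : ∀ l' : List V, (∀ v ∈ l', ∀ w ∈ l', dist v w ≤ c ^ k * δ) → F l' = 0) :
    (Sd b)^[k] F l = 0 := by
  induction k generalizing l δ with
  | zero => exact hF l (by simpa using hlδ)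
  | succ k ih =>
    rw [Function.iterate_succ_apply']
    refine sdN_mesh b h1 hc h2 _ hl _ l rfl hδ hlδ fun l' hlen _ hd => ?_
    refine ih l' (by omega) (by positivity) hd fun l'' h'' => hF l'' fun v hv w hw => ?_
    refine (h'' v hv w hw).trans (le_of_eq ?_)
    rw [pow_succ]; ring

end Mesh

/-- The barycentre of a list of points of the standard simplex. -/
def bary {n : ℕ} (l : List (Dl n)) : Dl n :=
  if h : l = [] then vert n 0 else
    aff (l.length - 1) (fun i => l.getD i (vert n 0)) ⟨fun _ => (l.length : ℝ)⁻¹, by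
      have : l.length - 1 + 1 = l.length := by have := List.length_pos_iff.2 h; omega
      refine ⟨fun _ => by positivity, ?_⟩
      rw [Finset.sum_const, Finset.card_univ, Fintype.card_fin, this, nsmul_eq_mul,
        mul_inv_cancel₀]
      exact_mod_cast (List.length_pos_iff.2 h).ne'⟩

theorem sum_getD {n : ℕ} (l : List (Dl n)) (hl : l ≠ []) (g : Dl n → ℝ) :
    ∑ i : Fin (l.length - 1 + 1), g (l.getD i (vert n 0)) = (l.map g).sum := by
  have h : l.length - 1 + 1 = l.length := by have := List.length_pos_iff.2 hl; omega
  rw [← Finset.sum_range fun i => g (l.getD i (vert n 0)), h, Finset.sum_range,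
    ← Fin.sum_univ_getElem]
  refine Fintype.sum_equiv (finCongr (by simp)) _ _ fun i => ?_
  simp

theorem bary_apply {n : ℕ} {l : List (Dl n)} (hl : l ≠ []) (j : Fin (n + 1)) :
    bary l j = (l.length : ℝ)⁻¹ * (l.map fun v => v j).sum := by
  rw [bary, dif_neg hl, aff_apply, ← sum_getD l hl fun v => v j, Finset.mul_sum]
  rfl

theorem bary_map {m n : ℕ} (v : Fin (m + 1) → Fin (n + 1)) (l : List (Dl m)) (hl : l ≠ []) :
    bary (l.map (stdSimplex.map v)) = stdSimplex.map v (bary l) := by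
  ext j
  change bary _ j = stdSimplex.map v (bary l) j
  rw [bary_apply (by simpa using hl), stdSimplex_map_apply]
  simp only [bary_apply hl, List.length_map, List.map_map, Function.comp_def,
    stdSimplex_map_apply]
  have : ∀ i, (if v i = j then (l.length : ℝ)⁻¹ * (l.map fun w => w i).sum else 0) =
      (l.length : ℝ)⁻¹ * (l.map fun w => if v i = j then w i else 0).sum := by
    intro i
    split_ifs <;> simp
  simp only [this, ← Finset.mul_sum]
  congr 1
  clear this hl
  induction l with
  | nil => simp
  | cons w l ih => simp only [List.map_cons, List.sum_cons, Finset.sum_add_distrib, ih]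

theorem dist_le_of_coord {n : ℕ} {x y : Dl n} {ρ : ℝ} (hρ : 0 ≤ ρ) (h : ∀ j, |x j - y j| ≤ ρ) :
    dist x y ≤ ρ := by
  rw [Subtype.dist_eq]
  exact (dist_pi_le_iff hρ).2 fun j => by rw [Real.dist_eq]; exact h j

theorem abs_coord_le_dist {n : ℕ} (x y : Dl n) (j : Fin (n + 1)) : |x j - y j| ≤ dist x y := by
  rw [Subtype.dist_eq]
  have := dist_le_pi_dist (x : Fin (n + 1) → ℝ) y j
  rwa [Real.dist_eq] at this

/-- Balls of the sup metric are convex. -/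
theorem dist_aff_le {m n : ℕ} (a : ℕ → Dl n) (t : Dl m) (y : Dl n) {ρ : ℝ}
    (h : ∀ i ≤ m, dist (a i) y ≤ ρ) : dist (aff m a t) y ≤ ρ := by
  refine dist_le_of_coord (dist_nonneg.trans (h 0 (Nat.zero_le _))) fun j => ?_
  have e : aff m a t j - y j = ∑ i : Fin (m + 1), t i * (a i j - y j) := by
    simp only [mul_sub, Finset.sum_sub_distrib, ← Finset.sum_mul, stdSimplex.sum_eq_one, one_mul,
      aff_apply]
  rw [e]
  refine (Finset.abs_sum_le_sum_abs _ _).trans ?_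
  calc ∑ i : Fin (m + 1), |t i * (a i j - y j)| ≤ ∑ i : Fin (m + 1), t i * ρ := by
        refine Finset.sum_le_sum fun i _ => ?_
        rw [abs_mul, abs_of_nonneg (stdSimplex.zero_le t i)]
        exact mul_le_mul_of_nonneg_left ((abs_coord_le_dist _ _ j).trans
          (h i (Nat.le_of_lt_succ i.2))) (stdSimplex.zero_le t i)
    _ = ρ := by rw [← Finset.sum_mul, stdSimplex.sum_eq_one, one_mul]

theorem mhull_bary {n : ℕ} (l : List (Dl n)) (hl : l ≠ []) : MHull l (bary l) := by
  intro y ρ h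
  rw [bary, dif_neg hl]
  refine dist_aff_le _ _ _ fun i hi => h _ ?_
  have := List.length_pos_iff.2 hl
  rw [List.getD_eq_getElem _ _ (by omega)]
  exact List.getElem_mem _

/-- In the average over the entries `w` of the differences between `w` and `v`, the term `w = v` is
zero. So at most the fraction 1 - 1/length of `δ` remains, and this is at most 1 - 1/L. -/
theorem dist_bary_le {n L : ℕ} (l : List (Dl n)) (δ : ℝ) (hl : l.length ≤ L)
    (h : ∀ v ∈ l, ∀ w ∈ l, dist v w ≤ δ) (v : Dl n) (hv : v ∈ l) :
    dist v (bary l) ≤ (1 - (L : ℝ)⁻¹) * δ := by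
  have hne : l ≠ [] := by rintro rfl; simp at hv
  have hpos : (0 : ℝ) < l.length := by exact_mod_cast List.length_pos_iff.2 hne
  have hδ : 0 ≤ δ := dist_nonneg.trans (h v hv v hv)
  have hle : 1 - (l.length : ℝ)⁻¹ ≤ 1 - (L : ℝ)⁻¹ :=
    sub_le_sub_left (inv_anti₀ hpos (by exact_mod_cast hl)) 1
  have h0 : 0 ≤ 1 - (l.length : ℝ)⁻¹ := by
    rw [sub_nonneg]
    exact inv_le_one_of_one_le₀ (by exact_mod_cast List.length_pos_iff.2 hne)
  refine le_trans ?_ (mul_le_mul_of_nonneg_right hle hδ)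
  rw [dist_comm]
  refine dist_le_of_coord (by positivity) fun j => ?_
  obtain ⟨l₁, l₂, rfl⟩ := List.append_of_mem hv
  rw [bary_apply hne]
  have key : ∀ l' : List (Dl n), (∀ w ∈ l', dist w v ≤ δ) →
      |(l'.map fun w => w j).sum - l'.length * v j| ≤ l'.length * δ := by
    intro l' hl'
    induction l' with
    | nil => simp
    | cons w l' ih =>
      have h1 := ih fun x hx => hl' x (List.mem_cons_of_mem _ hx)
      have h2 := (abs_coord_le_dist w v j).trans (hl' w (by simp))
      have e : ((w :: l').map fun w => w j).sum - ((w :: l').length : ℕ) * v j =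
          (w j - v j) + ((l'.map fun w => w j).sum - l'.length * v j) := by
        simp only [List.map_cons, List.sum_cons, List.length_cons]; push_cast; ring
      rw [e]
      refine (abs_add_le _ _).trans ?_
      simp only [List.length_cons]; push_cast; linarith
  have k1 := key l₁ fun w hw => h w (by simp [hw]) v hv
  have k2 := key l₂ fun w hw => h w (by simp [hw]) v hv
  set s₁ := (l₁.map fun w => w j).sum
  set s₂ := (l₂.map fun w => w j).sum
  have hlen : ((l₁ ++ v :: l₂).length : ℝ) = l₁.length + l₂.length + 1 := by
    simp; ring
  have e : ((l₁ ++ v :: l₂).length : ℝ)⁻¹ * ((l₁ ++ v :: l₂).map fun w => w j).sum - v j =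
      ((l₁ ++ v :: l₂).length : ℝ)⁻¹ * ((s₁ - l₁.length * v j) + (s₂ - l₂.length * v j)) := by
    field_simp
    rw [hlen]
    simp only [List.map_append, List.map_cons, List.sum_append, List.sum_cons]
    ring
  rw [e, abs_mul, abs_of_pos (by positivity)]
  have e2 : (1 - ((l₁ ++ v :: l₂).length : ℝ)⁻¹) * δ =
      ((l₁ ++ v :: l₂).length : ℝ)⁻¹ * (l₁.length * δ + l₂.length * δ) := by
    field_simp
    rw [hlen]
    ring
  rw [e2]
  exact mul_le_mul_of_nonneg_left ((abs_add_le _ _).trans (add_le_add k1 k2)) (by positivity)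

/-! ### Small simplices -/

theorem dist_vert_le {n : ℕ} (x y : Dl n) : dist x y ≤ 1 := by
  refine dist_le_of_coord zero_le_one fun j => ?_
  have h1 := stdSimplex.zero_le x j
  have h2 := stdSimplex.zero_le y j
  have h3 := stdSimplex.le_one x j
  have h4 := stdSimplex.le_one y j
  rw [abs_le]
  constructor <;> linarith

namespace Cochain

/-- The cochain with given values. -/
def of (f : Sing X → ℤ) : Cochain X := f

theorem of_val (f : Sing X → ℤ) (σ : Sing X) : of f σ = f σ := rfl

theorem onList_eq_zero_fun {f : Cochain X} {n : ℕ} {σ : Simp n X}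
    (h : ∀ τ : Sing X, Set.range τ.2 ⊆ Set.range σ → f τ = 0) : f.onList σ = fun _ => 0 := by
  funext l
  by_cases hl : l = []
  · subst hl; rfl
  · rw [onList_of_ne _ _ hl]
    refine h _ ?_
    rintro _ ⟨t, rfl⟩
    exact ⟨_, rfl⟩

/-- The sum of the first `k` homotopies between successive subdivisions, applied to `f`. -/
def sdHomotopy (f : Cochain X) (k : ℕ) {n : ℕ} (σ : Simp n X) (l : List (Dl n)) : ℤ :=
  ∑ i ∈ Finset.range k, (Sd bary)^[i] (Hd bary (f.onList σ)) l

theorem sdHomotopy_pull (f : Cochain X) (k : ℕ) {n m : ℕ} (σ : Simp n X) (a : ℕ → ℕ)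
    (l : List (Dl m)) :
    f.sdHomotopy k (σ.pull m a) l = f.sdHomotopy k σ (l.map (stdSimplex.map (vtx m n a))) := by
  refine Finset.sum_congr rfl fun i _ => ?_
  rw [Sd_iterate_map bary bary _ (bary_map (vtx m n a))]
  have : f.onList (σ.pull m a) = fun l => f.onList σ (l.map (stdSimplex.map (vtx m n a))) :=
    funext fun l => onList_pull f σ a l
  rw [this]
  exact congrArg (fun G => (Sd bary)^[i] G l)
    (funext fun l => (Hd_map bary bary _ (bary_map (vtx m n a)) _ l).symm)

/-- Sufficiently fine subdivisions of a simplex are small. -/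
theorem exists_sd_eq_zero {ι : Type*} (U : ι → Set X) (hU : ∀ i, IsOpen (U i)) (f : Cochain X)
    (hf : ∀ τ : Sing X, ∀ i, Set.range τ.2 ⊆ U i → f τ = 0) {n : ℕ} (σ : Simp n X)
    (hσ : Set.range σ ⊆ ⋃ i, U i) :
    ∃ m : ℕ, ∀ k, m ≤ k → (Sd bary)^[k] (f.onList σ) (verts n) = 0 ∧
      (Sd bary)^[k] (Hd bary (f.onList σ)) (verts n) = 0 := by
  obtain ⟨δ, hδ, hball⟩ := lebesgue_number_lemma_of_metric (s := (Set.univ : Set (Dl n)))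
    (c := fun i => σ ⁻¹' U i) isCompact_univ (fun i => (hU i).preimage σ.continuous)
    (fun x _ => by
      obtain ⟨i, hi⟩ := Set.mem_iUnion.1 (hσ ⟨x, rfl⟩)
      exact Set.mem_iUnion.2 ⟨i, hi⟩)
  -- `δ` is a Lebesgue number of the cover, so a list in a ball of radius `δ / 2` spans a simplex
  -- inside one `U i`. Smallness is expressed by balls rather than by diameters because balls are
  -- closed under barycentres, which `Hd_eq_zero` needs.
  have hF : ∀ (x : Dl n) (l : List (Dl n)), (∀ v ∈ l, dist v x ≤ δ / 2) → f.onList σ l = 0 := by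
    intro x l hl
    by_cases hne : l = []
    · subst hne; rfl
    obtain ⟨i, hi⟩ := hball x (Set.mem_univ _)
    rw [onList_of_ne _ _ hne]
    refine hf _ i ?_
    rintro _ ⟨t, rfl⟩
    refine hi ?_
    rw [Metric.mem_ball]
    refine lt_of_le_of_lt (dist_aff_le _ _ _ (ρ := δ / 2) fun j hj => hl _ ?_) (by linarith)
    have := List.length_pos_iff.2 hne
    rw [List.getD_eq_getElem _ _ (by omega)]
    exact List.getElem_mem _
  have hH : ∀ (x : Dl n) (l : List (Dl n)), (∀ v ∈ l, dist v x ≤ δ / 2) →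
      Hd bary (f.onList σ) l = 0 := fun x l hl =>
    Hd_eq_zero bary (fun v => dist v x ≤ δ / 2) (fun l h0 h => mhull_bary l h0 _ _ h) _ (hF x) l hl
  set c : ℝ := 1 - ((n + 1 : ℕ) : ℝ)⁻¹ with hc
  have hc0 : 0 ≤ c := by
    rw [hc, sub_nonneg]
    exact inv_le_one_of_one_le₀ (by simp)
  have hc1 : c < 1 := by
    rw [hc, sub_lt_self_iff]
    positivity
  obtain ⟨m, hm⟩ := exists_pow_lt_of_lt_one (half_pos hδ) hc1
  have key : ∀ G : List (Dl n) → ℤ, (∀ (x : Dl n) (l : List (Dl n)),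
      (∀ v ∈ l, dist v x ≤ δ / 2) → G l = 0) → ∀ k, m ≤ k → (Sd bary)^[k] G (verts n) = 0 := by
    intro G hG k hk
    refine Sd_iterate_mesh bary mhull_bary hc0 (L := n + 1) (fun l δ h1 h2 v hv =>
      dist_bary_le l δ h1 h2 v hv) k G (verts n) (length_verts n).le zero_le_one
      (fun v _ w _ => dist_vert_le v w) fun l' hl' => ?_
    by_cases hne : l' = []
    · subst hne; exact hG (vert n 0) [] (by simp)
    · refine hG (l'.head hne) l' fun v hv => (hl' v hv _ (List.head_mem hne)).trans ?_
      rw [mul_one]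
      exact (pow_le_pow_of_le_one hc0 hc1.le hk).trans hm.le
  exact ⟨m, fun k hk => ⟨key _ hF k hk, key _ hH k hk⟩⟩

/-- **Small simplices.** Let `f` be a cochain that is a cocycle on the union of the open sets `U i`
and vanishes on all simplices contained in one of them. Then, on that union, `f` is the
coboundary of a cochain `h`, and `h` vanishes on each simplex on whose subsimplices `f` vanishes. -/
theorem exists_d_eq_of_small {ι : Type*} (U : ι → Set X) (hU : ∀ i, IsOpen (U i)) (f : Cochain X)
    (hd : ∀ σ : Sing X, Set.range σ.2 ⊆ ⋃ i, U i → f.d σ = 0)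
    (hf : ∀ τ : Sing X, ∀ i, Set.range τ.2 ⊆ U i → f τ = 0) :
    ∃ h : Cochain X, (∀ σ : Sing X, Set.range σ.2 ⊆ ⋃ i, U i → h.d σ = f σ) ∧
      ∀ σ : Sing X, (∀ τ : Sing X, Set.range τ.2 ⊆ Set.range σ.2 → f τ = 0) → h σ = 0 := by
  classical
  have hex : ∀ σ : Sing X, ∃ m : ℕ, Set.range σ.2 ⊆ ⋃ i, U i → ∀ k, m ≤ k →
      (Sd bary)^[k] (f.onList σ.2) (verts σ.1) = 0 ∧
      (Sd bary)^[k] (Hd bary (f.onList σ.2)) (verts σ.1) = 0 := by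
    intro σ
    by_cases hσ : Set.range σ.2 ⊆ ⋃ i, U i
    · obtain ⟨m, hm⟩ := exists_sd_eq_zero U hU f hf σ.2 hσ
      exact ⟨m, fun _ => hm⟩
    · exact ⟨0, fun h => absurd h hσ⟩
  choose m hm using hex
  -- The homotopy terms with index at least `m σ` vanish on `σ`, so the sum may be cut off anywhere
  -- beyond. Hence one number `M` serves a simplex and all its faces, although `m` varies from
  -- simplex to simplex.
  have hM : ∀ σ : Sing X, Set.range σ.2 ⊆ ⋃ i, U i → ∀ k, m σ ≤ k →
      f.sdHomotopy (m σ) σ.2 (verts σ.1) = f.sdHomotopy k σ.2 (verts σ.1) := by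
    intro σ hσ k hk
    refine Finset.sum_subset (Finset.range_mono hk) fun i _ hi => ?_
    exact (hm σ hσ i (by simpa using hi)).2
  refine ⟨of fun σ => f.sdHomotopy (m σ) σ.2 (verts σ.1), ?_, ?_⟩
  · rintro ⟨n, σ⟩ hσ
    cases n with
    | zero =>
      -- Both sides are zero on a point: the point lies in some `U i`, where `f` vanishes.
      rw [d_zero_dim]
      obtain ⟨i, hi⟩ := Set.mem_iUnion.1 (hσ ⟨vert 0 0, rfl⟩)
      refine (hf _ i ?_).symm
      rintro _ ⟨t, rfl⟩
      rwa [Subsingleton.elim t (vert 0 0)]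
    | succ n =>
      have hface : ∀ i, Set.range (σ.pull n (skip i)) ⊆ Set.range σ := by
        rintro i _ ⟨t, rfl⟩
        exact ⟨_, rfl⟩
      set M := m ⟨n + 1, σ⟩ + ∑ i ∈ Finset.range (n + 2), m ⟨n, σ.pull n (skip i)⟩ with hMdef
      have hd' : dL (f.onList σ) = fun _ => 0 := by
        rw [← onList_d']
        exact onList_eq_zero_fun fun τ hτ => hd τ (hτ.trans hσ)
      have h1 := Sd_iterate_homotopy bary (f.onList σ) hd' M (verts (n + 1))
      rw [(hm ⟨n + 1, σ⟩ hσ M (by omega)).1, sub_zero, onList_verts] at h1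
      rw [h1, d_succ, dL_eq_sum, length_verts]
      refine Finset.sum_congr rfl fun i hi => ?_
      have hle : m ⟨n, σ.pull n (skip i)⟩ ≤ M :=
        (Finset.single_le_sum (f := fun i => m ⟨n, σ.pull n (skip i)⟩)
          (fun _ _ => Nat.zero_le _) hi).trans (Nat.le_add_left _ _)
      rw [of_val, hM ⟨n, σ.pull n (skip i)⟩ ((hface i).trans hσ) M hle, sdHomotopy_pull,
        verts_map_skip n i (by have := Finset.mem_range.1 hi; omega)]
      rfl
  · rintro ⟨n, σ⟩ hσ
    have h0 := onList_eq_zero_fun hσ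
    simp only [of_val, sdHomotopy, h0, Hd_zero, Sd_iterate_zero, Finset.sum_const_zero]

end Cochain

/-! ### Cochains on subsets -/

namespace Cochain

/-- `f` vanishes on the simplices contained in `A`. -/
def VanOn (A : Set X) (f : Cochain X) : Prop := ∀ σ : Sing X, Set.range σ.2 ⊆ A → f σ = 0

/-- `f` and `g` agree on the simplices contained in `A`. -/
def EqOn (A : Set X) (f g : Cochain X) : Prop := ∀ σ : Sing X, Set.range σ.2 ⊆ A → f σ = g σ

theorem sub_val (f g : Cochain X) (σ : Sing X) : (f - g) σ = f σ - g σ := rfl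

theorem d_sub (f g : Cochain X) : d (f - g) = d f - d g := by
  rw [sub_eq_add_neg, d_add, d_neg, ← sub_eq_add_neg]

theorem range_pull {n m : ℕ} (σ : Simp n X) (a : ℕ → ℕ) : Set.range (σ.pull m a) ⊆ Set.range σ := by
  rintro _ ⟨t, rfl⟩
  exact ⟨_, rfl⟩

section

variable {A B : Set X} {f f' g g' : Cochain X}

theorem VanOn.mono (h : VanOn B f) (hAB : A ⊆ B) : VanOn A f := fun σ hσ => h σ (hσ.trans hAB)

theorem EqOn.mono (h : EqOn B f g) (hAB : A ⊆ B) : EqOn A f g := fun σ hσ => h σ (hσ.trans hAB)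

theorem EqOn.symm (h : EqOn A f g) : EqOn A g f := fun σ hσ => (h σ hσ).symm

theorem EqOn.trans {k : Cochain X} (h : EqOn A f g) (h' : EqOn A g k) : EqOn A f k :=
  fun σ hσ => (h σ hσ).trans (h' σ hσ)

theorem VanOn.eqOn (h : VanOn A f) : EqOn A f 0 := h

theorem VanOn.add (h : VanOn A f) (h' : VanOn A g) : VanOn A (f + g) :=
  fun σ hσ => by rw [add_val, h σ hσ, h' σ hσ, add_zero]

theorem VanOn.sub (h : VanOn A f) (h' : VanOn A g) : VanOn A (f - g) :=
  fun σ hσ => by rw [sub_val, h σ hσ, h' σ hσ, sub_zero]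

theorem VanOn.neg (h : VanOn A f) : VanOn A (-f) :=
  fun σ hσ => by rw [neg_val, h σ hσ, neg_zero]

theorem VanOn.inv (h : VanOn A f) : VanOn A f.inv :=
  fun σ hσ => by rw [inv_val, h σ hσ, mul_zero]

theorem vanOn_zero : VanOn A (0 : Cochain X) := fun _ _ => rfl

theorem EqOn.sub (h : EqOn A f g) (h' : EqOn A f' g') : EqOn A (f - f') (g - g') :=
  fun σ hσ => by rw [sub_val, h σ hσ, h' σ hσ, sub_val]

theorem EqOn.d (h : EqOn A f g) : EqOn A f.d g.d := by
  rintro ⟨n, σ⟩ hσ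
  cases n with
  | zero => rw [d_zero_dim, d_zero_dim]
  | succ n =>
    rw [d_succ, d_succ]
    exact Finset.sum_congr rfl fun i _ => by rw [h _ ((range_pull σ _).trans hσ)]

theorem EqOn.mul (h : EqOn A f g) (h' : EqOn A f' g') : EqOn A (f * f') (g * g') := by
  rintro ⟨n, σ⟩ hσ
  rw [mul_val, mul_val]
  exact Finset.sum_congr rfl fun i _ => by
    rw [h _ ((range_pull σ _).trans hσ), h' _ ((range_pull σ _).trans hσ)]

theorem VanOn.d (h : VanOn A f) : VanOn A f.d := by
  have := h.eqOn.d
  rwa [d_zero] at this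

theorem VanOn.mul_right (h : VanOn A f) (g : Cochain X) : VanOn A (f * g) := by
  have := EqOn.mul h.eqOn (fun σ _ => rfl : EqOn A g g)
  rwa [zero_mul] at this

theorem VanOn.mul_left (h : VanOn A f) (g : Cochain X) : VanOn A (g * f) := by
  have := EqOn.mul (fun σ _ => rfl : EqOn A g g) h.eqOn
  rwa [mul_zero] at this

theorem VanOn.pullback {A : Set X} {B : Set Y} {f : Cochain Y} (h : VanOn B f) (φ : C(X, Y))
    (hφ : ∀ x ∈ A, φ x ∈ B) : VanOn A (pullback φ f) := by
  rintro ⟨n, σ⟩ hσ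
  refine h _ ?_
  rintro _ ⟨t, rfl⟩
  exact hφ _ (hσ ⟨t, rfl⟩)

end

theorem pullback_add (φ : C(X, Y)) (f g : Cochain Y) :
    pullback φ (f + g) = pullback φ f + pullback φ g := rfl

theorem pullback_sub (φ : C(X, Y)) (f g : Cochain Y) :
    pullback φ (f - g) = pullback φ f - pullback φ g := rfl

theorem pullback_zero (φ : C(X, Y)) : pullback φ (0 : Cochain Y) = 0 := rfl

theorem pullback_one (φ : C(X, Y)) : pullback φ (1 : Cochain Y) = 1 := rfl

theorem pullback_comp (φ : C(X, Y)) (ψ : C(Y, Z)) (f : Cochain Z) :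
    pullback (ψ.comp φ) f = pullback φ (pullback ψ f) := rfl

theorem pullback_id (f : Cochain X) : pullback (ContinuousMap.id X) f = f := rfl

theorem inv_pullback (φ : C(X, Y)) (f : Cochain Y) : inv (pullback φ f) = pullback φ (inv f) := rfl

/-- Cochains on an embedded subspace extend. -/
theorem exists_extend (j : C(Z, X)) (hj : Topology.IsEmbedding j) (f : Cochain Z) :
    ∃ F : Cochain X, pullback j F = f ∧ ∀ A : Set X, VanOn (j ⁻¹' A) f → VanOn A F := by
  classical
  let lift : ∀ σ : Sing X, Set.range σ.2 ⊆ Set.range j → Sing Z := fun σ h =>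
    ⟨σ.1, (⟨hj.toHomeomorph.symm, hj.toHomeomorph.symm.continuous⟩ : C(Set.range j, Z)).comp
      ⟨fun t => ⟨σ.2 t, h ⟨t, rfl⟩⟩, σ.2.continuous.subtype_mk _⟩⟩
  have hlift : ∀ (σ : Sing X) (h) (t : Dl σ.1), j ((lift σ h).2 t) = σ.2 t := by
    intro σ h t
    exact congrArg Subtype.val (hj.toHomeomorph.apply_symm_apply ⟨σ.2 t, h ⟨t, rfl⟩⟩)
  refine ⟨of fun σ => if h : Set.range σ.2 ⊆ Set.range j then f (lift σ h) else 0, ?_, ?_⟩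
  · refine ext fun n σ => ?_
    have h : Set.range (j.comp σ) ⊆ Set.range j := by
      rintro _ ⟨t, rfl⟩; exact ⟨_, rfl⟩
    refine (dif_pos h).trans ?_
    congr 1
    refine Sigma.ext rfl (heq_of_eq ?_)
    ext t
    exact hj.injective (hlift ⟨n, j.comp σ⟩ h t)
  · intro A hA σ hσ
    rw [of_val]
    split_ifs with h
    · refine hA _ ?_
      rintro _ ⟨t, rfl⟩
      change j ((lift σ h).2 t) ∈ A
      rw [hlift]
      exact hσ ⟨t, rfl⟩
    · rfl

theorem eqOn_range_of_pullback_eq {j : C(Z, X)} (hj : Topology.IsEmbedding j) {f g : Cochain X}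
    (h : pullback j f = pullback j g) : EqOn (Set.range j) f g := by
  rintro ⟨n, σ⟩ hσ
  let τ : Simp n Z := (⟨hj.toHomeomorph.symm, hj.toHomeomorph.symm.continuous⟩ :
    C(Set.range j, Z)).comp ⟨fun t => ⟨σ t, hσ ⟨t, rfl⟩⟩, σ.continuous.subtype_mk _⟩
  have e : j.comp τ = σ := by
    ext t
    exact congrArg Subtype.val (hj.toHomeomorph.apply_symm_apply ⟨σ t, hσ ⟨t, rfl⟩⟩)
  have := congrFun h ⟨n, τ⟩
  rw [pullback_apply, pullback_apply, e] at this
  exact this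

theorem pullback_eq_of_eqOn {j : C(Z, X)} {f g : Cochain X} (h : EqOn (Set.range j) f g) :
    pullback j f = pullback j g := by
  refine ext fun n σ => h _ ?_
  rintro _ ⟨t, rfl⟩
  exact ⟨_, rfl⟩

/-! ### Homogeneous components -/

/-- The component of degree `n`. -/
def comp (n : ℕ) (f : Cochain X) : Cochain X := of fun σ => if σ.1 = n then f σ else 0

theorem comp_val (n : ℕ) (f : Cochain X) (σ : Sing X) :
    comp n f σ = if σ.1 = n then f σ else 0 := rfl

theorem supp_comp (n : ℕ) (f : Cochain X) : Supp n (comp n f) := fun _ h => if_neg h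

theorem Supp.comp_eq {n : ℕ} {f : Cochain X} (h : Supp n f) : comp n f = f := by
  refine ext fun k σ => ?_
  rw [comp_val]
  split_ifs with hk
  · rfl
  · exact (h _ hk).symm

theorem VanOn.comp {A : Set X} {f : Cochain X} (h : VanOn A f) (n : ℕ) : VanOn A (comp n f) :=
  fun σ hσ => by rw [comp_val, h σ hσ, ite_self]

theorem comp_add (n : ℕ) (f g : Cochain X) : comp n (f + g) = comp n f + comp n g := by
  refine ext fun k σ => ?_
  simp only [comp_val, add_val]
  split_ifs <;> simp

theorem comp_sub (n : ℕ) (f g : Cochain X) : comp n (f - g) = comp n f - comp n g := by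
  refine ext fun k σ => ?_
  simp only [comp_val, sub_val]
  split_ifs <;> simp

theorem comp_succ_d (n : ℕ) (f : Cochain X) : comp (n + 1) f.d = (comp n f).d := by
  refine ext fun k σ => ?_
  rw [comp_val]
  cases k with
  | zero => simp [d_zero_dim]
  | succ k =>
    simp only [d_succ, comp_val, Nat.succ_inj]
    split_ifs <;> simp

theorem comp_zero_d (f : Cochain X) : comp 0 f.d = 0 := by
  refine ext fun k σ => ?_
  rw [comp_val]
  split_ifs with h
  · subst h; exact d_zero_dim _ _
  · rfl

theorem Supp.d {n : ℕ} {f : Cochain X} (h : Supp n f) : Supp (n + 1) f.d := by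
  rw [← h.comp_eq, ← comp_succ_d]
  exact supp_comp _ _

theorem comp_mul_of_supp {p : ℕ} {f : Cochain X} (hf : Supp p f) (q : ℕ) (g : Cochain X) :
    comp (p + q) (f * g) = f * comp q g := by
  refine ext fun k σ => ?_
  rw [comp_val, mul_val, mul_val]
  split_ifs with h
  · refine Finset.sum_congr rfl fun x hx => ?_
    by_cases h1 : x.1 = p
    · have : x.2 = q := by
        have := Finset.HasAntidiagonal.mem_antidiagonal.1 hx
        simp only at this h
        omega
      rw [comp_val, if_pos this]
    · rw [hf _ h1, zero_mul, zero_mul]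
  · symm
    refine Finset.sum_eq_zero fun x hx => ?_
    by_cases h1 : x.1 = p
    · have : x.2 ≠ q := by
        have := Finset.HasAntidiagonal.mem_antidiagonal.1 hx
        simp only at this h
        omega
      rw [comp_val, if_neg this, mul_zero]
    · rw [hf _ h1, zero_mul]

theorem Supp.mul {p q : ℕ} {f g : Cochain X} (hf : Supp p f) (hg : Supp q g) :
    Supp (p + q) (f * g) := by
  rw [← hg.comp_eq, ← comp_mul_of_supp hf]
  exact supp_comp _ _

theorem Supp.pullback {p : ℕ} {f : Cochain Y} (hf : Supp p f) (φ : C(X, Y)) :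
    Supp p (pullback φ f) := fun _ h => hf _ h

theorem Supp.inv_eq {p : ℕ} {f : Cochain X} (hf : Supp p f) (hp : Even p) : inv f = f := by
  refine ext fun k σ => ?_
  rw [inv_val]
  by_cases h : k = p
  · subst h; simp [hp.neg_one_pow]
  · rw [hf _ h, mul_zero]

theorem supp_one : Supp 0 (1 : Cochain X) := fun σ h => by rw [one_val, if_neg h]

end Cochain

/-! ### Degrees in the cohomology ring -/

namespace Coh

theorem mk_surjective (a : Coh X) : ∃ f : cocycles X, mk f = a := by
  obtain ⟨f, hf⟩ := Quotient.exists_rep a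
  exact ⟨f, hf⟩

theorem map_mk (φ : C(X, Y)) (f : cocycles Y) : map φ (mk f) = mk (cocyclesPullback φ f) := rfl

theorem map_comp (φ : C(X, Y)) (ψ : C(Y, Z)) (a : Coh Z) :
    map (ψ.comp φ) a = map φ (map ψ a) := by
  obtain ⟨f, rfl⟩ := mk_surjective a
  rfl

theorem map_id (a : Coh X) : map (ContinuousMap.id X) a = a := by
  obtain ⟨f, rfl⟩ := mk_surjective a
  rfl

theorem mk_eq_zero_iff {f : cocycles X} : mk f = 0 ↔ ∃ h : Cochain X, h.d = f := by
  rw [← RingHom.map_zero (mk : cocycles X →+* Coh X), mk_eq_iff]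
  simp

variable {n m : ℕ} {a b : Coh X}

theorem InDegree.zero : InDegree n (0 : Coh X) := ⟨0, RingHom.map_zero _, fun _ _ => rfl⟩

theorem InDegree.one : InDegree 0 (1 : Coh X) := ⟨1, RingHom.map_one _, Cochain.supp_one⟩

theorem InDegree.add (ha : InDegree n a) (hb : InDegree n b) : InDegree n (a + b) := by
  obtain ⟨f, rfl, hf⟩ := ha
  obtain ⟨g, rfl, hg⟩ := hb
  refine ⟨f + g, RingHom.map_add _ _ _, fun σ h => ?_⟩
  change (f : Cochain X) σ + (g : Cochain X) σ = 0
  rw [hf σ h, hg σ h, add_zero]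

theorem InDegree.neg (ha : InDegree n a) : InDegree n (-a) := by
  obtain ⟨f, rfl, hf⟩ := ha
  refine ⟨-f, RingHom.map_neg _ _, fun σ h => ?_⟩
  change - (f : Cochain X) σ = 0
  rw [hf σ h, neg_zero]

theorem InDegree.mul (ha : InDegree n a) (hb : InDegree m b) : InDegree (n + m) (a * b) := by
  obtain ⟨f, rfl, hf⟩ := ha
  obtain ⟨g, rfl, hg⟩ := hb
  exact ⟨f * g, RingHom.map_mul _ _ _, Cochain.Supp.mul hf hg⟩

theorem InDegree.sum {ι : Type*} {s : Finset ι} {a : ι → Coh X} (h : ∀ i ∈ s, InDegree n (a i)) :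
    InDegree n (∑ i ∈ s, a i) := by
  classical
  induction s using Finset.induction_on with
  | empty => exact InDegree.zero
  | insert i s hi ih =>
    rw [Finset.sum_insert hi]
    exact (h i (by simp)).add (ih fun j hj => h j (by simp [hj]))

theorem InDegree.pow (ha : InDegree n a) (k : ℕ) : InDegree (n * k) (a ^ k) := by
  induction k with
  | zero => rw [pow_zero, Nat.mul_zero]; exact InDegree.one
  | succ k ih => rw [pow_succ]; exact ih.mul ha

theorem InDegree.map {a : Coh Y} (ha : InDegree n a) (φ : C(X, Y)) : InDegree n (Coh.map φ a) := by
  obtain ⟨f, rfl, hf⟩ := ha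
  exact ⟨cocyclesPullback φ f, rfl, Cochain.Supp.pullback hf φ⟩

/-- Classes of even degree are central. -/
theorem InDegree.commute (ha : InDegree n a) (hn : Even n) (b : Coh X) : Commute a b := by
  obtain ⟨f, rfl, hf⟩ := ha
  obtain ⟨g, rfl⟩ := mk_surjective b
  obtain ⟨h, hh⟩ := Cochain.exists_d_eq_commutator (g : Cochain X) (f : Cochain X) n hn hf f.2 g.2
  change mk f * mk g = mk g * mk f
  rw [← RingHom.map_mul, ← RingHom.map_mul]
  exact (mk_eq_iff.2 ⟨h, hh⟩).symm

/-- Classes of degree zero are determined by their values on points. -/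
theorem InDegree.mk_eq_zero {f : cocycles X} (hf : Cochain.Supp 0 (f : Cochain X))
    (h : mk f = 0) : (f : Cochain X) = 0 := by
  obtain ⟨g, hg⟩ := mk_eq_zero_iff.1 h
  rw [← hf.comp_eq, ← hg, Cochain.comp_zero_d]

end Coh

/-! ### Homotopy invariance -/

/-- The lattice path that first goes to the right and then upwards. -/
def cornerPath : ℕ → ℕ → List (ℕ × ℕ)
  | 0, 0 => [(0, 0)]
  | 0, q + 1 => (0, 0) :: (cornerPath 0 q).map (Prod.map id Nat.succ)
  | p + 1, q => (0, 0) :: (cornerPath p q).map (Prod.map Nat.succ id)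

theorem pathSum_zero_right (p : ℕ) (F : List (ℕ × ℕ) → ℤ) : pathSum p 0 F = F (cornerPath p 0) := by
  induction p generalizing F with
  | zero => rw [pathSum, cornerPath]
  | succ p ih => rw [pathSum, ih, cornerPath]

theorem cornerPath_zero_right (p : ℕ) :
    cornerPath p 0 = (List.range (p + 1)).map fun i => (i, 0) := by
  induction p with
  | zero => simp [cornerPath]
  | succ p ih =>
    rw [cornerPath, ih, List.range_succ_eq_map (n := p + 1)]
    simp [Function.comp_def]

theorem prodSimp_cornerPath_zero {p : ℕ} (σ : Simp p X) (τ : Simp 0 Y) :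
    prodSimp σ τ (cornerPath p 0) = ⟨p, σ.prodMk (ContinuousMap.const _ (τ (vert 0 0)))⟩ := by
  have gen : ∀ n, n = p → (⟨n, (σ.pull n fun i => ((cornerPath p 0).getD i (0, 0)).1).prodMk
      (τ.pull n fun i => ((cornerPath p 0).getD i (0, 0)).2)⟩ : Sing (X × Y)) =
        ⟨p, σ.prodMk (ContinuousMap.const _ (τ (vert 0 0)))⟩ := by
    rintro n rfl
    rw [Simp.pull_id]
    · congr 2
      ext t
      exact congrArg τ (Subsingleton.elim _ _)
    · intro i hi
      rw [cornerPath_zero_right, List.getD_eq_getElem _ _ (by simp; omega)]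
      simp
  exact gen _ (by simp [cornerPath_zero_right])

theorem slantSimp_zero_dim (f : Cochain (X × Y)) (τ : Simp 0 Y) :
    slantSimp f ⟨0, τ⟩ = Cochain.pullback
      ((ContinuousMap.id X).prodMk (ContinuousMap.const X (τ (vert 0 0)))) f := by
  refine Cochain.ext fun p σ => ?_
  change pathSum p 0 _ = f ⟨p, _⟩
  rw [pathSum_zero_right, prodSimp_cornerPath_zero]
  rfl

theorem prodSimp_mem {p q : ℕ} (σ : Simp p X) (τ : Simp q Y) (l : List (ℕ × ℕ))
    {S : Set (X × Y)} (h : ∀ s ∈ Set.range σ, ∀ t ∈ Set.range τ, (s, t) ∈ S) :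
    Set.range (prodSimp σ τ l).2 ⊆ S := by
  rintro _ ⟨t, rfl⟩
  exact h _ (Cochain.range_pull σ _ ⟨t, rfl⟩) _ (Cochain.range_pull τ _ ⟨t, rfl⟩)

theorem pathSum_eq_zero (p q : ℕ) (F : List (ℕ × ℕ) → ℤ) (h : ∀ l, F l = 0) :
    pathSum p q F = 0 := by
  rw [pathSum_congr p q F (fun _ => 0 * 0) (fun l _ _ => by simpa using h l), pathSum_mul, zero_mul]

theorem slantSimp_eq_zero {f : Cochain (X × Y)} {S : Set (X × Y)} (hf : f.VanOn S) (σ : Sing X)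
    (τ : Sing Y) (h : ∀ s ∈ Set.range σ.2, ∀ t ∈ Set.range τ.2, (s, t) ∈ S) :
    slantSimp f τ σ = 0 :=
  pathSum_eq_zero _ _ _ fun l => hf _ (prodSimp_mem _ _ l h)

/-- Homotopic maps induce cohomologous pull-backs of a cocycle. -/
theorem Cochain.exists_homotopy (H : C(X × unitInterval, Y)) (f : Cochain Y) (hf : f.d = 0) :
    ∃ K : Cochain X, K.d =
        pullback (H.comp ((ContinuousMap.id X).prodMk (ContinuousMap.const X 1))) f -
        pullback (H.comp ((ContinuousMap.id X).prodMk (ContinuousMap.const X 0))) f ∧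
      ∀ (A : Set X) (B : Set Y), (∀ x ∈ A, ∀ t, H (x, t) ∈ B) → VanOn B f → VanOn A K := by
  let τ : Simp 1 unitInterval := ⟨stdSimplexHomeomorphUnitInterval,
    stdSimplexHomeomorphUnitInterval.continuous⟩
  set F := pullback H f with hF
  have hFd : F.d = 0 := by rw [hF, d_pullback, hf, pullback_zero]
  -- The prism operator is the slant product with the 1-simplex that parametrises the interval;
  -- `inv` absorbs the sign in `slantSimp_d`.
  refine ⟨(slantSimp F ⟨1, τ⟩).inv, ?_, ?_⟩
  · have h0 : (τ.pull 0 (skip 0)) (vert 0 0) = 1 := by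
      change stdSimplexHomeomorphUnitInterval (stdSimplex.map _ (vert 0 0)) = 1
      rw [map_vert_vtx _ _ le_rfl]
      exact stdSimplexHomeomorphUnitInterval_one
    have h1 : (τ.pull 0 (skip 1)) (vert 0 0) = 0 := by
      change stdSimplexHomeomorphUnitInterval (stdSimplex.map _ (vert 0 0)) = 0
      rw [map_vert_vtx _ _ le_rfl]
      exact stdSimplexHomeomorphUnitInterval_zero
    refine ext fun n σ => ?_
    have h := slantSimp_d F ⟨n, σ⟩ ⟨1, τ⟩
    have hz : slantSimp (0 : Cochain (X × unitInterval)) ⟨1, τ⟩ ⟨n, σ⟩ = 0 :=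
      pathSum_eq_zero _ _ _ fun _ => rfl
    rw [hFd, hz] at h
    simp only [bdrySimp, Finset.sum_range_succ, Finset.sum_range_zero, zero_add, map_add,
      Finsupp.linearCombination_single, slantSimp_zero_dim, h0, h1, pow_zero, pow_one, one_smul,
      neg_smul] at h
    rw [d_inv, neg_val, inv_val, sub_val, eq_neg_of_add_eq_zero_left h.symm]
    have e : ((-1 : ℤ) ^ n) * (-1) ^ n = 1 := by rw [← mul_pow]; simp
    simp only [hF, ← pullback_comp]
    linear_combination (pullback (H.comp ((ContinuousMap.id X).prodMk (ContinuousMap.const X 1))) f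
      ⟨n, σ⟩ - pullback (H.comp ((ContinuousMap.id X).prodMk (ContinuousMap.const X 0))) f
      ⟨n, σ⟩) * e
  · intro A B hAB hfB
    refine VanOn.inv fun σ hσ => ?_
    refine slantSimp_eq_zero (S := {q | H q ∈ B}) (hfB.pullback H fun _ h => h) _ _ ?_
    intro s hs t _
    exact hAB s (hσ hs) t

/-! ### Deformations and two-set covers -/

namespace Cochain

theorem vanOn_univ {f : Cochain X} (h : VanOn Set.univ f) : f = 0 :=
  ext fun _ _ => h _ (Set.subset_univ _)

/-- The bottom end of the prism homotopy vanishes because the deformation ends in `A`, and the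
primitive is again relative because `A` is preserved. In other words, the pair has no cohomology. -/
theorem exists_d_eq_of_deformation {A : Set X} (H : C(X × unitInterval, X))
    (h1 : ∀ x, H (x, 1) = x) (h0 : ∀ x, H (x, 0) ∈ A) (hA : ∀ x ∈ A, ∀ t, H (x, t) ∈ A)
    {f : Cochain X} (hf : f.d = 0) (hfA : VanOn A f) : ∃ g : Cochain X, VanOn A g ∧ g.d = f := by
  obtain ⟨K, hK, hKA⟩ := exists_homotopy H f hf
  refine ⟨K, hKA A A hA hfA, ?_⟩
  have e1 : H.comp ((ContinuousMap.id X).prodMk (ContinuousMap.const X 1)) = ContinuousMap.id X :=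
    ContinuousMap.ext h1
  have e0 : pullback (H.comp ((ContinuousMap.id X).prodMk (ContinuousMap.const X 0))) f = 0 :=
    vanOn_univ (hfA.pullback _ fun x _ => h0 x)
  rw [hK, e1, e0, pullback_id, sub_zero]

/-- The values on simplices contained in `A` go to `k₂`, all others to `k₁`. A simplex contained in
both sets lies in `A ∩ B`, where `k` is zero. -/
theorem exists_split {A B : Set X} {k : Cochain X} (hk : VanOn (A ∩ B) k) :
    ∃ k₁ k₂ : Cochain X, VanOn A k₁ ∧ VanOn B k₂ ∧ k = k₁ - k₂ := by
  classical
  refine ⟨of fun σ => if Set.range σ.2 ⊆ A then 0 else k σ,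
    of fun σ => if Set.range σ.2 ⊆ A then - k σ else 0, fun σ h => if_pos h, fun σ h => ?_, ?_⟩
  · rw [of_val]
    split_ifs with h'
    · rw [hk σ (Set.subset_inter h' h), neg_zero]
    · rfl
  · refine ext fun n σ => ?_
    rw [sub_val, of_val, of_val]
    split_ifs <;> simp

/-- Excision at the level of cochains. Vanishing on `U` and on `V` says nothing about simplices of
the union that lie in neither; a coboundary repairs this. The last clause keeps the correction
relative to every set on which `f` was already zero. -/
theorem exists_correction {U V : Set X} (hU : IsOpen U) (hV : IsOpen V) {f : Cochain X}
    (hfU : VanOn U f) (hfV : VanOn V f) (hd : VanOn (U ∪ V) f.d) :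
    ∃ h : Cochain X, VanOn (U ∪ V) (f - h.d) ∧ ∀ C, VanOn C f → VanOn C h := by
  obtain ⟨h, h1, h2⟩ := exists_d_eq_of_small (fun b : Bool => cond b U V)
    (by rintro (_ | _) <;> assumption) f
    (fun σ hσ => hd σ (hσ.trans (Set.union_eq_iUnion (s₁ := U) (s₂ := V)).ge))
    (by rintro τ (_ | _) hτ; exacts [hfV τ hτ, hfU τ hτ])
  refine ⟨h, fun σ hσ => ?_, fun C hC σ hσ => h2 σ fun τ hτ => hC τ (hτ.trans hσ)⟩
  rw [sub_val, h1 σ (hσ.trans (Set.union_eq_iUnion (s₁ := U) (s₂ := V)).le), sub_self]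

end Cochain

/-! ### Suspension -/

open Cochain

section Suspension

variable (A : Set X)

/-- The complement of `(X ∖ A) × 0` in `X × ℝ`. -/
def suspSet : Set (X × ℝ) := {q | q.1 ∈ A ∨ q.2 ≠ 0}

/-- The union of `A × ℝ` and the upper half of `X × ℝ`. -/
def suspPos : Set (X × ℝ) := {q | q.1 ∈ A ∨ 0 < q.2}

/-- The union of `A × ℝ` and the lower half of `X × ℝ`. -/
def suspNeg : Set (X × ℝ) := {q | q.1 ∈ A ∨ q.2 < 0}

variable {A}

theorem suspPos_union_suspNeg {X : Type*} {A : Set X} : suspPos A ∪ suspNeg A = suspSet A := by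
  ext q
  simp only [suspPos, suspNeg, suspSet, Set.mem_union, Set.mem_ofPred_eq, ne_iff_lt_or_gt]
  tauto

theorem suspPos_inter_suspNeg {X : Type*} {A : Set X} : suspPos A ∩ suspNeg A = {q | q.1 ∈ A} := by
  ext q
  simp only [suspPos, suspNeg, Set.mem_inter_iff, Set.mem_ofPred_eq]
  constructor
  · rintro ⟨h | h, h' | h'⟩
    · exact h
    · exact h
    · exact h'
    · exact absurd h (not_lt.2 h'.le)
  · intro h
    exact ⟨Or.inl h, Or.inl h⟩

theorem isOpen_suspPos (hA : IsOpen A) : IsOpen (suspPos A) :=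
  (hA.preimage continuous_fst).union (isOpen_lt continuous_const continuous_snd)

theorem isOpen_suspNeg (hA : IsOpen A) : IsOpen (suspNeg A) :=
  (hA.preimage continuous_fst).union (isOpen_lt continuous_snd continuous_const)

theorem isOpen_suspSet (hA : IsOpen A) : IsOpen (suspSet A) := by
  rw [← suspPos_union_suspNeg]
  exact (isOpen_suspPos hA).union (isOpen_suspNeg hA)

/-- Moving the real coordinate linearly to 1 carries everything into the upper half and preserves
`suspPos A`, so this pair has no cohomology. -/
theorem exists_d_eq_suspPos {f : Cochain (X × ℝ)} (hf : f.d = 0) (hfA : VanOn (suspPos A) f) :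
    ∃ g, VanOn (suspPos A) g ∧ g.d = f := by
  refine exists_d_eq_of_deformation ⟨fun q => (q.1.1, (q.2 : ℝ) * q.1.2 + (1 - q.2)), by fun_prop⟩
    (fun x => by simp) (fun x => Or.inr (by simp)) ?_ hf hfA
  rintro ⟨x, t⟩ (h | h) s
  · exact Or.inl h
  · right
    have h0 := s.2.1
    have h1 := s.2.2
    simp only [ContinuousMap.coe_mk] at h ⊢
    rcases h0.eq_or_lt with h' | h'
    · rw [← h']; simp
    · have := mul_pos h' h; linarith

theorem exists_d_eq_suspNeg {f : Cochain (X × ℝ)} (hf : f.d = 0) (hfA : VanOn (suspNeg A) f) :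
    ∃ g, VanOn (suspNeg A) g ∧ g.d = f := by
  refine exists_d_eq_of_deformation ⟨fun q => (q.1.1, (q.2 : ℝ) * q.1.2 - (1 - q.2)), by fun_prop⟩
    (fun x => by simp) (fun x => Or.inr (by simp)) ?_ hf hfA
  rintro ⟨x, t⟩ (h | h) s
  · exact Or.inl h
  · right
    have h0 := s.2.1
    have h1 := s.2.2
    simp only [ContinuousMap.coe_mk] at h ⊢
    rcases h0.eq_or_lt with h' | h'
    · rw [← h']; simp
    · have := mul_neg_of_pos_of_neg h' h; linarith

/-- The inclusion of `X × 0`. -/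
def suspIncl : C(X, X × ℝ) := (ContinuousMap.id X).prodMk (ContinuousMap.const X 0)

/-- The class of `φ` on `(X, A)` corresponds to the class of `f` on the suspension. -/
def SuspRel (A : Set X) (f : Cochain (X × ℝ)) (φ : Cochain X) : Prop :=
  ∃ g₁ g₂ : Cochain (X × ℝ), VanOn (suspPos A) g₁ ∧ VanOn (suspNeg A) g₂ ∧ g₁.d = f ∧ g₂.d = f ∧
    pullback suspIncl (g₁ - g₂) = φ

theorem SuspRel.sub {f f' : Cochain (X × ℝ)} {φ φ' : Cochain X} (h : SuspRel A f φ)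
    (h' : SuspRel A f' φ') : SuspRel A (f - f') (φ - φ') := by
  obtain ⟨g₁, g₂, h1, h2, h3, h4, rfl⟩ := h
  obtain ⟨g₁', g₂', h1', h2', h3', h4', rfl⟩ := h'
  refine ⟨g₁ - g₁', g₂ - g₂', h1.sub h1', h2.sub h2', by rw [d_sub, h3, h3'],
    by rw [d_sub, h4, h4'], ?_⟩
  rw [← pullback_sub]
  congr 1
  abel

theorem SuspRel.mul {f : Cochain (X × ℝ)} {φ : Cochain X} (h : SuspRel A f φ) (y : Cochain X)
    (hy : y.d = 0) :
    SuspRel A (f * pullback (ContinuousMap.fst) y) (φ * y) := by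
  obtain ⟨g₁, g₂, h1, h2, h3, h4, rfl⟩ := h
  refine ⟨g₁ * pullback ContinuousMap.fst y, g₂ * pullback ContinuousMap.fst y,
    h1.mul_right _, h2.mul_right _, ?_, ?_, ?_⟩
  · rw [d_mul, d_pullback, hy, pullback_zero, mul_zero, add_zero, h3]
  · rw [d_mul, d_pullback, hy, pullback_zero, mul_zero, add_zero, h4]
  · rw [← sub_mul, pullback_mul]
    rfl

/-- `g₁ - g` and `g₂ - g` are relative cocycles of the two acyclic pairs. The difference of their
primitives, restricted to `X × 0`, bounds `φ`. -/
theorem SuspRel.exists_d_right {f : Cochain (X × ℝ)} {φ : Cochain X} (h : SuspRel A f φ)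
    {g : Cochain (X × ℝ)} (hg : VanOn (suspSet A) g) (hgf : g.d = f) :
    ∃ k, VanOn A k ∧ k.d = φ := by
  obtain ⟨g₁, g₂, h1, h2, h3, h4, rfl⟩ := h
  have hs : suspPos A ⊆ suspSet A := by rw [← suspPos_union_suspNeg]; exact Set.subset_union_left
  have hs' : suspNeg A ⊆ suspSet A := by rw [← suspPos_union_suspNeg]; exact Set.subset_union_right
  obtain ⟨m₁, hm₁, hm₁'⟩ := exists_d_eq_suspPos (A := A) (f := g₁ - g)
    (by rw [d_sub, h3, hgf, sub_self]) (h1.sub (hg.mono hs))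
  obtain ⟨m₂, hm₂, hm₂'⟩ := exists_d_eq_suspNeg (A := A) (f := g₂ - g)
    (by rw [d_sub, h4, hgf, sub_self]) (h2.sub (hg.mono hs'))
  refine ⟨pullback suspIncl (m₁ - m₂), ?_, ?_⟩
  · exact ((hm₁.mono (A := {q : X × ℝ | q.1 ∈ A}) fun q h => Or.inl h).sub
      (hm₂.mono fun q h => Or.inl h)).pullback _ fun x hx => hx
  · rw [d_pullback, d_sub, hm₁', hm₂']
    congr 1
    abel

/-- Contracting ℝ to 0 makes `g₁ - g₂` cohomologous to the pull-back of `φ`. As `φ` is bounded by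
`k`, the cochain `g₁ - g₂` has a primitive that vanishes on A × ℝ, the intersection of the two sets.
Splitting this primitive turns `g₁` and `g₂` into one cochain that vanishes on both sets, and
excision finishes the argument. -/
theorem SuspRel.exists_d_left (hA : IsOpen A) {f : Cochain (X × ℝ)} {φ : Cochain X}
    (h : SuspRel A f φ) (hf : VanOn (suspSet A) f) {k : Cochain X} (hk : VanOn A k)
    (hkφ : k.d = φ) : ∃ g, VanOn (suspSet A) g ∧ g.d = f := by
  obtain ⟨g₁, g₂, h1, h2, h3, h4, rfl⟩ := h
  have hA' : VanOn {q : X × ℝ | q.1 ∈ A} (g₁ - g₂) :=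
    (h1.mono fun q h => Or.inl h).sub (h2.mono fun q h => Or.inl h)
  obtain ⟨K, hK, hKA⟩ := exists_homotopy
    (⟨fun q => (q.1.1, (q.2 : ℝ) * q.1.2), by fun_prop⟩ : C((X × ℝ) × unitInterval, X × ℝ))
    (g₁ - g₂) (by rw [d_sub, h3, h4, sub_self])
  have hK' : (K + pullback ContinuousMap.fst k).d = g₁ - g₂ := by
    rw [d_add, hK, d_pullback, hkφ, ← pullback_comp]
    have e1 : (⟨fun q => (q.1.1, (q.2 : ℝ) * q.1.2), by fun_prop⟩ :
        C((X × ℝ) × unitInterval, X × ℝ)).comp ((ContinuousMap.id _).prodMk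
          (ContinuousMap.const _ 1)) = ContinuousMap.id _ := by
      ext q <;> simp
    have e0 : (⟨fun q => (q.1.1, (q.2 : ℝ) * q.1.2), by fun_prop⟩ :
        C((X × ℝ) × unitInterval, X × ℝ)).comp ((ContinuousMap.id _).prodMk
          (ContinuousMap.const _ 0)) = suspIncl.comp ContinuousMap.fst := by
      ext q <;> simp [suspIncl]
    rw [e1, e0, pullback_id]
    abel
  obtain ⟨k₁, k₂, hk₁, hk₂, hkk⟩ := exists_split (A := suspPos A) (B := suspNeg A)
    (k := K + pullback ContinuousMap.fst k) (by
      rw [suspPos_inter_suspNeg]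
      exact (hKA _ _ (fun x hx t => hx) hA').add (hk.pullback _ fun x hx => hx))
  have e : g₁ - k₁.d = g₂ - k₂.d := by
    rw [hkk, d_sub] at hK'
    rw [sub_eq_sub_iff_sub_eq_sub]
    exact hK'.symm
  obtain ⟨m, hm, hm'⟩ := exists_correction (isOpen_suspPos hA) (isOpen_suspNeg hA)
    (f := g₁ - k₁.d) (h1.sub hk₁.d) (by rw [e]; exact h2.sub hk₂.d)
    (by rw [d_sub, d_d, sub_zero, h3, suspPos_union_suspNeg]; exact hf)
  rw [suspPos_union_suspNeg] at hm
  exact ⟨_, hm, by rw [d_sub, d_sub, d_d, d_d, sub_zero, sub_zero, h3]⟩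

/-- The connecting map of Mayer–Vietoris: the pull-back of `φ` is split between the two sets, and
`f` is the common coboundary of the two parts, corrected so as to vanish on the union. Taking
components makes it homogeneous. -/
theorem exists_suspRel_left {n : ℕ} (hA : IsOpen A) {φ : Cochain X} (hφ : φ.d = 0)
    (hφA : VanOn A φ) (hn : Supp n φ) :
    ∃ f, f.d = 0 ∧ VanOn (suspSet A) f ∧ Supp (n + 1) f ∧ SuspRel A f φ := by
  obtain ⟨φ₁, φ₂, h1, h2, h3⟩ := exists_split (A := suspPos A) (B := suspNeg A)
    (k := pullback ContinuousMap.fst φ) (by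
      rw [suspPos_inter_suspNeg]
      exact hφA.pullback _ fun x hx => hx)
  have e : φ₁.d = φ₂.d := by
    rw [← sub_eq_zero, ← d_sub, ← h3, d_pullback, hφ, pullback_zero]
  obtain ⟨m, hm, hm'⟩ := exists_correction (isOpen_suspPos hA) (isOpen_suspNeg hA)
    (f := φ₁.d) h1.d (by rw [e]; exact h2.d) (by rw [d_d]; exact vanOn_zero)
  rw [suspPos_union_suspNeg] at hm
  refine ⟨comp (n + 1) (φ₁.d - m.d), ?_, hm.comp _, supp_comp _ _, comp n (φ₁ - m),
    comp n (φ₂ - m), (h1.sub (hm' _ h1.d)).comp _,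
    (h2.sub (hm' _ (by rw [e]; exact h2.d))).comp _, ?_, ?_, ?_⟩
  · rw [← comp_succ_d, d_sub, d_d, d_d, sub_zero]
    exact ext fun _ _ => ite_self _
  · rw [← comp_succ_d, d_sub]
  · rw [← comp_succ_d, d_sub, e]
  · rw [← comp_sub, sub_sub_sub_cancel_right, ← h3, ((hn.pullback _).comp_eq)]
    rfl

theorem exists_suspRel_right {f : Cochain (X × ℝ)} (hf : f.d = 0) (hfA : VanOn (suspSet A) f) :
    ∃ φ, φ.d = 0 ∧ VanOn A φ ∧ SuspRel A f φ := by
  have hs : suspPos A ⊆ suspSet A := by rw [← suspPos_union_suspNeg]; exact Set.subset_union_left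
  have hs' : suspNeg A ⊆ suspSet A := by rw [← suspPos_union_suspNeg]; exact Set.subset_union_right
  obtain ⟨g₁, h1, h3⟩ := exists_d_eq_suspPos hf (hfA.mono hs)
  obtain ⟨g₂, h2, h4⟩ := exists_d_eq_suspNeg hf (hfA.mono hs')
  refine ⟨pullback suspIncl (g₁ - g₂), ?_, ?_, g₁, g₂, h1, h2, h3, h4, rfl⟩
  · rw [d_pullback, d_sub, h3, h4, sub_self, pullback_zero]
  · exact ((h1.mono (A := {q : X × ℝ | q.1 ∈ A}) fun q h => Or.inl h).sub
      (h2.mono fun q h => Or.inl h)).pullback _ fun x hx => hx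

end Suspension

/-! ### The Thom isomorphism for trivial bundles -/

/-- Multiplication by the relative cocycle `u` is an isomorphism from the cohomology of `B` to the
cohomology of the pair `(T, T₀)`. -/
structure IsThomIso {T B : Type*} [TopologicalSpace T] [TopologicalSpace B] (p : C(T, B))
    (T₀ : Set T) (u : Cochain T) : Prop where
  inj : ∀ y : Cochain B, y.d = 0 → ∀ g : Cochain T, VanOn T₀ g → g.d = u * pullback p y →
    ∃ k : Cochain B, k.d = y
  surj : ∀ f : Cochain T, f.d = 0 → VanOn T₀ f → ∃ (y : Cochain B) (g : Cochain T), y.d = 0 ∧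
    VanOn T₀ g ∧ f = u * pullback p y + g.d

/-- There is a relative cocycle of degree `n` with a Thom isomorphism. -/
def HasThomCocycle {T B : Type*} [TopologicalSpace T] [TopologicalSpace B] (p : C(T, B))
    (T₀ : Set T) (n : ℕ) : Prop :=
  ∃ u : Cochain T, Supp n u ∧ u.d = 0 ∧ VanOn T₀ u ∧ IsThomIso p T₀ u

theorem hasThomCocycle_id : HasThomCocycle (ContinuousMap.id X) ∅ 0 := by
  have hv : ∀ f : Cochain X, VanOn ∅ f := fun f σ hσ =>
    ((Set.range_nonempty σ.2).ne_empty (Set.subset_empty_iff.1 hσ)).elim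
  refine ⟨1, supp_one, d_one, hv 1, ?_, ?_⟩
  · intro y _ g _ h
    exact ⟨g, by rw [h, one_mul, pullback_id]⟩
  · intro f hf _
    exact ⟨f, 0, hf, hv 0, by rw [one_mul, pullback_id, d_zero, add_zero]⟩

/-- The suspension correspondence `SuspRel` is compatible with multiplication by cocycles of the
base, so it transports a Thom isomorphism in both directions. -/
theorem HasThomCocycle.susp {B : Type*} [TopologicalSpace B] {p : C(X, B)} {A : Set X}
    (hA : IsOpen A) {n : ℕ} (h : HasThomCocycle p A n) :
    HasThomCocycle (p.comp ContinuousMap.fst) (suspSet A) (n + 1) := by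
  obtain ⟨κ, hκn, hκ, hκA, hi⟩ := h
  obtain ⟨κ', hκ', hκA', hκn', hrel⟩ := exists_suspRel_left hA hκ hκA hκn
  have hmul : ∀ y : Cochain B, y.d = 0 →
      SuspRel A (κ' * pullback (p.comp ContinuousMap.fst) y) (κ * pullback p y) := fun y hy =>
    hrel.mul (pullback p y) (by rw [d_pullback, hy, pullback_zero])
  refine ⟨κ', hκn', hκ', hκA', ?_, ?_⟩
  · intro y hy g hg hgd
    obtain ⟨k, hk, hk'⟩ := (hmul y hy).exists_d_right hg hgd
    exact hi.inj y hy k hk hk'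
  · intro f hf hfA
    obtain ⟨φ, hφ, hφA, hr⟩ := exists_suspRel_right hf hfA
    obtain ⟨y, k, hy, hk, rfl⟩ := hi.surj φ hφ hφA
    have h1 := hr.sub (hmul y hy)
    rw [add_sub_cancel_left] at h1
    obtain ⟨g, hg, hg'⟩ := h1.exists_d_left hA (hfA.sub (hκA'.mul_right _)) hk rfl
    exact ⟨y, g, hy, hg, by rw [hg']; abel⟩

theorem HasThomCocycle.homeo {B : Type*} [TopologicalSpace B] {p : C(X, B)} {A : Set X}
    {n : ℕ} (h : HasThomCocycle p A n) (e : Y ≃ₜ X) {p' : C(Y, B)} {A' : Set Y}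
    (hp : ∀ x, p' x = p (e x)) (hA : ∀ x, x ∈ A' ↔ e x ∈ A) : HasThomCocycle p' A' n := by
  obtain ⟨u, hun, hu, huA, hi⟩ := h
  let E : C(Y, X) := ⟨e, e.continuous⟩
  let E' : C(X, Y) := ⟨e.symm, e.symm.continuous⟩
  have hp' : p' = p.comp E := ContinuousMap.ext hp
  have h1 : ∀ f : Cochain X, pullback E' (pullback E f) = f := fun f => by
    rw [← pullback_comp, show E.comp E' = ContinuousMap.id X from ContinuousMap.ext fun x => by
      simp [E, E'], pullback_id]
  have h2 : ∀ f : Cochain Y, pullback E (pullback E' f) = f := fun f => by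
    rw [← pullback_comp, show E'.comp E = ContinuousMap.id Y from ContinuousMap.ext fun x => by
      simp [E, E'], pullback_id]
  have hA' : ∀ x ∈ A, E' x ∈ A' := fun x hx => (hA _).2 (by simpa [E'] using hx)
  refine ⟨pullback E u, hun.pullback _, by rw [d_pullback, hu, pullback_zero],
    huA.pullback _ fun x hx => (hA x).1 hx, ?_, ?_⟩
  · intro y hy g hg hgd
    refine hi.inj y hy (pullback E' g) (hg.pullback _ hA') ?_
    rw [d_pullback, hgd, hp', pullback_comp, pullback_mul, h1, h1]
  · intro f hf hfA
    obtain ⟨y, g, hy, hg, hfe⟩ := hi.surj (pullback E' f) (by rw [d_pullback, hf, pullback_zero])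
      (hfA.pullback _ hA')
    refine ⟨y, pullback E g, hy, hg.pullback _ fun x hx => (hA x).1 hx, ?_⟩
    have := congrArg (pullback E) hfe
    rw [h2] at this
    rw [this, hp', pullback_add, pullback_mul, d_pullback, pullback_comp]

/-- `W × ℂ^{n+1}` as a double suspension of `W × ℂ^n`. -/
def consHomeo (W : Type*) [TopologicalSpace W] (n : ℕ) :
    W × (Fin (n + 1) → ℂ) ≃ₜ ((W × (Fin n → ℂ)) × ℝ) × ℝ where
  toFun q := (((q.1, Fin.tail q.2), (q.2 0).re), (q.2 0).im)
  invFun q := (q.1.1.1, Fin.cons (⟨q.1.2, q.2⟩ : ℂ) q.1.1.2)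
  left_inv q := by simp
  right_inv q := by simp
  continuous_toFun := by
    have : Continuous fun q : W × (Fin (n + 1) → ℂ) => Fin.tail q.2 :=
      continuous_pi fun i => (continuous_apply (Fin.succ i)).comp continuous_snd
    have h0 : Continuous fun q : W × (Fin (n + 1) → ℂ) => q.2 0 :=
      (continuous_apply 0).comp continuous_snd
    exact (((continuous_fst.prodMk this).prodMk (Complex.continuous_re.comp h0)).prodMk
      (Complex.continuous_im.comp h0))
  continuous_invFun := by
    have h0 : Continuous fun q : ((W × (Fin n → ℂ)) × ℝ) × ℝ => (⟨q.1.2, q.2⟩ : ℂ) := by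
      have : (fun q : ((W × (Fin n → ℂ)) × ℝ) × ℝ => (⟨q.1.2, q.2⟩ : ℂ)) =
          fun q => (q.1.2 : ℂ) + (q.2 : ℂ) * Complex.I := by
        funext q; exact (Complex.mk_eq_add_mul_I _ _)
      rw [this]
      fun_prop
    refine (by fun_prop : Continuous fun q : ((W × (Fin n → ℂ)) × ℝ) × ℝ => q.1.1.1).prodMk ?_
    refine continuous_pi fun i => ?_
    refine Fin.cases ?_ (fun i => ?_) i
    · simpa using h0
    · simp only [Fin.cons_succ]; fun_prop

/-- Each complex coordinate is two real suspensions, and in rank zero the unit is a Thom cocycle.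
The sign on the fibres is not tracked; `isThomIso_prod` does not depend on it. -/
theorem hasThomCocycle_prod (W : Type*) [TopologicalSpace W] (n : ℕ) :
    HasThomCocycle (ContinuousMap.fst : C(W × (Fin n → ℂ), W)) {q | q.2 ≠ 0} (2 * n) := by
  induction n with
  | zero =>
    refine (hasThomCocycle_id (X := W)).homeo (Homeomorph.prodUnique W (Fin 0 → ℂ))
      (fun x => rfl) fun x => ?_
    simp only [Set.mem_ofPred_eq, Set.mem_empty_iff_false, iff_false, not_not]
    exact Subsingleton.elim _ _
  | succ n ih =>
    have ho : IsOpen {q : W × (Fin n → ℂ) | q.2 ≠ 0} :=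
      isOpen_ne_fun continuous_snd continuous_const
    refine ((ih.susp ho).susp (isOpen_suspSet ho)).homeo (consHomeo W n) (fun x => rfl) ?_
    intro q
    simp only [suspSet, consHomeo, Set.mem_ofPred_eq, Homeomorph.homeomorph_mk_coe,
      Equiv.coe_fn_mk]
    rw [← not_iff_not]
    simp only [not_or, not_not, ne_eq]
    constructor
    · intro h
      rw [h]
      exact ⟨⟨rfl, rfl⟩, rfl⟩
    · rintro ⟨⟨h1, h2⟩, h3⟩
      funext i
      refine Fin.cases ?_ (fun i => ?_) i
      · exact Complex.ext h2 h3
      · exact congrFun h1 i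

/-! ### From local to global Thom isomorphisms -/

open Cochain

section LocalToGlobal

variable {T B : Type*} [TopologicalSpace T] [TopologicalSpace B]

/-- The mapping cone of multiplication by `u` is acyclic over `W`. -/
def ConeAcyclic (p : C(T, B)) (T₀ : Set T) (u : Cochain T) (W : Set B) : Prop :=
  ∀ (k : Cochain B) (h : Cochain T), VanOn T₀ h → VanOn W k.d →
    EqOn (p ⁻¹' W) h.d (u * pullback p k) → ∃ (k' : Cochain B) (h' : Cochain T), VanOn T₀ h' ∧
      EqOn W k'.d k ∧ EqOn (p ⁻¹' W) (u * pullback p k' - h'.d) h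

/-- `(k', h')` bounds `(k, h)` in the mapping cone over `U`. -/
structure ConeBounds (p : C(T, B)) (T₀ : Set T) (u : Cochain T) (k : Cochain B) (h : Cochain T)
    (U : Set B) (k' : Cochain B) (h' : Cochain T) : Prop where
  isOpen : IsOpen U
  vanOn : VanOn T₀ h'
  base : EqOn U k'.d k
  total : EqOn (p ⁻¹' U) (u * pullback p k' - h'.d) h

theorem Cochain.exists_glue {U V : Set X} {f g : Cochain X} (h : EqOn (U ∩ V) f g) :
    ∃ k : Cochain X, EqOn U k f ∧ EqOn V k g ∧ ∀ C, VanOn C f → VanOn C g → VanOn C k := by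
  classical
  refine ⟨of fun σ => if Set.range σ.2 ⊆ U then f σ else g σ, fun σ hσ => if_pos hσ,
    fun σ hσ => ?_, fun C hf hg σ hσ => ?_⟩
  · rw [of_val]
    split_ifs with h'
    · exact h σ (Set.subset_inter h' hσ)
    · rfl
  · rw [of_val, hf σ hσ, hg σ hσ, ite_self]

theorem Cochain.EqOn.pullback {A : Set X} {B : Set Y} {f g : Cochain Y} (h : EqOn B f g)
    (φ : C(X, Y)) (hφ : ∀ x ∈ A, φ x ∈ B) : EqOn A (pullback φ f) (pullback φ g) := by
  rintro ⟨n, σ⟩ hσ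
  refine h _ ?_
  rintro _ ⟨t, rfl⟩
  exact hφ _ (hσ ⟨t, rfl⟩)

theorem Cochain.EqOn.refl {A : Set X} (f : Cochain X) : EqOn A f f := fun _ _ => rfl

theorem Cochain.EqOn.vanOn_sub {A : Set X} {f g : Cochain X} (h : EqOn A f g) : VanOn A (f - g) :=
  fun σ hσ => by rw [sub_val, h σ hσ, sub_self]

variable {p : C(T, B)} {T₀ : Set T} {u : Cochain T} {k : Cochain B} {h : Cochain T}

/-- Mayer–Vietoris for the mapping cone. Over `U ∩ W` the two bounds differ by a cone cocycle, hence
by the boundary of some `(a, b)`; changing the second bound accordingly makes the two glue. Errors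
on simplices that lie over neither set are removed by `exists_correction`. The result agrees with
the first bound over `U` on the nose, not just up to boundaries, and this is what allows unions
along chains. -/
theorem ConeBounds.union (hu : u.d = 0) (hui : u.inv = u) (huT : VanOn T₀ u)
    (hk : k.d = 0) (hhT : VanOn T₀ h) (hh : h.d = u * pullback p k)
    {U W : Set B} {k₁ k₂ : Cochain B} {h₁ h₂ : Cochain T} (h1 : ConeBounds p T₀ u k h U k₁ h₁)
    (h2 : ConeBounds p T₀ u k h W k₂ h₂) (hac : ConeAcyclic p T₀ u (U ∩ W)) :
    ∃ k' h', ConeBounds p T₀ u k h (U ∪ W) k' h' ∧ EqOn U k' k₁ ∧ EqOn (p ⁻¹' U) h' h₁ := by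
  have hdu : ∀ y : Cochain B, (u * pullback p y).d = u * pullback p y.d := fun y => by
    rw [d_mul, hu, zero_mul, zero_add, hui, d_pullback]
  obtain ⟨a, b, hb, hab, hab'⟩ := hac (k₁ - k₂) (h₁ - h₂) (h1.vanOn.sub h2.vanOn)
    (by
      rw [d_sub]
      exact ((h1.base.mono Set.inter_subset_left).trans
        (h2.base.mono Set.inter_subset_right).symm).vanOn_sub)
    (by
      have e1 := (h1.total.mono (Set.preimage_mono (f := p) (Set.inter_subset_left (t := W)))).trans
        (h2.total.mono (Set.preimage_mono (f := p) (Set.inter_subset_right (s := U)))).symm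
      intro σ hσ
      have := e1 σ hσ
      rw [d_sub, pullback_sub, mul_sub]
      simp only [sub_val] at this ⊢
      linarith)
  obtain ⟨k₃, hk1, hk2, -⟩ := exists_glue (U := U) (V := W) (f := k₁) (g := k₂ + a.d)
    (fun σ hσ => by
      have := hab σ hσ
      rw [sub_val] at this
      rw [add_val, this]
      ring)
  obtain ⟨h₃, hh1, hh2, hh3⟩ := exists_glue (U := p ⁻¹' U) (V := p ⁻¹' W) (f := h₁)
    (g := h₂ + (u * pullback p a - b.d))
    (fun σ hσ => by
      have := hab' σ hσ
      rw [sub_val h₁] at this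
      rw [add_val, this]
      ring)
  have hT3 : VanOn T₀ h₃ := hh3 _ h1.vanOn (h2.vanOn.add ((huT.mul_right _).sub hb.d))
  have hU : VanOn U (k - k₃.d) := (hk1.d.trans h1.base).symm.vanOn_sub
  have hW : VanOn W (k - k₃.d) := by
    refine (hk2.d.trans ?_).symm.vanOn_sub
    rw [d_add, d_d, add_zero]
    exact h2.base
  obtain ⟨c, hc, hc'⟩ := exists_correction h1.isOpen h2.isOpen hU hW
    (by rw [d_sub, hk, d_d, sub_zero]; exact vanOn_zero)
  have hcU : EqOn U (k₃ + c) k₃ := fun σ hσ => by rw [add_val, hc' _ hU σ hσ, add_zero]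
  have hcW : EqOn W (k₃ + c) k₃ := fun σ hσ => by rw [add_val, hc' _ hW σ hσ, add_zero]
  have hb' : EqOn (U ∪ W) (k₃ + c).d k := fun σ hσ => by
    have := hc σ hσ
    simp only [sub_val, d_add, add_val] at this ⊢
    linarith
  have hU' : VanOn (p ⁻¹' U) (h - (u * pullback p (k₃ + c) - h₃.d)) := by
    refine EqOn.vanOn_sub (EqOn.symm (EqOn.trans (EqOn.sub (EqOn.mul (EqOn.refl u)
      ((hcU.trans hk1).pullback p fun x hx => hx)) hh1.d) h1.total))
  have hW' : VanOn (p ⁻¹' W) (h - (u * pullback p (k₃ + c) - h₃.d)) := by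
    refine EqOn.vanOn_sub (EqOn.symm (EqOn.trans (EqOn.sub (EqOn.mul (EqOn.refl u)
      ((hcW.trans hk2).pullback p fun x hx => hx)) hh2.d) ?_))
    have : u * pullback p (k₂ + a.d) - (h₂ + (u * pullback p a - b.d)).d =
        u * pullback p k₂ - h₂.d := by
      rw [d_add, d_sub, d_d, hdu, pullback_add, mul_add]
      abel
    rw [this]
    exact h2.total
  obtain ⟨e, he, he'⟩ := exists_correction (h1.isOpen.preimage p.continuous)
    (h2.isOpen.preimage p.continuous) hU' hW' (by
      rw [d_sub, d_sub, d_d, sub_zero, hh, hdu, ← mul_sub, ← pullback_sub]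
      exact (VanOn.pullback hb'.symm.vanOn_sub p fun x hx => hx).mul_left u)
  refine ⟨k₃ + c, h₃ - e, ⟨h1.isOpen.union h2.isOpen, ?_, hb', ?_⟩, hcU.trans hk1, ?_⟩
  · exact hT3.sub (he' _ (hhT.sub ((huT.mul_right _).sub hT3.d)))
  · intro σ hσ
    have := he σ hσ
    simp only [sub_val, d_sub] at this ⊢
    linarith
  · intro σ hσ
    rw [sub_val, he' _ hU' σ hσ, sub_zero, hh1 σ hσ]

/-- The image of a simplex is compact. Hence conditions on cochains over a directed union of open
sets may be checked on its members. -/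
theorem exists_range_subset_of_directed {α : Type*} [Nonempty α] (U : α → Set X)
    (hU : ∀ a, IsOpen (U a)) (hd : Directed (· ⊆ ·) U) (σ : Sing X)
    (h : Set.range σ.2 ⊆ ⋃ a, U a) : ∃ a, Set.range σ.2 ⊆ U a :=
  (isCompact_range σ.2.continuous).elim_directed_cover U hU h hd

theorem Cochain.exists_glue_chain {α : Type*} (U : α → Set X) (f : α → Cochain X) (hf : ∀ a b, EqOn (U a ∩ U b) (f a) (f b)) :
    ∃ k : Cochain X, (∀ a, EqOn (U a) k (f a)) ∧ ∀ C, (∀ a, VanOn C (f a)) → VanOn C k := by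
  classical
  refine ⟨of fun σ => if h : ∃ a, Set.range σ.2 ⊆ U a then f h.choose σ else 0,
    fun a σ hσ => ?_, fun C hC σ hσ => ?_⟩
  · have h : ∃ a, Set.range σ.2 ⊆ U a := ⟨a, hσ⟩
    rw [of_val, dif_pos h]
    exact hf _ _ σ (Set.subset_inter h.choose_spec hσ)
  · rw [of_val]
    split_ifs with h
    · exact hC _ σ hσ
    · rfl

/-- Zorn's lemma for bounds over open subsets of the base, ordered by strict extension. Chains have
upper bounds because every simplex of the union already lies in one member. If a point were missing
from a maximal domain, `ConeBounds.union` with a good neighbourhood of that point would enlarge it.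
No countability or paracompactness of the base enters. -/
theorem coneAcyclic_univ (hu : u.d = 0) (hui : u.inv = u) (huT : VanOn T₀ u)
    (hloc : ∀ b : B, ∃ W : Set B, IsOpen W ∧ b ∈ W ∧ ∀ W' : Set B, IsOpen W' → W' ⊆ W →
      ConeAcyclic p T₀ u W')
    (hk : k.d = 0) (hhT : VanOn T₀ h) (hh : h.d = u * pullback p k) :
    ∃ (k' : Cochain B) (h' : Cochain T), VanOn T₀ h' ∧ k'.d = k ∧
      u * pullback p k' - h'.d = h := by
  let α := {x : Set B × Cochain B × Cochain T // ConeBounds p T₀ u k h x.1 x.2.1 x.2.2}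
  let R : α → α → Prop := fun x y => x.1.1 ⊆ y.1.1 ∧ EqOn x.1.1 y.1.2.1 x.1.2.1 ∧
    EqOn (p ⁻¹' x.1.1) y.1.2.2 x.1.2.2
  obtain ⟨⟨⟨U, k', h'⟩, hm⟩, hmax⟩ : ∃ m : α, ∀ a, R m a → R a m := by
    refine exists_maximal_of_chains_bounded ?_ ?_
    · intro c hc
      rcases c.eq_empty_or_nonempty with rfl | hne
      · refine ⟨⟨⟨∅, 0, 0⟩, isOpen_empty, vanOn_zero, ?_, ?_⟩, by simp⟩
        · intro σ hσ
          exact ((Set.range_nonempty σ.2).ne_empty (Set.subset_empty_iff.1 hσ)).elim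
        · intro σ hσ
          exact ((Set.range_nonempty σ.2).ne_empty (Set.subset_empty_iff.1 hσ)).elim
      have : Nonempty c := hne.to_subtype
      have htot : ∀ a b : c, R a b ∨ R b a := by
        intro a b
        by_cases hab : (a : α) = b
        · left
          rw [hab]
          exact ⟨subset_rfl, EqOn.refl _, EqOn.refl _⟩
        · exact hc a.2 b.2 hab
      have hdir : Directed (· ⊆ ·) fun a : c => a.1.1.1 := fun a b => by
        rcases htot a b with h | h
        · exact ⟨b, h.1, subset_rfl⟩
        · exact ⟨a, subset_rfl, h.1⟩
      have hdir' : Directed (· ⊆ ·) fun a : c => p ⁻¹' a.1.1.1 := fun a b => by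
        obtain ⟨e, h1, h2⟩ := hdir a b
        exact ⟨e, Set.preimage_mono h1, Set.preimage_mono h2⟩
      obtain ⟨K, hK, -⟩ := exists_glue_chain (fun a : c => a.1.1.1)
        (fun a => a.1.1.2.1) (fun a b => by
          rcases htot a b with h | h
          · exact (h.2.1.mono Set.inter_subset_left).symm
          · exact h.2.1.mono Set.inter_subset_right)
      obtain ⟨H, hH, hH'⟩ := exists_glue_chain (fun a : c => p ⁻¹' a.1.1.1)
        (fun a => a.1.1.2.2) (fun a b => by
          rcases htot a b with h | h
          · exact (h.2.2.mono Set.inter_subset_left).symm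
          · exact h.2.2.mono Set.inter_subset_right)
      refine ⟨⟨⟨⋃ a : c, a.1.1.1, K, H⟩, isOpen_iUnion fun a => a.1.2.isOpen,
        hH' _ fun a => a.1.2.vanOn, ?_, ?_⟩, ?_⟩
      · intro σ hσ
        obtain ⟨a, ha⟩ := exists_range_subset_of_directed _ (fun a : c => a.1.2.isOpen) hdir σ hσ
        exact ((hK a).d.trans a.1.2.base) σ ha
      · intro σ hσ
        obtain ⟨a, ha⟩ := exists_range_subset_of_directed _
          (fun a : c => a.1.2.isOpen.preimage p.continuous) hdir' σ
          (hσ.trans (Set.preimage_iUnion (f := p)).le)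
        exact ((EqOn.sub (EqOn.mul (EqOn.refl u) ((hK a).pullback p fun x hx => hx))
          (hH a).d).trans a.1.2.total) σ ha
      · intro a ha
        exact ⟨Set.subset_iUnion (fun a : c => a.1.1.1) ⟨a, ha⟩, hK ⟨a, ha⟩, hH ⟨a, ha⟩⟩
    · rintro a b e ⟨h1, h2, h3⟩ ⟨h1', h2', h3'⟩
      exact ⟨h1.trans h1', (h2'.mono h1).trans h2, (h3'.mono (Set.preimage_mono h1)).trans h3⟩
  have hU : U = Set.univ := by
    refine Set.eq_univ_of_forall fun b => ?_
    obtain ⟨W, hW, hbW, hac⟩ := hloc b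
    obtain ⟨k₂, h₂, h3, h4, h5⟩ := hac W hW subset_rfl k h hhT (by rw [hk]; exact vanOn_zero)
      (by rw [hh]; exact EqOn.refl _)
    obtain ⟨k₃, h₃, hb, e1, e2⟩ := hm.union hu hui huT hk hhT hh ⟨hW, h3, h4, h5⟩
      (hac _ (hm.isOpen.inter hW) Set.inter_subset_right)
    exact (hmax ⟨⟨U ∪ W, k₃, h₃⟩, hb⟩ ⟨Set.subset_union_left, e1, e2⟩).1 (Or.inr hbW)
  subst hU
  refine ⟨k', h', hm.vanOn, ext fun n σ => hm.base _ (Set.subset_univ _),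
    ext fun n σ => hm.total _ (Set.subset_univ _)⟩

/-- Acyclicity of the cone is the Thom isomorphism: cone cocycles `(y, g)` give injectivity and cone
cocycles `(0, f)` give surjectivity. -/
theorem isThomIso_of_locally (hu : u.d = 0) (hui : u.inv = u) (huT : VanOn T₀ u)
    (hloc : ∀ b : B, ∃ W : Set B, IsOpen W ∧ b ∈ W ∧ ∀ W' : Set B, IsOpen W' → W' ⊆ W →
      ConeAcyclic p T₀ u W') : IsThomIso p T₀ u where
  inj y hy g hg hgd := by
    obtain ⟨k', -, -, h2, -⟩ := coneAcyclic_univ hu hui huT hloc hy hg hgd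
    exact ⟨k', h2⟩
  surj f hf hfT := by
    obtain ⟨k', h', h1, h2, h3⟩ := coneAcyclic_univ (p := p) hu hui huT hloc (k := 0) (h := f)
      d_zero hfT (by rw [hf, pullback_zero, mul_zero])
    exact ⟨k', -h', h2, h1.neg, by rw [d_neg, ← sub_eq_add_neg, h3]⟩

/-- Restriction of the Thom isomorphism to a subset of the base. -/
theorem IsThomIso.coneAcyclic {T' B' : Type*} [TopologicalSpace T'] [TopologicalSpace B']
    {p' : C(T', B')} {T₀' : Set T'} {jT : C(T', T)} {jB : C(B', B)} (hu : u.d = 0)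
    (hui : u.inv = u) (huT : VanOn T₀ u)
    (hjT : Topology.IsEmbedding jT) (hjB : Topology.IsEmbedding jB) (hp : p.comp jT = jB.comp p')
    (hT : ∀ t, jT t ∈ T₀ ↔ t ∈ T₀') (hr : p ⁻¹' Set.range jB = Set.range jT)
    (hi : IsThomIso p' T₀' (pullback jT u)) : ConeAcyclic p T₀ u (Set.range jB) := by
  intro k h hhT hk hh
  have hpull : ∀ y : Cochain B, pullback jT (u * pullback p y) =
      pullback jT u * pullback p' (pullback jB y) := fun y => by
    rw [pullback_mul, ← pullback_comp, hp, pullback_comp]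
  have hk0 : (pullback jB k).d = 0 := by
    rw [d_pullback]
    exact pullback_eq_of_eqOn (g := 0) hk
  have hh0 : (pullback jT h).d = pullback jT u * pullback p' (pullback jB k) := by
    rw [d_pullback, ← hpull]
    exact pullback_eq_of_eqOn (hr ▸ hh)
  have hT' : VanOn T₀' (pullback jT h) := hhT.pullback _ fun t ht => (hT t).2 ht
  have hu0 : (pullback jT u).d = 0 := by rw [d_pullback, hu, pullback_zero]
  have huT' : VanOn T₀' (pullback jT u) := huT.pullback _ fun t ht => (hT t).2 ht
  -- Injectivity gives a primitive `k₁` of `k`. The failure of `u * k₁ = h` is then a relative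
  -- cocycle, which surjectivity writes as `u * y` plus the coboundary of `g`; so `(k₁ - y, g)` is
  -- the required bound.
  obtain ⟨k₁, hk₁⟩ := hi.inj _ hk0 _ hT' hh0
  obtain ⟨y, g, hy, hg, hyg⟩ := hi.surj (pullback jT u * pullback p' k₁ - pullback jT h)
    (by rw [d_sub, d_mul, hu0, zero_mul, zero_add, inv_pullback, hui, d_pullback, hk₁, hh0,
      sub_self]) ((huT'.mul_right _).sub hT')
  obtain ⟨k', hk', -⟩ := exists_extend jB hjB (k₁ - y)
  obtain ⟨h', hh', hh''⟩ := exists_extend jT hjT g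
  refine ⟨k', h', hh'' _ (hg.mono fun t ht => (hT t).1 ht), ?_, ?_⟩
  · refine eqOn_range_of_pullback_eq hjB ?_
    rw [← d_pullback, hk', d_sub, hk₁, hy, sub_zero]
  · rw [hr]
    refine eqOn_range_of_pullback_eq hjT ?_
    rw [pullback_sub, hpull, hk', ← d_pullback, hh', pullback_sub, mul_sub]
    rw [sub_eq_iff_eq_add] at hyg
    rw [hyg]
    abel

end LocalToGlobal

/-! ### The Thom isomorphism for vector bundles -/

open Cochain

theorem orientedSimp_apply (r : ℕ) (t : Dl (2 * r)) (a : Fin r) : orientedSimp r t a =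
    ((t ⟨2 * a + 1, by omega⟩ - t 0 : ℝ) : ℂ) +
      ((t ⟨2 * a + 2, by omega⟩ - t 0 : ℝ) : ℂ) * Complex.I := rfl

theorem orientedSimp_re (r : ℕ) (t : Dl (2 * r)) (a : Fin r) :
    (orientedSimp r t a).re = t ⟨2 * a + 1, by omega⟩ - t 0 := by
  simp [orientedSimp_apply]

theorem orientedSimp_im (r : ℕ) (t : Dl (2 * r)) (a : Fin r) :
    (orientedSimp r t a).im = t ⟨2 * a + 2, by omega⟩ - t 0 := by
  simp [orientedSimp_apply]

/-- At a zero of `orientedSimp r` all barycentric coordinates are equal; if one of them were zero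
they could not add up to 1. -/
theorem orientedSimp_ne_zero (r : ℕ) (t : Dl (2 * r)) (i : Fin (2 * r + 1)) (ht : t i = 0) :
    orientedSimp r t ≠ 0 := by
  intro h
  have key : ∀ j : Fin (2 * r + 1), t j = t 0 := by
    intro j
    obtain ⟨j, hj⟩ := j
    rcases Nat.eq_zero_or_pos j with rfl | hj0
    · rfl
    rcases Nat.even_or_odd' j with ⟨a, rfl | rfl⟩
    · have := orientedSimp_im r t ⟨a - 1, by omega⟩
      rw [h] at this
      have e : (⟨2 * (a - 1) + 2, by omega⟩ : Fin (2 * r + 1)) = ⟨2 * a, hj⟩ := by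
        ext; simp; omega
      simp only [e] at this
      simp at this
      linarith
    · have := orientedSimp_re r t ⟨a, by omega⟩
      rw [h] at this
      simp at this
      linarith
  have hs := t.2.2
  have hz : ∀ j : Fin (2 * r + 1), t.1 j = 0 := fun j =>
    (key j).trans ((key i).symm.trans ht)
  rw [Finset.sum_eq_zero fun j _ => hz j] at hs
  exact zero_ne_one hs

theorem pull_skip_apply_eq_zero {n : ℕ} (i : ℕ) (hi : i < n + 2) (s : Dl n) :
    stdSimplex.map (vtx n (n + 1) (skip i)) s ⟨i, hi⟩ = 0 := by
  rw [stdSimplex_map_apply]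
  refine Finset.sum_eq_zero fun j _ => if_neg ?_
  intro h
  have := congrArg Fin.val h
  simp only [vtx, skip] at this
  have := j.2
  split_ifs at * <;> omega

/-- The faces of the oriented simplex avoid the origin. Hence the value of a relative cocycle on a
fibre depends only on its relative class. -/
theorem d_orientedSimp_eq_zero {A : Set X} {r : ℕ} (φ : C(Fin r → ℂ, X))
    (hφ : ∀ z, z ≠ 0 → φ z ∈ A) {g : Cochain X} (hg : VanOn A g) :
    g.d ⟨2 * r, φ.comp (orientedSimp r)⟩ = 0 := by
  have gen : ∀ n (σ : Simp n X), (∀ (t : Dl n) (i), t i = 0 → σ t ∈ A) → g.d ⟨n, σ⟩ = 0 := by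
    intro n σ hσ
    cases n with
    | zero => exact d_zero_dim _ _
    | succ n =>
      rw [d_succ]
      refine Finset.sum_eq_zero fun i hi => ?_
      rw [hg, mul_zero]
      rintro _ ⟨s, rfl⟩
      exact hσ _ _ (pull_skip_apply_eq_zero i (Finset.mem_range.1 hi) s)
  exact gen _ _ fun t i ht => hφ _ (orientedSimp_ne_zero r t i ht)

/-- `p : T → B` is a complex vector bundle of rank `r`, with complement of the zero section `T₀`, whose
local trivialisations are given by the elements of `frames`. -/
def LocTriv {T B : Type*} [TopologicalSpace T] [TopologicalSpace B] (r : ℕ) (p : C(T, B))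
    (T₀ : Set T) (frames : Set C(Fin r → ℂ, T)) : Prop :=
  ∀ b : B, ∃ W : Set B, IsOpen W ∧ b ∈ W ∧ ∃ (Θ : B × (Fin r → ℂ) → T) (ζ : T → Fin r → ℂ),
    ContinuousOn Θ (W ×ˢ Set.univ) ∧ ContinuousOn ζ (p ⁻¹' W) ∧
    (∀ w ∈ W, ∀ z, p (Θ (w, z)) = w ∧ ζ (Θ (w, z)) = z ∧ (Θ (w, z) ∈ T₀ ↔ z ≠ 0)) ∧
    (∀ t, p t ∈ W → Θ (p t, ζ t) = t) ∧ ∀ w ∈ W, ∃ φ ∈ frames, ∀ z, φ z = Θ (w, z)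

/-- `u` is a relative cocycle of degree `2 * r` representing the Thom class. -/
structure IsThomCocycle {T : Type*} [TopologicalSpace T] (r : ℕ) (T₀ : Set T)
    (frames : Set C(Fin r → ℂ, T)) (u : Cochain T) : Prop where
  supp : Supp (2 * r) u
  d_eq : u.d = 0
  vanOn : VanOn T₀ u
  value : ∀ φ ∈ frames, u ⟨2 * r, φ.comp (orientedSimp r)⟩ = 1

/-! ### Relative classes in the degree of the Thom class -/

section Bundle

variable {T B : Type*} [TopologicalSpace T] [TopologicalSpace B] {r : ℕ} {p : C(T, B)}
  {T₀ : Set T} {frames : Set C(Fin r → ℂ, T)} {u : Cochain T}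

theorem IsThomCocycle.inv_eq (h : IsThomCocycle r T₀ frames u) : u.inv = u :=
  h.supp.inv_eq (even_two_mul r)

/-- A relative cocycle of the same degree as `u` is a locally constant multiple of `u`. -/
theorem IsThomIso.exists_eq_mul {n : ℕ} (hi : IsThomIso p T₀ u) (hu : Supp n u) {f : Cochain T}
    (hf : f.d = 0) (hfT : VanOn T₀ f) (hfn : Supp n f) :
    ∃ (a : Cochain B) (g : Cochain T), a.d = 0 ∧ Supp 0 a ∧ VanOn T₀ g ∧
      f = u * pullback p a + g.d := by
  obtain ⟨y, g, hy, hg, h⟩ := hi.surj f hf hfT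
  have hy0 : (comp 0 y).d = 0 := by
    rw [← comp_succ_d, hy]
    exact ext fun _ _ => ite_self _
  have h' := congrArg (comp n) h
  have e : comp n (u * pullback p y) = u * pullback p (comp 0 y) := comp_mul_of_supp hu 0 _
  rw [hfn.comp_eq, comp_add, e] at h'
  -- In degree zero the coboundary has no component, so nothing is left to correct.
  cases n with
  | zero =>
    refine ⟨comp 0 y, 0, hy0, supp_comp _ _, vanOn_zero, ?_⟩
    rw [h', comp_zero_d, d_zero]
  | succ n =>
    exact ⟨comp 0 y, comp n g, hy0, supp_comp _ _, hg.comp _, by rw [h', comp_succ_d]⟩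

theorem mul_supp_zero_val {n : ℕ} (f a : Cochain X) (ha : Supp 0 a) (σ : Simp n X) :
    (f * a) ⟨n, σ⟩ = f ⟨n, σ⟩ * a ⟨0, σ.pull 0 (n + ·)⟩ := by
  rw [mul_val, Finset.sum_eq_single (n, 0)]
  · rw [Simp.pull_id σ (a := id) (fun i _ => rfl)]
  · rintro ⟨x, y⟩ h h'
    have hy : y ≠ 0 := by
      rintro rfl
      simp at h h'
      exact h' h
    rw [ha _ hy, mul_zero]
  · simp

theorem pullback_val_const {n : ℕ} (p : C(X, Y)) (σ : Simp n X) (b : Y) (h : ∀ t, p (σ t) = b)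
    (m : ℕ) (s : ℕ → ℕ) (a : Cochain Y) :
    pullback p a ⟨m, σ.pull m s⟩ = a ⟨m, ContinuousMap.const _ b⟩ := by
  rw [pullback_apply]
  congr 2
  ext t
  exact h _

theorem simp_zero_eq_const (σ : Simp 0 X) : σ = ContinuousMap.const _ (σ (vert 0 0)) := by
  ext t
  exact congrArg σ (Subsingleton.elim _ _)

theorem Cochain.ext_of_supp_zero {a b : Cochain X} (ha : Supp 0 a) (hb : Supp 0 b)
    (h : ∀ x : X, a ⟨0, ContinuousMap.const _ x⟩ = b ⟨0, ContinuousMap.const _ x⟩) : a = b := by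
  refine ext fun n σ => ?_
  cases n with
  | zero => rw [simp_zero_eq_const σ]; exact h _
  | succ n => rw [ha _ (Nat.succ_ne_zero n), hb _ (Nat.succ_ne_zero n)]

/-- `a` is its own inverse, so division by `u` is division by `κ` followed by multiplication by `a`.
The term `g.d` only changes primitives, by `g * pullback p y`. -/
theorem IsThomIso.of_mul_unit {κ : Cochain T} (hi : IsThomIso p T₀ κ) {a : Cochain B}
    (ha : a.d = 0) (ha0 : Supp 0 a) (haa : a * a = 1) {g : Cochain T} (hg : VanOn T₀ g)
    (hu : u = κ * pullback p a + g.d) : IsThomIso p T₀ u where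
  inj y hy f hf hfd := by
    have hai : a.inv = a := ha0.inv_eq Even.zero
    obtain ⟨k, hk⟩ := hi.inj (a * y) (by rw [d_mul, ha, hy, zero_mul, mul_zero, add_zero])
      (f - g * pullback p y) (hf.sub (hg.mul_right _)) (by
        rw [d_sub, hfd, d_mul, d_pullback, hy, pullback_zero, mul_zero, add_zero, hu, add_mul,
          pullback_mul, mul_assoc]
        abel)
    refine ⟨a * k, ?_⟩
    rw [d_mul, ha, zero_mul, zero_add, hai, hk, ← mul_assoc, haa, one_mul]
  surj f hf hfT := by
    obtain ⟨y, m, hy, hm, h⟩ := hi.surj f hf hfT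
    have hay : (a * y).d = 0 := by rw [d_mul, ha, hy, zero_mul, mul_zero, add_zero]
    refine ⟨a * y, m - g * pullback p (a * y), hay, hm.sub (hg.mul_right _), ?_⟩
    rw [d_sub, d_mul, d_pullback, hay, pullback_zero, mul_zero, add_zero, h, hu, add_mul,
      mul_assoc, ← pullback_mul, ← mul_assoc a, haa, one_mul]
    abel

/-- The Thom isomorphism for a trivial bundle. -/
theorem isThomIso_prod {W : Type*} [TopologicalSpace W] {u : Cochain (W × (Fin r → ℂ))}
    (hu : Supp (2 * r) u) (hud : u.d = 0) (huT : VanOn {q | q.2 ≠ 0} u)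
    (h1 : ∀ w : W, u ⟨2 * r, ((ContinuousMap.const _ w).prodMk (ContinuousMap.id _)).comp
      (orientedSimp r)⟩ = 1) :
    IsThomIso (ContinuousMap.fst : C(W × (Fin r → ℂ), W)) {q | q.2 ≠ 0} u := by
  obtain ⟨κ, hκ, hκd, hκT, hi⟩ := hasThomCocycle_prod W r
  obtain ⟨a, g, ha, ha0, hg, h⟩ := hi.exists_eq_mul hκ hud huT hu
  refine hi.of_mul_unit ha ha0 ?_ hg h
  refine ext_of_supp_zero (ha0.mul ha0) supp_one fun w => ?_
  have hw := h1 w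
  rw [h, add_val, d_orientedSimp_eq_zero _ (fun z hz => hz) hg, add_zero,
    mul_supp_zero_val _ _ (ha0.pullback _), pullback_val_const _ _ w (fun _ => rfl)] at hw
  -- On each fibre the value of `κ` times that of `a` is 1, so `a` is ±1 at every point. Its square
  -- is 1 whichever sign `κ` has.
  have ha2 := Int.eq_one_or_neg_one_of_mul_eq_one (u := a ⟨0, ContinuousMap.const _ w⟩)
    ((mul_comm _ _).trans hw)
  rw [mul_supp_zero_val _ _ ha0, one_val, if_pos rfl]
  have e : Simp.pull (ContinuousMap.const (Dl 0) w) 0 (0 + ·) = ContinuousMap.const _ w := rfl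
  rw [e]
  rcases ha2 with h | h <;> rw [h] <;> rfl

theorem LocTriv.coneAcyclic (hp : LocTriv r p T₀ frames) (hu : IsThomCocycle r T₀ frames u)
    (b : B) : ∃ W : Set B, IsOpen W ∧ b ∈ W ∧ ∀ W' : Set B, IsOpen W' → W' ⊆ W →
      ConeAcyclic p T₀ u W' := by
  obtain ⟨W, hW, hb, Θ, ζ, hΘ, hζ, h1, h2, h3⟩ := hp b
  refine ⟨W, hW, hb, fun W' _ hWW => ?_⟩
  have hmem : ∀ q : W' × (Fin r → ℂ), Θ (q.1, q.2) ∈ p ⁻¹' W' := fun q => by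
    rw [Set.mem_preimage, (h1 _ (hWW q.1.2) _).1]; exact q.1.2
  let e : W' × (Fin r → ℂ) ≃ₜ p ⁻¹' W' :=
    { toFun := fun q => ⟨Θ (q.1, q.2), hmem q⟩
      invFun := fun t => (⟨p t, t.2⟩, ζ t)
      left_inv := fun q => Prod.ext (Subtype.ext (h1 _ (hWW q.1.2) _).1) (h1 _ (hWW q.1.2) _).2.1
      right_inv := fun t => Subtype.ext (h2 _ (hWW t.2))
      continuous_toFun := Continuous.subtype_mk (hΘ.comp_continuous
        (by fun_prop : Continuous fun q : W' × (Fin r → ℂ) => ((q.1 : B), q.2))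
        fun q => ⟨hWW q.1.2, trivial⟩) hmem
      continuous_invFun := by
        refine Continuous.prodMk (Continuous.subtype_mk (by fun_prop) _) ?_
        exact hζ.comp_continuous continuous_subtype_val fun t => hWW t.2 }
  let jT : C(W' × (Fin r → ℂ), T) := ⟨fun q => e q, by fun_prop⟩
  let jB : C(W', B) := ⟨Subtype.val, continuous_subtype_val⟩
  have hjB : Set.range jB = W' := Subtype.range_coe
  have := IsThomIso.coneAcyclic (p := p) (T₀ := T₀) (u := u) (jT := jT) (jB := jB)
    (p' := ContinuousMap.fst) (T₀' := {q | q.2 ≠ 0}) hu.d_eq hu.inv_eq hu.vanOn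
    (Topology.IsEmbedding.subtypeVal.comp e.isEmbedding) Topology.IsEmbedding.subtypeVal
    (ContinuousMap.ext fun q => (h1 _ (hWW q.1.2) _).1) (fun q => (h1 _ (hWW q.1.2) _).2.2)
    (by
      rw [hjB]
      ext t
      exact ⟨fun ht => ⟨e.symm ⟨t, ht⟩, congrArg Subtype.val (e.apply_symm_apply ⟨t, ht⟩)⟩,
        by rintro ⟨q, rfl⟩; exact (e q).2⟩)
    (isThomIso_prod (hu.supp.pullback _) (by rw [d_pullback, hu.d_eq, pullback_zero])
      (hu.vanOn.pullback _ fun q hq => (h1 _ (hWW q.1.2) _).2.2.2 hq) fun w => by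
        obtain ⟨φ, hφ, hφz⟩ := h3 w (hWW w.2)
        rw [pullback_apply, ← hu.value φ hφ, ← ContinuousMap.comp_assoc]
        congr 3
        ext z
        exact (hφz z).symm)
  rwa [hjB] at this

/-- The Thom isomorphism theorem. -/
theorem LocTriv.isThomIso (hp : LocTriv r p T₀ frames) (hu : IsThomCocycle r T₀ frames u) :
    IsThomIso p T₀ u :=
  isThomIso_of_locally hu.d_eq hu.inv_eq hu.vanOn (hp.coneAcyclic hu)

/-- A relative cocycle of degree `2 * r` is the product of the Thom class with its values on the
fibres. -/
theorem LocTriv.exists_eq_mul (hp : LocTriv r p T₀ frames) (hu : IsThomCocycle r T₀ frames u)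
    {f : Cochain T} (hf : f.d = 0) (hfT : VanOn T₀ f) (hfn : Supp (2 * r) f) :
    ∃ (a : Cochain B) (g : Cochain T), a.d = 0 ∧ Supp 0 a ∧ VanOn T₀ g ∧
      f = u * pullback p a + g.d ∧ ∀ b : B, ∃ φ ∈ frames, (∀ z, p (φ z) = b) ∧
        (∀ z, z ≠ 0 → φ z ∈ T₀) ∧
        f ⟨2 * r, φ.comp (orientedSimp r)⟩ = a ⟨0, ContinuousMap.const _ b⟩ := by
  obtain ⟨a, g, ha, ha0, hg, h⟩ := (hp.isThomIso hu).exists_eq_mul hu.supp hf hfT hfn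
  refine ⟨a, g, ha, ha0, hg, h, fun b => ?_⟩
  obtain ⟨W, hW, hb, Θ, ζ, hΘ, hζ, h1, h2, h3⟩ := hp b
  obtain ⟨φ, hφ, hφz⟩ := h3 b hb
  have hpb : ∀ z, p (φ z) = b := fun z => by rw [hφz, (h1 b hb z).1]
  have hT : ∀ z, z ≠ 0 → φ z ∈ T₀ := fun z hz => by rw [hφz]; exact (h1 b hb z).2.2.2 hz
  refine ⟨φ, hφ, hpb, hT, ?_⟩
  rw [h, add_val, d_orientedSimp_eq_zero φ hT hg, add_zero,
    mul_supp_zero_val _ _ (ha0.pullback _), hu.value φ hφ,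
    pullback_val_const _ _ b (fun t => hpb _), one_mul]

/-- Uniqueness of the Thom class. -/
theorem LocTriv.unique (hp : LocTriv r p T₀ frames) {v : Cochain T}
    (hu : IsThomCocycle r T₀ frames u) (hv : IsThomCocycle r T₀ frames v) :
    ∃ g, VanOn T₀ g ∧ v = u + g.d := by
  obtain ⟨a, g, ha, ha0, hg, h, hval⟩ := hp.exists_eq_mul hu hv.d_eq hv.vanOn hv.supp
  refine ⟨g, hg, ?_⟩
  have : a = 1 := ext_of_supp_zero ha0 supp_one fun b => by
    obtain ⟨φ, hφ, -, -, h'⟩ := hval b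
    rw [← h', hv.value φ hφ]
    rfl
  rw [h, this, pullback_one, mul_one]

theorem IsThomCocycle.pullback {T' : Type*} [TopologicalSpace T'] {T₀' : Set T'}
    {frames' : Set C(Fin r → ℂ, T')} (hu : IsThomCocycle r T₀ frames u) (φ : C(T', T))
    (h0 : ∀ t ∈ T₀', φ t ∈ T₀) (hf : ∀ ψ ∈ frames', φ.comp ψ ∈ frames) :
    IsThomCocycle r T₀' frames' (pullback φ u) where
  supp := hu.supp.pullback _
  d_eq := by rw [d_pullback, hu.d_eq, pullback_zero]
  vanOn := hu.vanOn.pullback _ h0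
  value ψ hψ := hu.value _ (hf ψ hψ)

theorem IsThomClass.exists_cocycle {u : RelCoh T₀} (hu : IsThomClass r T₀ frames u) :
    ∃ (f : relCocycles T₀), QuotientAddGroup.mk f = u ∧ IsThomCocycle r T₀ frames (f : Cochain T) := by
  obtain ⟨⟨f, hf, hs⟩, hv⟩ := hu
  exact ⟨f, hf, hs, f.2.2, f.2.1, fun φ hφ => hv f hf φ hφ⟩

end Bundle

/-! ### Lattice paths -/

/-- `l` is the list of vertices of a lattice path from `(0, 0)` to `(p, q)`. -/
structure IsPath (p q : ℕ) (l : List (ℕ × ℕ)) : Prop where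
  length_eq : l.length = p + q + 1
  zero_eq : l.getD 0 (0, 0) = (0, 0)
  step : ∀ i < p + q, l.getD (i + 1) (0, 0) = ((l.getD i (0, 0)).1 + 1, (l.getD i (0, 0)).2) ∨
    l.getD (i + 1) (0, 0) = ((l.getD i (0, 0)).1, (l.getD i (0, 0)).2 + 1)
  bound : ∀ v ∈ l, v.1 ≤ p ∧ v.2 ≤ q

theorem getD_map_of_lt {α β : Type*} (f : α → β) (l : List α) {i : ℕ} (hi : i < l.length) (a : α)
    (b : β) : (l.map f).getD i b = f (l.getD i a) := by
  rw [List.getD_eq_getElem _ _ (by simpa using hi), List.getD_eq_getElem _ _ hi, List.getElem_map]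

theorem IsPath.cons_fst {p q : ℕ} {l : List (ℕ × ℕ)} (h : IsPath p q l) :
    IsPath (p + 1) q ((0, 0) :: l.map (Prod.map Nat.succ id)) where
  length_eq := by simp [h.length_eq]; omega
  zero_eq := rfl
  step i hi := by
    have hl := h.length_eq
    rw [List.getD_cons_succ, getD_map_of_lt _ _ (by omega) (0, 0)]
    cases i with
    | zero => rw [h.zero_eq]; left; rfl
    | succ i =>
      rw [List.getD_cons_succ, getD_map_of_lt _ _ (by omega) (0, 0)]
      rcases h.step i (by omega) with e | e <;> rw [e]
      · left; rfl
      · right; rfl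
  bound v hv := by
    rcases List.mem_cons.1 hv with rfl | hv
    · simp
    · obtain ⟨w, hw, rfl⟩ := List.mem_map.1 hv
      have := h.bound w hw
      simp; omega

theorem IsPath.cons_snd {p q : ℕ} {l : List (ℕ × ℕ)} (h : IsPath p q l) :
    IsPath p (q + 1) ((0, 0) :: l.map (Prod.map id Nat.succ)) where
  length_eq := by simp [h.length_eq]; omega
  zero_eq := rfl
  step i hi := by
    have hl := h.length_eq
    rw [List.getD_cons_succ, getD_map_of_lt _ _ (by omega) (0, 0)]
    cases i with
    | zero => rw [h.zero_eq]; right; rfl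
    | succ i =>
      rw [List.getD_cons_succ, getD_map_of_lt _ _ (by omega) (0, 0)]
      rcases h.step i (by omega) with e | e <;> rw [e]
      · left; rfl
      · right; rfl
  bound v hv := by
    rcases List.mem_cons.1 hv with rfl | hv
    · simp
    · obtain ⟨w, hw, rfl⟩ := List.mem_map.1 hv
      have := h.bound w hw
      simp; omega

theorem isPath_singleton : IsPath 0 0 [(0, 0)] := ⟨rfl, rfl, by simp, by simp⟩

theorem pathSum_congr_of_isPath (p q : ℕ) (F G : List (ℕ × ℕ) → ℤ)
    (h : ∀ l, IsPath p q l → F l = G l) : pathSum p q F = pathSum p q G := by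
  induction p, q, F using pathSum.induct generalizing G with
  | case1 F => rw [pathSum, pathSum]; exact h _ isPath_singleton
  | case2 p F ih =>
    rw [pathSum, pathSum]
    exact ih _ fun l hl => h _ hl.cons_fst
  | case3 q F ih =>
    rw [pathSum, pathSum]
    exact ih _ fun l hl => h _ hl.cons_snd
  | case4 p q F ih1 ih2 =>
    rw [pathSum, pathSum, ih1 _ fun l hl => h _ hl.cons_fst, ih2 _ fun l hl => h _ hl.cons_snd]

/-- If `F` vanishes on the paths that do not pass through the corner `(p, 0)`, then only
the path along the corner contributes. -/
theorem pathSum_eq_cornerPath (p q : ℕ) (F : List (ℕ × ℕ) → ℤ)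
    (h : ∀ l, IsPath p q l → (p, 0) ∉ l → F l = 0) : pathSum p q F = F (cornerPath p q) := by
  induction p, q, F using pathSum.induct with
  | case1 F => rw [pathSum, cornerPath]
  | case2 p F ih =>
    rw [pathSum, cornerPath, ih]
    intro l hl hn
    refine h _ hl.cons_fst ?_
    simpa using hn
  | case3 q F ih =>
    rw [pathSum, cornerPath, ih]
    intro l hl hn
    -- For `p = 0` the corner is the starting point, which lies on every path.
    exfalso
    refine hn ?_
    have h0 := hl.zero_eq
    rw [List.getD_eq_getElem _ _ (by rw [hl.length_eq]; omega)] at h0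
    rw [← h0]
    exact List.getElem_mem _
  | case4 p q F ih1 ih2 =>
    rw [pathSum, cornerPath, ih1]
    -- A path that starts with an upward step never meets the corner, so this half of the sum is
    -- zero; `0 * 0` is the shape that `pathSum_mul` accepts.
    · rw [pathSum_congr_of_isPath _ _ _ (fun _ => 0 * 0), pathSum_mul, zero_mul, mul_zero, add_zero]
      intro l hl
      rw [h _ hl.cons_snd, mul_zero]
      simp
    · intro l hl hn
      refine h _ hl.cons_fst ?_
      simpa using hn

theorem isPath_cornerPath (p q : ℕ) : IsPath p q (cornerPath p q) := by
  induction p, q using cornerPath.induct with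
  | case1 => rw [cornerPath]; exact isPath_singleton
  | case2 q ih => rw [cornerPath]; exact ih.cons_snd
  | case3 p q ih => rw [cornerPath]; exact ih.cons_fst

theorem cornerPath_getD (p q i : ℕ) (hi : i ≤ p + q) :
    (cornerPath p q).getD i (0, 0) = (min i p, i - p) := by
  induction p, q using cornerPath.induct generalizing i with
  | case1 =>
    obtain rfl : i = 0 := by omega
    simp [cornerPath]
  | case2 q ih =>
    rw [cornerPath]
    cases i with
    | zero => rfl
    | succ i =>
      rw [List.getD_cons_succ, getD_map_of_lt _ _ (by rw [(isPath_cornerPath _ _).length_eq]; omega)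
        (0, 0), ih i (by omega)]
      simp
  | case3 p q ih =>
    rw [cornerPath]
    cases i with
    | zero => simp
    | succ i =>
      rw [List.getD_cons_succ, getD_map_of_lt _ _ (by rw [(isPath_cornerPath _ _).length_eq]; omega)
        (0, 0), ih i (by omega)]
      simp

theorem prodSimp_eq {p q n : ℕ} (σ : Simp p X) (τ : Simp q Y) {l : List (ℕ × ℕ)}
    (hl : l.length = n + 1) :
    prodSimp σ τ l = ⟨n, (σ.pull n fun i => (l.getD i (0, 0)).1).prodMk
      (τ.pull n fun i => (l.getD i (0, 0)).2)⟩ := by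
  obtain rfl : l.length - 1 = n := by omega
  rfl

/-! ### Normalised cochains -/

namespace Cochain

/-- `a` vanishes on degenerate simplices. -/
def Normalized (a : Cochain X) : Prop :=
  ∀ (n : ℕ) (σ : Simp n X) (m : ℕ) (b : ℕ → ℕ) (k : ℕ), k < m → b k = b (k + 1) →
    a ⟨m, σ.pull m b⟩ = 0

theorem normalized_one : Normalized (1 : Cochain X) := fun n σ m b k hk _ => by
  rw [one_val, if_neg (by change m ≠ 0; omega)]

theorem Normalized.mul {a b : Cochain X} (ha : Normalized a) (hb : Normalized b) :
    Normalized (a * b) := by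
  intro n σ m s k hk hs
  have key : ∀ ρ : Simp m X, ρ = σ.pull m s → (a * b) ⟨m, ρ⟩ = 0 := by
    rintro ρ rfl
    rw [mul_val]
    refine Finset.sum_eq_zero fun x hx => ?_
    have hx' : x.1 + x.2 = m := Finset.HasAntidiagonal.mem_antidiagonal.1 hx
    change a ⟨x.1, (σ.pull m s).pull x.1 id⟩ * b ⟨x.2, (σ.pull m s).pull x.2 (x.1 + ·)⟩ = 0
    rw [Simp.pull_pull _ _ _ (by intro i hi; simp; omega),
      Simp.pull_pull _ _ _ (by intro i hi; omega)]
    by_cases h : k < x.1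
    · rw [ha n σ x.1 _ k h (by simpa using hs), zero_mul]
    · rw [hb n σ x.2 _ (k - x.1) (by omega), mul_zero]
      simp only [Function.comp]
      rw [show x.1 + (k - x.1) = k by omega, show x.1 + (k - x.1 + 1) = k + 1 by omega, hs]
  exact key _ rfl

theorem Normalized.pow {a : Cochain X} (ha : Normalized a) (k : ℕ) : Normalized (a ^ k) := by
  induction k with
  | zero => rw [pow_zero]; exact normalized_one
  | succ k ih => rw [pow_succ]; exact ih.mul ha

theorem Supp.pow {n : ℕ} {a : Cochain X} (ha : Supp n a) (k : ℕ) : Supp (n * k) (a ^ k) := by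
  induction k with
  | zero => rw [pow_zero, Nat.mul_zero]; exact supp_one
  | succ k ih => rw [pow_succ]; exact ih.mul ha

theorem Supp.sub {n : ℕ} {a b : Cochain X} (ha : Supp n a) (hb : Supp n b) : Supp n (a - b) :=
  fun σ h => by rw [sub_val, ha σ h, hb σ h, sub_zero]

/-- A cocycle of degree two is cohomologous to a normalised one. -/
theorem exists_normalized {f : Cochain X} (hf : f.d = 0) (hs : Supp 2 f) :
    ∃ g : Cochain X, Normalized (f - g.d) ∧ Supp 1 g ∧ ∀ A, VanOn A f → VanOn A g := by
  -- On an edge with first vertex x the value is f(x, x, x). For a degenerate triangle with middle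
  -- vertex y, the cocycle condition gives f the value f(y, y, y), and this is also the value of
  -- `g.d`.
  let g : Cochain X := of fun σ => if σ.1 = 1 then f ⟨2, σ.2.pull 2 fun _ => 0⟩ else 0
  have hg : Supp 1 g := fun σ h => if_neg h
  refine ⟨g, ?_, hg, fun A hA σ hσ => ?_⟩
  swap
  · change (if σ.1 = 1 then _ else 0) = 0
    rw [hA _ ((range_pull _ _).trans hσ), ite_self]
  intro n σ m b k hk hb
  by_cases hm : m = 2
  swap
  · rw [sub_val, hs _ hm, hg.d _ hm, sub_zero]
  subst hm
  let F : ℕ → ℕ → ℕ → ℤ := fun x y z => f ⟨2, σ.pull 2 fun i => [x, y, z].getD i 0⟩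
  have hF : ∀ x y z w, F y z w - F x z w + F x y w - F x y z = 0 := by
    intro x y z w
    have h := congrFun hf ⟨3, σ.pull 3 fun i => [x, y, z, w].getD i 0⟩
    rw [d_succ] at h
    simp only [Finset.sum_range_succ, Finset.sum_range_zero, zero_add] at h
    have e : ∀ i, i ≤ 3 → ∀ x' y' z', (∀ j ≤ 2, [x, y, z, w].getD (skip i j) 0 =
        [x', y', z'].getD j 0) → f ⟨2, Simp.pull (σ.pull 3 fun i => [x, y, z, w].getD i 0) 2
          (skip i)⟩ = F x' y' z' := by
      intro i hi x' y' z' hj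
      rw [Simp.pull_pull _ _ _ (by intro j hj; rw [skip]; split_ifs <;> omega)]
      refine congrArg (fun ρ => f ⟨2, ρ⟩) (Simp.pull_congr _ fun j hj' => ?_)
      rw [Function.comp, hj j hj']
    rw [e 0 (by omega) y z w (by intro j hj; interval_cases j <;> rfl),
      e 1 (by omega) x z w (by intro j hj; interval_cases j <;> rfl),
      e 2 (by omega) x y w (by intro j hj; interval_cases j <;> rfl),
      e 3 (by omega) x y z (by intro j hj; interval_cases j <;> rfl)] at h
    rw [zero_val] at h
    linear_combination h
  have hf2 : f ⟨2, σ.pull 2 b⟩ = F (b 0) (b 1) (b 2) := by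
    refine congrArg (fun ρ => f ⟨2, ρ⟩) (Simp.pull_congr _ fun j hj => ?_)
    interval_cases j <;> rfl
  have hg2 : g.d ⟨2, σ.pull 2 b⟩ = F (b 1) (b 1) (b 1) := by
    rw [d_succ]
    simp only [Finset.sum_range_succ, Finset.sum_range_zero, zero_add]
    have e : ∀ i, g ⟨1, Simp.pull (σ.pull 2 b) 1 (skip i)⟩ =
        F (b (skip i 0)) (b (skip i 0)) (b (skip i 0)) := by
      intro i
      change (if 1 = 1 then f ⟨2, Simp.pull (Simp.pull (σ.pull 2 b) 1 (skip i)) 2 fun _ => 0⟩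
        else 0) = _
      rw [if_pos rfl, Simp.pull_pull _ _ _ (by simp), Simp.pull_pull _ _ _ (by
        intro j _; simp only [Function.comp, skip]; split_ifs <;> omega)]
      refine congrArg (fun ρ => f ⟨2, ρ⟩) (Simp.pull_congr _ fun j hj => ?_)
      interval_cases j <;> rfl
    rw [e, e, e]
    simp [skip]
  rw [sub_val, hf2, hg2]
  have : k = 0 ∨ k = 1 := by omega
  rcases this with rfl | rfl
  · have := hF (b 1) (b 1) (b 1) (b 2)
    rw [hb]
    linarith
  · have := hF (b 0) (b 1) (b 1) (b 1)
    rw [← hb]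
    linarith

theorem mul_val_of_supp {p q : ℕ} {f g : Cochain X} (hf : Supp p f) (σ : Simp (p + q) X) :
    (f * g) ⟨p + q, σ⟩ = f ⟨p, σ.pull p id⟩ * g ⟨q, σ.pull q (p + ·)⟩ := by
  rw [mul_val, Finset.sum_eq_single (p, q)]
  · rintro ⟨x, y⟩ h h'
    have hx : x ≠ p := by
      rintro rfl
      simp only [Finset.HasAntidiagonal.mem_antidiagonal, Nat.add_left_cancel_iff] at h
      exact h' (by rw [h])
    rw [hf _ hx, zero_mul]
  · simp

end Cochain

/-! ### Slant products of cross products -/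

open Cochain

/-- Along a path, `a` sees only the first `p'` steps and `b` only the last `q'`. An upward step
among the first `p'` makes the simplex seen by `a` degenerate, so only the path along the corner
survives. The bound `q' ≤ q` forces `p ≤ p'` when the total degrees agree, so `b` need not be
normalised. -/
theorem slantSimp_cross {p' q' p q : ℕ} {a : Cochain X} {b : Cochain Y} (ha : Normalized a)
    (hap : Supp p' a) (hbq : Supp q' b) (hq : q' ≤ q) (σ : Simp p X) (τ : Simp q Y) :
    slantSimp (pullback ContinuousMap.fst a * pullback ContinuousMap.snd b) ⟨q, τ⟩ ⟨p, σ⟩ =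
      a ⟨p, σ⟩ * b ⟨q, τ⟩ := by
  change pathSum p q (fun l => (pullback ContinuousMap.fst a * pullback ContinuousMap.snd b : Cochain (X × Y))
    (prodSimp σ τ l)) = _
  by_cases hpq : p + q = p' + q'
  swap
  · rw [pathSum_congr_of_isPath _ _ _ (fun _ => 0 * 0), pathSum_mul, zero_mul]
    · by_cases h : p = p'
      · rw [hbq ⟨q, τ⟩ (by change q ≠ q'; omega), mul_zero]
      · rw [hap ⟨p, σ⟩ h, zero_mul]
    · intro l hl
      rw [prodSimp_eq σ τ hl.length_eq]
      exact ((hap.pullback _).mul (hbq.pullback _)) _ hpq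
  have hval : ∀ l, IsPath p q l → (pullback ContinuousMap.fst a *
      pullback ContinuousMap.snd b : Cochain (X × Y)) (prodSimp σ τ l) = a ⟨p', σ.pull p' fun i => (l.getD i (0, 0)).1⟩ *
        b ⟨q', τ.pull q' fun i => (l.getD (p' + i) (0, 0)).2⟩ := by
    intro l hl
    rw [prodSimp_eq σ τ (n := p' + q') (by rw [hl.length_eq, hpq]),
      mul_val_of_supp (hap.pullback _)]
    change a ⟨p', Simp.pull (σ.pull (p' + q') _) p' id⟩ *
      b ⟨q', Simp.pull (τ.pull (p' + q') _) q' (p' + ·)⟩ = _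
    rw [Simp.pull_pull _ _ _ (by intro i hi; simp; omega),
      Simp.pull_pull _ _ _ (by intro i hi; omega)]
    rfl
  rw [pathSum_eq_cornerPath, hval _ (isPath_cornerPath p q)]
  · by_cases h : p = p'
    · subst h
      obtain rfl : q = q' := by omega
      rw [Simp.pull_id, Simp.pull_id]
      · intro i hi
        rw [cornerPath_getD _ _ _ (by omega)]
        simp
      · intro i hi
        rw [cornerPath_getD _ _ _ (by omega)]
        simpa using hi
    · rw [ha p σ p' _ p (by omega), hap ⟨p, σ⟩ h, zero_mul, zero_mul]
      rw [cornerPath_getD _ _ _ (by omega), cornerPath_getD _ _ _ (by omega)]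
      simp
  · intro l hl hn
    rw [hval l hl]
    by_cases hk : ∃ k < p', (l.getD k (0, 0)).1 = (l.getD (k + 1) (0, 0)).1
    · obtain ⟨k, hk, hk'⟩ := hk
      rw [ha p σ p' _ k hk hk', zero_mul]
    · push Not at hk
      exfalso
      have hi : ∀ i ≤ p, l.getD i (0, 0) = (i, 0) := by
        intro i hi
        induction i with
        | zero => exact hl.zero_eq
        | succ i ih =>
          rcases hl.step i (by omega) with e | e
          · rw [e, ih (by omega)]
          · exact (hk i (by omega) (by rw [e])).elim
      refine hn ?_
      rw [← hi p le_rfl, List.getD_eq_getElem _ _ (by rw [hl.length_eq]; omega)]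
      exact List.getElem_mem _

/-- The slant product of a cross product. -/
theorem slant_cross {p n d : ℕ} (hn : n ≤ d) {a : cocycles X} (ha : Normalized (a : Cochain X))
    (hap : Supp p (a : Cochain X)) {b : Coh Y} (hb : b.InDegree n) {z : Hml Y} (hz : z.InDegree d) :
    slant (Coh.map ContinuousMap.fst (Coh.mk a) * Coh.map ContinuousMap.snd b) z =
      pairing b z • Coh.mk a := by
  obtain ⟨f, rfl, hf⟩ := hb
  obtain ⟨c, rfl, hc⟩ := hz
  have key : slantCocycle (cocyclesPullback ContinuousMap.fst a * cocyclesPullback ContinuousMap.snd f)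
      c = Cochain.eval (f : Cochain Y) (c : Sing Y →₀ ℤ) • a := by
    refine Subtype.ext ?_
    refine Cochain.ext fun k σ => ?_
    have e : ((Cochain.eval (f : Cochain Y) (c : Sing Y →₀ ℤ) • a : cocycles X) : Cochain X) ⟨k, σ⟩ =
        Cochain.eval (f : Cochain Y) (c : Sing Y →₀ ℤ) * (a : Cochain X) ⟨k, σ⟩ := rfl
    rw [e]
    change Finsupp.linearCombination ℤ (fun τ => slantSimp (pullback ContinuousMap.fst (a : Cochain X) *
      pullback ContinuousMap.snd (f : Cochain Y)) τ ⟨k, σ⟩) (c : Sing Y →₀ ℤ) =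
      Finsupp.linearCombination ℤ (fun τ => (f : Cochain Y) τ) (c : Sing Y →₀ ℤ) * _
    rw [Finsupp.linearCombination_apply, Finsupp.linearCombination_apply, Finsupp.sum, Finsupp.sum,
      Finset.sum_mul]
    refine Finset.sum_congr rfl fun τ hτ => ?_
    have hd : τ.1 = d := by
      by_contra h
      exact Finsupp.mem_support_iff.1 hτ (hc τ h)
    obtain ⟨q, τ⟩ := τ
    subst hd
    rw [slantSimp_cross ha hap hf hn]
    simp only [smul_eq_mul]
    ring
  change Coh.mk (slantCocycle _ c) = Cochain.eval (f : Cochain Y) (c : Sing Y →₀ ℤ) • Coh.mk a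
  rw [key]
  exact map_zsmul Coh.mk _ _

theorem slant_add (y y' : Coh (X × Y)) (z : Hml Y) : slant (y + y') z = slant y z + slant y' z := by
  obtain ⟨f, rfl⟩ := Coh.mk_surjective y
  obtain ⟨f', rfl⟩ := Coh.mk_surjective y'
  obtain ⟨c, rfl⟩ := Submodule.Quotient.mk_surjective _ z
  have key : slantCocycle (f + f') c = slantCocycle f c + slantCocycle f' c :=
    Subtype.ext (slantChain_add_left _ _ _)
  change Coh.mk (slantCocycle (f + f') c) = Coh.mk (slantCocycle f c) + Coh.mk (slantCocycle f' c)
  rw [key, RingHom.map_add]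

theorem slant_zsmul (k : ℤ) (y : Coh (X × Y)) (z : Hml Y) : slant (k • y) z = k • slant y z := 
  map_zsmul (⟨⟨fun y => slant y z, by simpa using slant_add 0 0 z⟩, fun y y' => slant_add y y' z⟩ :
    Coh (X × Y) →+ Coh X) k y

theorem slant_sum {ι : Type*} (s : Finset ι) (y : ι → Coh (X × Y)) (z : Hml Y) :
    slant (∑ i ∈ s, y i) z = ∑ i ∈ s, slant (y i) z :=
  map_sum (⟨⟨fun y => slant y z, by simpa using slant_add 0 0 z⟩, fun y y' => slant_add y y' z⟩ :
    Coh (X × Y) →+ Coh X) y s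

/-! ### The Sperner cocycle of `ℂ^n` -/

open Cochain

/-- The real coordinates of `z ∈ ℂ^n`, preceded by `0`. -/
def realCoord {n : ℕ} (z : Fin n → ℂ) (k : Fin (2 * n + 1)) : ℝ :=
  if h : (k : ℕ) = 0 then 0 else
    if (k : ℕ) % 2 = 1 then (z ⟨((k : ℕ) - 1) / 2, by omega⟩).re
    else (z ⟨((k : ℕ) - 1) / 2, by omega⟩).im

theorem realCoord_zero_index {n : ℕ} (z : Fin n → ℂ) : realCoord z 0 = 0 := by
  simp [realCoord]

theorem realCoord_orientedSimp {n : ℕ} (t : Dl (2 * n)) (k : Fin (2 * n + 1)) :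
    realCoord (orientedSimp n t) k = t k - t 0 := by
  obtain ⟨k, hk⟩ := k
  rw [realCoord]
  by_cases h0 : k = 0
  · subst h0; simp
  rw [dif_neg h0]
  split_ifs with h1
  · rw [orientedSimp_re]
    congr 2
    ext
    simp only at h1 ⊢
    omega
  · rw [orientedSimp_im]
    congr 2
    ext
    simp only at h1 ⊢
    omega

theorem continuous_realCoord {n : ℕ} (k : Fin (2 * n + 1)) :
    Continuous fun z : Fin n → ℂ => realCoord z k := by
  unfold realCoord
  split_ifs
  · exact continuous_const
  · exact Complex.continuous_re.comp (continuous_apply _)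
  · exact Complex.continuous_im.comp (continuous_apply _)

theorem realCoord_zero {n : ℕ} (k : Fin (2 * n + 1)) : realCoord (0 : Fin n → ℂ) k = 0 := by
  simp [realCoord]

theorem eq_zero_of_realCoord {n : ℕ} {z : Fin n → ℂ} (h : ∀ k, realCoord z k = 0) : z = 0 := by
  funext a
  refine Complex.ext ?_ ?_
  · have := h ⟨2 * a + 1, by omega⟩
    rw [realCoord, dif_neg (by simp), if_pos (by simp only; omega)] at this
    refine Eq.trans ?_ this
    congr 2
    ext
    simp only
    omega
  · have := h ⟨2 * a + 2, by omega⟩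
    rw [realCoord, dif_neg (by simp), if_neg (by simp only; omega)] at this
    refine Eq.trans ?_ this
    congr 2
    ext
    simp only
    omega

/-- The largest index of a maximal real coordinate. -/
theorem exists_label {n : ℕ} (z : Fin n → ℂ) : ∃ k : Fin (2 * n + 1),
    (∀ j, realCoord z j ≤ realCoord z k) ∧ ∀ j, k < j → realCoord z j < realCoord z k := by
  classical
  obtain ⟨m, hm⟩ := Finite.exists_max (realCoord z)
  let s := Finset.univ.filter fun k => ∀ j, realCoord z j ≤ realCoord z k
  have hs : s.Nonempty := ⟨m, by simpa [s] using hm⟩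
  have hk := (Finset.mem_filter.1 (s.max'_mem hs)).2
  refine ⟨s.max' hs, hk, fun j hj => lt_of_le_of_ne (hk j) fun h => ?_⟩
  have : j ∈ s := Finset.mem_filter.2 ⟨Finset.mem_univ _, fun i => h ▸ hk i⟩
  exact absurd (s.le_max' j this) (not_le.2 hj)

/-- The largest index of a maximal real coordinate. -/
def label {n : ℕ} (z : Fin n → ℂ) : Fin (2 * n + 1) := (exists_label z).choose

theorem realCoord_le_label {n : ℕ} (z : Fin n → ℂ) (j : Fin (2 * n + 1)) :
    realCoord z j ≤ realCoord z (label z) := (exists_label z).choose_spec.1 j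

theorem label_eq {n : ℕ} {z : Fin n → ℂ} {k : Fin (2 * n + 1)}
    (h : ∀ j, realCoord z j ≤ realCoord z k) (h' : ∀ j, k < j → realCoord z j < realCoord z k) :
    label z = k := by
  rcases lt_trichotomy (label z) k with hk | hk | hk
  · exact absurd (h _) (not_le.2 ((exists_label z).choose_spec.2 k hk))
  · exact hk
  · exact absurd (realCoord_le_label z k) (not_le.2 (h' _ hk))

/-- The Sperner cocycle: the signed count of simplices whose vertices carry all labels. -/
def sperner (n : ℕ) : Cochain (Fin n → ℂ) := of fun σ =>
  if σ.1 = 2 * n then Matrix.det (Matrix.of fun i k : Fin (2 * n + 1) =>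
    if label (σ.2 (vert σ.1 i)) = k then (1 : ℤ) else 0) else 0

theorem sperner_val {n : ℕ} (σ : Simp (2 * n) (Fin n → ℂ)) : sperner n ⟨2 * n, σ⟩ =
    Matrix.det (Matrix.of fun i k : Fin (2 * n + 1) =>
      if label (σ (vert (2 * n) i)) = k then (1 : ℤ) else 0) := if_pos rfl

theorem supp_sperner (n : ℕ) : Supp (2 * n) (sperner n) := fun _ h => if_neg h

theorem pull_vert {p n : ℕ} (σ : Simp p X) (b : ℕ → ℕ) {i : ℕ} (hi : i ≤ n) :
    σ.pull n b (vert n i) = σ (vert p (b i)) := by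
  change σ (stdSimplex.map _ _) = _
  rw [map_vert_vtx _ _ hi]

/-- The sum is the expansion, along a first column of ones, of the matrix of labels. That matrix is
singular: each row has exactly one further 1, so the first column is the sum of the others. -/
theorem det_labels_eq_zero {N : ℕ} (lab : Fin (N + 1) → Fin N) :
    ∑ i : Fin (N + 1), (-1) ^ (i : ℕ) * Matrix.det (Matrix.of fun j k : Fin N =>
      if lab (i.succAbove j) = k then (1 : ℤ) else 0) = 0 := by
  let A : Matrix (Fin (N + 1)) (Fin (N + 1)) ℤ := Matrix.of fun i =>
    Fin.cons 1 fun k => if lab i = k then 1 else 0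
  have hA : A.det = 0 := by
    refine Matrix.exists_mulVec_eq_zero_iff.1 ⟨Fin.cons 1 fun _ => -1, ?_, ?_⟩
    · intro h
      simpa using congrFun h 0
    · funext i
      simp [Matrix.mulVec, dotProduct, Fin.sum_univ_succ, A]
  rw [Matrix.det_succ_column_zero] at hA
  refine Eq.trans ?_ hA
  refine Finset.sum_congr rfl fun i _ => ?_
  have : A i 0 = 1 := rfl
  rw [this, mul_one]
  rfl

theorem d_sperner (n : ℕ) : (sperner n).d = 0 := by
  refine ext fun m σ => ?_
  by_cases hm : m = 2 * n + 1
  swap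
  · exact (supp_sperner n).d _ hm
  subst hm
  rw [d_succ, zero_val, Finset.sum_range,
    ← det_labels_eq_zero fun i => label (σ (vert (2 * n + 1) i))]
  refine Finset.sum_congr rfl fun i _ => ?_
  rw [sperner_val]
  congr 3
  funext j k
  rw [pull_vert _ _ (by omega)]
  congr 5
  simp only [skip, Fin.succAbove, Fin.lt_def, Fin.val_castSucc]
  split_ifs <;> rfl

/-- The set of points at which the `j`-th real coordinate is not maximal. -/
def nonMax {n : ℕ} (j : Fin (2 * n + 1)) : Set (Fin n → ℂ) :=
  {z | ∃ k, realCoord z j < realCoord z k}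

theorem isOpen_nonMax {n : ℕ} (j : Fin (2 * n + 1)) : IsOpen (nonMax j) := by
  have : nonMax j = ⋃ k, {z : Fin n → ℂ | realCoord z j < realCoord z k} := by
    ext z; simp [nonMax]
  rw [this]
  exact isOpen_iUnion fun k => isOpen_lt (continuous_realCoord j) (continuous_realCoord k)

theorem iUnion_nonMax (n : ℕ) : (⋃ j, nonMax j) = {z : Fin n → ℂ | z ≠ 0} := by
  ext z
  simp only [Set.mem_iUnion, Set.mem_ofPred_eq]
  constructor
  · rintro ⟨j, k, h⟩ rfl
    rw [realCoord_zero, realCoord_zero] at h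
    exact lt_irrefl _ h
  · intro h
    by_contra hn
    push Not at hn
    refine h (eq_zero_of_realCoord fun k => le_antisymm ?_ ?_)
    · refine le_of_not_gt fun hk => hn 0 ⟨k, ?_⟩
      rwa [realCoord_zero_index]
    · refine le_of_not_gt fun hk => hn k ⟨0, ?_⟩
      rwa [realCoord_zero_index]

/-- No point of `nonMax j` carries the label `j`, so the matrix of labels has a zero column. -/
theorem vanOn_sperner {n : ℕ} (j : Fin (2 * n + 1)) : VanOn (nonMax j) (sperner n) := by
  rintro ⟨m, σ⟩ hσ
  by_cases hm : m = 2 * n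
  swap
  · exact supp_sperner n _ hm
  subst hm
  rw [sperner_val]
  refine Matrix.det_eq_zero_of_column_eq_zero j fun i => if_neg fun h => ?_
  obtain ⟨k, hk⟩ := hσ ⟨vert (2 * n) i, rfl⟩
  rw [← h] at hk
  exact absurd (realCoord_le_label _ k) (not_le.2 hk)

theorem sperner_orientedSimp (n : ℕ) : sperner n ⟨2 * n, orientedSimp n⟩ = 1 := by
  rw [sperner_val]
  refine Eq.trans ?_ (Matrix.det_one (n := Fin (2 * n + 1)) (R := ℤ))
  congr 1
  ext i k
  have : label (orientedSimp n (vert (2 * n) i)) = i := by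
    have hi : min (i : ℕ) (2 * n) = i := by omega
    refine label_eq (fun j => ?_) fun j hj => ?_
    · simp only [realCoord_orientedSimp, vert_apply, hi, sub_le_sub_iff_right]
      split_ifs <;> norm_num
    · simp only [realCoord_orientedSimp, vert_apply, hi, sub_lt_sub_iff_right]
      rw [if_neg (by have := Fin.lt_def.1 hj; omega)]
      norm_num
  rw [Matrix.of_apply, this, Matrix.one_apply]

/-- The sets `nonMax j` are open, cover the complement of the origin, and on each of them the
Sperner cocycle vanishes. The theorem of small simplices makes it vanish on the whole complement.
Since `h` itself vanishes on each `nonMax j`, it does not affect the values on the test simplices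
below. -/
theorem exists_sperner_correction (n : ℕ) : ∃ h : Cochain (Fin (n + 1) → ℂ), Supp (2 * n + 1) h ∧
    VanOn {z | z ≠ 0} (sperner (n + 1) - h.d) ∧ ∀ j, VanOn (nonMax j) h := by
  obtain ⟨h, h1, h2⟩ := exists_d_eq_of_small (fun j : Fin (2 * (n + 1) + 1) => nonMax j)
    isOpen_nonMax (sperner (n + 1)) (fun σ _ => by rw [d_sperner]; rfl)
    (fun τ j hτ => vanOn_sperner j τ hτ)
  refine ⟨comp (2 * n + 1) h, supp_comp _ _, ?_, fun j => VanOn.comp (fun σ hσ => ?_) _⟩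
  · have e : sperner (n + 1) - (comp (2 * n + 1) h).d =
        comp (2 * n + 1 + 1) (sperner (n + 1) - h.d) := by
      rw [comp_sub, comp_succ_d]
      congr 1
      exact (supp_sperner (n + 1)).comp_eq.symm
    rw [e]
    refine VanOn.comp (fun σ hσ => ?_) _
    rw [sub_val, h1 σ (by rw [iUnion_nonMax]; exact hσ), sub_self]
  · exact h2 σ fun τ hτ => vanOn_sperner j τ (hτ.trans hσ)

theorem exists_pos_of_stdSimplex {n : ℕ} (t : Dl n) : ∃ k, 0 < t k := by
  by_contra h
  push Not at h
  have hs := t.2.2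
  have : ∑ k, t.1 k ≤ 0 := Finset.sum_nonpos fun k _ => h k
  linarith

/-- On a face of `orientedSimp`, the coordinate of the omitted vertex is not maximal. -/
theorem exists_lt_of_apply_eq_zero {n : ℕ} (t : Dl n) (j : Fin (n + 1)) (h : t j = 0) :
    ∃ k, t j - t 0 < t k - t 0 := by
  obtain ⟨k, hk⟩ := exists_pos_of_stdSimplex t
  exact ⟨k, by linarith⟩

/-! ### Cross products of Thom classes of vector spaces -/

/-- The identification of `ℂ × ℂ^r` with `ℂ^{r+1}`. -/
def consMap (r : ℕ) : C((Fin 1 → ℂ) × (Fin r → ℂ), Fin (r + 1) → ℂ) where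
  toFun q := Fin.cons (q.1 0) q.2
  continuous_toFun := by
    refine continuous_pi fun i => ?_
    refine Fin.cases ?_ (fun i => ?_) i
    · simp only [Fin.cons_zero]; fun_prop
    · simp only [Fin.cons_succ]; fun_prop

theorem realCoord_cons {r : ℕ} (q : (Fin 1 → ℂ) × (Fin r → ℂ)) (k : Fin (2 * (r + 1) + 1)) :
    realCoord (consMap r q) k = if h : (k : ℕ) ≤ 2 then realCoord q.1 ⟨k, by omega⟩
      else realCoord q.2 ⟨k - 2, by omega⟩ := by
  obtain ⟨k, hk⟩ := k
  by_cases h0 : k = 0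
  · subst h0
    simp [realCoord]
  by_cases h : k ≤ 2
  · rw [dif_pos h]
    simp only [realCoord, dif_neg h0]
    have e : (⟨(k - 1) / 2, by omega⟩ : Fin (r + 1)) = 0 := by
      ext; simp; omega
    have e' : (⟨(k - 1) / 2, by omega⟩ : Fin 1) = 0 := Subsingleton.elim _ _
    rw [e, e']
    rfl
  · rw [dif_neg h]
    simp only [realCoord, dif_neg h0, dif_neg (show ¬ k - 2 = 0 by omega)]
    have e : (⟨(k - 1) / 2, by omega⟩ : Fin (r + 1)) =
        Fin.succ ⟨(k - 2 - 1) / 2, by omega⟩ := by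
      ext; simp; omega
    have e2 : (k - 2) % 2 = k % 2 := by omega
    rw [e, e2]
    rfl

theorem realCoord_cons_orientedSimp {r : ℕ} (s : Dl (2 * 1)) (t : Dl (2 * r))
    (k : Fin (2 * (r + 1) + 1)) :
    realCoord (consMap r (orientedSimp 1 s, orientedSimp r t)) k =
      if h : (k : ℕ) ≤ 2 then s ⟨k, by omega⟩ - s 0 else t ⟨k - 2, by omega⟩ - t 0 := by
  rw [realCoord_cons]
  split_ifs <;> rw [realCoord_orientedSimp]

theorem label_cons_orientedSimp {r : ℕ} (a b : ℕ) (ha : a ≤ 2) (hb : b ≤ 2 * r) :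
    label (consMap r (orientedSimp 1 (vert (2 * 1) a), orientedSimp r (vert (2 * r) b))) =
      ⟨if b = 0 then a else 2 + b, by split_ifs <;> omega⟩ := by
  have hc : ∀ k : Fin (2 * (r + 1) + 1), realCoord (consMap r (orientedSimp 1 (vert (2 * 1) a),
      orientedSimp r (vert (2 * r) b))) k = if (k : ℕ) ≤ 2 then
        (if a = k then 1 else 0) - (if a = 0 then 1 else 0)
        else (if b = k - 2 then 1 else 0) - (if b = 0 then 1 else 0) := by
    intro k
    rw [realCoord_cons_orientedSimp]
    simp only [vert_apply, Nat.min_eq_left hb, Nat.min_eq_left (show a ≤ 2 * 1 from ha)]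
    rfl
  refine label_eq (fun j => ?_) fun j hj => ?_
  · rw [hc, hc]
    dsimp only
    split_ifs <;> first | (exfalso; omega) | norm_num
  · rw [hc, hc]
    have hj' := Fin.lt_def.1 hj
    dsimp only at hj' ⊢
    split_ifs at hj' ⊢ <;> first | (exfalso; omega) | norm_num

/-- The boundary of σ × τ consists of the products with a face of one factor. The set `S` may depend
on the face: for the Sperner correction it is `nonMax j` with `j` varying. -/
theorem slantSimp_d_eq_zero {p q : ℕ} {f : Cochain (X × Y)} (σ : Simp p X) (τ : Simp q Y)
    (h1 : ∀ i, ∃ S, VanOn S f ∧ ∀ (s : Dl p) (t : Dl q), s i = 0 → (σ s, τ t) ∈ S)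
    (h2 : ∀ j, ∃ S, VanOn S f ∧ ∀ (s : Dl p) (t : Dl q), t j = 0 → (σ s, τ t) ∈ S) :
    slantSimp f.d ⟨q, τ⟩ ⟨p, σ⟩ = 0 := by
  rw [slantSimp_d]
  have e1 : (slantSimp f ⟨q, τ⟩).d ⟨p, σ⟩ = 0 := by
    cases p with
    | zero => exact d_zero_dim _ _
    | succ p =>
      rw [d_succ]
      refine Finset.sum_eq_zero fun i hi => ?_
      obtain ⟨S, hS, hS'⟩ := h1 ⟨i, Finset.mem_range.1 hi⟩
      rw [slantSimp_eq_zero hS, mul_zero]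
      rintro _ ⟨s, rfl⟩ _ ⟨t, rfl⟩
      exact hS' _ _ (pull_skip_apply_eq_zero i (Finset.mem_range.1 hi) s)
  have e2 : Finsupp.linearCombination ℤ (fun τ' => slantSimp f τ' ⟨p, σ⟩) (bdrySimp ⟨q, τ⟩) = 0 := by
    cases q with
    | zero => simp [bdrySimp]
    | succ q =>
      simp only [bdrySimp, map_sum, Finsupp.linearCombination_single, smul_eq_mul]
      refine Finset.sum_eq_zero fun i hi => ?_
      obtain ⟨S, hS, hS'⟩ := h2 ⟨i, Finset.mem_range.1 hi⟩
      rw [slantSimp_eq_zero hS, mul_zero]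
      rintro _ ⟨s, rfl⟩ _ ⟨t, rfl⟩
      exact hS' _ _ (pull_skip_apply_eq_zero i (Finset.mem_range.1 hi) t)
  rw [e1, e2, mul_zero, add_zero]

theorem slantSimp_add (f g : Cochain (X × Y)) (τ : Sing Y) (σ : Sing X) :
    slantSimp (f + g) τ σ = slantSimp f τ σ + slantSimp g τ σ := pathSum_add _ _ _ _

theorem slantSimp_sub (f g : Cochain (X × Y)) (τ : Sing Y) (σ : Sing X) :
    slantSimp (f - g) τ σ = slantSimp f τ σ - slantSimp g τ σ := pathSum_sub _ _ _ _

/-- The point (a, b) of a lattice path carries the label a if b = 0 and 2 + b otherwise. Label 2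
therefore occurs only at the corner (2, 0), and every path that avoids it has a zero column. Along
the corner the labels occur in their natural order. -/
theorem slantSimp_sperner (r : ℕ) : slantSimp (pullback (consMap r) (sperner (r + 1)))
    ⟨2 * r, orientedSimp r⟩ ⟨2 * 1, orientedSimp 1⟩ = 1 := by
  change pathSum (2 * 1) (2 * r) (fun l => pullback (consMap r) (sperner (r + 1))
    (prodSimp (orientedSimp 1) (orientedSimp r) l)) = 1
  have hlab : ∀ l, IsPath (2 * 1) (2 * r) l → pullback (consMap r) (sperner (r + 1))
      (prodSimp (orientedSimp 1) (orientedSimp r) l) =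
      Matrix.det (Matrix.of fun i k : Fin (2 * (r + 1) + 1) =>
        if (if (l.getD i (0, 0)).2 = 0 then (l.getD i (0, 0)).1 else 2 + (l.getD i (0, 0)).2) = k
          then (1 : ℤ) else 0) := by
    intro l hl
    have hlen : l.length = 2 * (r + 1) + 1 := by rw [hl.length_eq]; omega
    rw [prodSimp_eq _ _ hlen, pullback_apply, sperner_val]
    congr 2
    funext i k
    have hi : (i : ℕ) ≤ 2 * (r + 1) := by omega
    have hb := hl.bound (l.getD i (0, 0)) (by
      rw [List.getD_eq_getElem _ _ (by omega)]
      exact List.getElem_mem _)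
    have e : label (((consMap r).comp (((orientedSimp 1).pull (2 * (r + 1))
        fun i => (l.getD i (0, 0)).1).prodMk ((orientedSimp r).pull (2 * (r + 1))
          fun i => (l.getD i (0, 0)).2))) (vert (2 * (r + 1)) i)) =
        ⟨if (l.getD i (0, 0)).2 = 0 then (l.getD i (0, 0)).1 else 2 + (l.getD i (0, 0)).2, by
          split_ifs <;> omega⟩ := by
      rw [ContinuousMap.comp_apply, ContinuousMap.prod_eval, pull_vert _ _ hi, pull_vert _ _ hi]
      exact label_cons_orientedSimp _ _ hb.1 hb.2
    rw [e]
    simp only [Fin.ext_iff]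
  rw [pathSum_eq_cornerPath, hlab _ (isPath_cornerPath _ _)]
  · refine Eq.trans ?_ (Matrix.det_one (n := Fin (2 * (r + 1) + 1)) (R := ℤ))
    congr 1
    ext i k
    rw [Matrix.of_apply, cornerPath_getD _ _ _ (by omega), Matrix.one_apply]
    simp only [Fin.ext_iff]
    congr 2
    split_ifs <;> omega
  · intro l hl hn
    rw [hlab l hl]
    refine Matrix.det_eq_zero_of_column_eq_zero ⟨2, by omega⟩ fun i => if_neg fun h => hn ?_
    have hlen : l.length = 2 * (r + 1) + 1 := by rw [hl.length_eq]; omega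
    have : l.getD i (0, 0) = (2 * 1, 0) := by
      dsimp only at h
      split_ifs at h with h0
      · exact Prod.ext h h0
      · omega
    rw [← this, List.getD_eq_getElem _ _ (by omega)]
    exact List.getElem_mem _

theorem locTriv_unit (n : ℕ) : LocTriv n (ContinuousMap.const (Fin n → ℂ) ()) {z | z ≠ 0}
    {ContinuousMap.id _} := by
  intro b
  refine ⟨Set.univ, isOpen_univ, trivial, Prod.snd, id, continuous_snd.continuousOn,
    continuous_id.continuousOn, fun w _ z => ⟨rfl, rfl, Iff.rfl⟩, fun t _ => rfl,
    fun w _ => ⟨_, rfl, fun z => rfl⟩⟩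

theorem vanOn_cross {u : Cochain X} {v : Cochain Y} {A : Set X} {B : Set Y}
    (hu : VanOn A u) (hv : VanOn B v) :
    VanOn {q : X × Y | q.1 ∈ A} (pullback ContinuousMap.fst u * pullback ContinuousMap.snd v) ∧
    VanOn {q : X × Y | q.2 ∈ B} (pullback ContinuousMap.fst u * pullback ContinuousMap.snd v) :=
  ⟨(hu.pullback ContinuousMap.fst fun _ h => h).mul_right _,
    (hv.pullback ContinuousMap.snd fun _ h => h).mul_left _⟩

/-- Orientations of products of complex vector spaces. -/
theorem cross_value {r : ℕ} {u : Cochain (Fin 1 → ℂ)} {v : Cochain (Fin r → ℂ)}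
    (hus : Supp (2 * 1) u) (hud : u.d = 0) (huT : VanOn {z | z ≠ 0} u)
    (hvs : Supp (2 * r) v) (hvd : v.d = 0) (hvT : VanOn {z | z ≠ 0} v)
    {U h : Cochain (Fin (r + 1) → ℂ)} (hUs : Supp (2 * (r + 1)) U) (hUd : U.d = 0)
    (hUT : VanOn {z | z ≠ 0} U) (h1 : VanOn {z | z 0 ≠ 0} h) (h2 : VanOn {z | Fin.tail z ≠ 0} h)
    (hU : pullback (consMap r) U = pullback ContinuousMap.fst u * pullback ContinuousMap.snd v +
      (pullback (consMap r) h).d) :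
    U ⟨2 * (r + 1), orientedSimp (r + 1)⟩ =
      u ⟨2 * 1, orientedSimp 1⟩ * v ⟨2 * r, orientedSimp r⟩ := by
  have hne1 : ∀ q : (Fin 1 → ℂ) × (Fin r → ℂ), q.1 ≠ 0 → consMap r q 0 ≠ 0 := fun q hq h =>
    hq (funext fun i => by rw [Subsingleton.elim i 0]; exact h)
  have hne2 : ∀ q : (Fin 1 → ℂ) × (Fin r → ℂ), Fin.tail (consMap r q) = q.2 := fun q => by
    simp [consMap]
  have hcons : ∀ q : (Fin 1 → ℂ) × (Fin r → ℂ), q.1 ≠ 0 ∨ q.2 ≠ 0 → consMap r q ≠ 0 := by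
    rintro q (hq | hq) h0
    · exact hne1 q hq (by rw [h0]; rfl)
    · refine hq ?_
      rw [← hne2, h0]
      rfl
  -- The pull-back of `U` is evaluated in two ways on the shuffle product of the two oriented
  -- simplices. The first way needs a normalised first factor, which is available because that
  -- factor is ℂ and `u` has degree two.
  obtain ⟨g, hg, hgs, hgA⟩ := exists_normalized hud hus
  have hgT := hgA _ huT
  have hprod : slantSimp (pullback ContinuousMap.fst u * pullback ContinuousMap.snd v)
      ⟨2 * r, orientedSimp r⟩ ⟨2 * 1, orientedSimp 1⟩ =
      u ⟨2 * 1, orientedSimp 1⟩ * v ⟨2 * r, orientedSimp r⟩ := by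
    have e : (pullback ContinuousMap.fst u * pullback ContinuousMap.snd v :
        Cochain ((Fin 1 → ℂ) × (Fin r → ℂ))) =
        pullback ContinuousMap.fst (u - g.d) * pullback ContinuousMap.snd v +
        (pullback ContinuousMap.fst g * pullback ContinuousMap.snd v).d := by
      rw [d_mul, d_pullback, d_pullback, hvd, pullback_zero, mul_zero, add_zero, ← add_mul,
        ← pullback_add, sub_add_cancel]
    obtain ⟨k1, k2⟩ := vanOn_cross hgT hvT
    have hgd : Supp (2 * 1) (u - g.d) := hus.sub hgs.d
    rw [e, slantSimp_add, slantSimp_cross hg hgd hvs le_rfl, slantSimp_d_eq_zero, add_zero, sub_val]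
    · have := d_orientedSimp_eq_zero (ContinuousMap.id _) (fun z hz => hz) hgT
      rw [ContinuousMap.id_comp] at this
      rw [this, sub_zero]
    · exact fun i => ⟨_, k1, fun s t hs => orientedSimp_ne_zero 1 s i hs⟩
    · exact fun i => ⟨_, k2, fun s t ht => orientedSimp_ne_zero r t i ht⟩
  have hL : slantSimp (pullback (consMap r) U) ⟨2 * r, orientedSimp r⟩ ⟨2 * 1, orientedSimp 1⟩ =
      u ⟨2 * 1, orientedSimp 1⟩ * v ⟨2 * r, orientedSimp r⟩ := by
    rw [hU, slantSimp_add, hprod, slantSimp_d_eq_zero, add_zero]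
    · exact fun i => ⟨_, h1.pullback (A := {q : (Fin 1 → ℂ) × (Fin r → ℂ) | q.1 ≠ 0}) _ (fun q hq => hne1 q hq),
        fun s t hs => orientedSimp_ne_zero 1 s i hs⟩
    · exact fun i => ⟨_, h2.pullback (A := {q : (Fin 1 → ℂ) × (Fin r → ℂ) | q.2 ≠ 0}) _ (fun q hq => by
        rw [Set.mem_ofPred_eq, hne2]; exact hq), fun s t ht => orientedSimp_ne_zero r t i ht⟩
  -- The second way: the corrected Sperner cocycle has the value 1 both on the oriented simplex of
  -- ℂ^{r+1} and on the shuffle product. `U` is an integer multiple of it up to a relative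
  -- coboundary, so the two values of `U` agree as well.
  obtain ⟨k, hks, hkT, hkj⟩ := exists_sperner_correction r
  have hT : IsThomCocycle (r + 1) {z | z ≠ 0} {ContinuousMap.id _} (sperner (r + 1) - k.d) := by
    refine ⟨(supp_sperner _).sub hks.d, by rw [d_sub, d_sperner, d_d, sub_zero], hkT, ?_⟩
    rintro _ rfl
    rw [ContinuousMap.id_comp, sub_val, sperner_orientedSimp]
    have : k.d ⟨2 * (r + 1), orientedSimp (r + 1)⟩ = 0 := by
      refine (d_succ k (n := 2 * r + 1) (orientedSimp (r + 1))).trans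
        (Finset.sum_eq_zero fun i hi => ?_)
      have hi' := Finset.mem_range.1 hi
      rw [hkj ⟨i, hi'⟩, mul_zero]
      rintro _ ⟨s, rfl⟩
      obtain ⟨j, hj⟩ := exists_lt_of_apply_eq_zero _ _ (pull_skip_apply_eq_zero i hi' s)
      refine ⟨j, ?_⟩
      change realCoord (orientedSimp (r + 1) _) _ < realCoord (orientedSimp (r + 1) _) _
      rw [realCoord_orientedSimp, realCoord_orientedSimp]
      exact hj
    rw [this, sub_zero]
  obtain ⟨a, m, ha, ha0, hm, hUm, hval⟩ := (locTriv_unit (r + 1)).exists_eq_mul hT hUd hUT hUs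
  obtain ⟨φ, rfl, -, -, hφ⟩ := hval ()
  rw [ContinuousMap.id_comp] at hφ
  have hR : slantSimp (pullback (consMap r) U) ⟨2 * r, orientedSimp r⟩ ⟨2 * 1, orientedSimp 1⟩ =
      a ⟨0, ContinuousMap.const _ ()⟩ := by
    have e : slantSimp (pullback (consMap r) ((sperner (r + 1) - k.d) *
        pullback (ContinuousMap.const _ ()) a)) ⟨2 * r, orientedSimp r⟩ ⟨2 * 1, orientedSimp 1⟩ =
        a ⟨0, ContinuousMap.const _ ()⟩ * slantSimp (pullback (consMap r)
          (sperner (r + 1) - k.d)) ⟨2 * r, orientedSimp r⟩ ⟨2 * 1, orientedSimp 1⟩ := by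
      change pathSum _ _ _ = _ * pathSum _ _ _
      rw [← pathSum_mul]
      refine pathSum_congr _ _ _ _ fun l _ _ => ?_
      rw [prodSimp, pullback_apply, pullback_apply, mul_supp_zero_val _ _ (ha0.pullback _),
        pullback_val_const _ _ () (fun _ => rfl), mul_comm]
    rw [hUm, pullback_add, slantSimp_add, e, pullback_sub, slantSimp_sub, slantSimp_sperner,
      ← d_pullback, ← d_pullback, slantSimp_d_eq_zero, slantSimp_d_eq_zero, sub_zero, mul_one,
      add_zero]
    · exact fun i => ⟨_, hm.pullback (A := {q | consMap r q ≠ 0}) _ (fun _ h => h),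
        fun s t hs => hcons _ (Or.inl (orientedSimp_ne_zero 1 s i hs))⟩
    · exact fun i => ⟨_, hm.pullback (A := {q | consMap r q ≠ 0}) _ (fun _ h => h),
        fun s t ht => hcons _ (Or.inr (orientedSimp_ne_zero r t i ht))⟩
    · intro i
      refine ⟨_, (hkj ⟨i, by omega⟩).pullback (A := {q | consMap r q ∈ nonMax ⟨i, by omega⟩}) _
        (fun _ h => h), fun s t hs => ?_⟩
      -- On a face of the first factor, the coordinate of the omitted vertex is exceeded by another
      -- coordinate with index at most 2.
      obtain ⟨j, hj⟩ := exists_lt_of_apply_eq_zero s i hs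
      refine ⟨⟨j, by omega⟩, ?_⟩
      rw [realCoord_cons_orientedSimp, realCoord_cons_orientedSimp, dif_pos (by simp only; omega),
        dif_pos (by simp only; omega)]
      exact hj
    · intro i
      -- On the face of the second factor opposite to vertex 0, coordinate 0 is exceeded by a
      -- positive `t j`. Opposite to another vertex, coordinate `2 + i` equals `- t 0`; it is
      -- exceeded by coordinate 0 if `t 0` is positive, and otherwise by the coordinate of some
      -- positive `t j`.
      by_cases hi : (i : ℕ) = 0
      · obtain rfl : i = 0 := Fin.ext hi
        refine ⟨_, (hkj 0).pullback (A := {q | consMap r q ∈ nonMax 0}) _ (fun _ h => h),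
          fun s t ht => ?_⟩
        obtain ⟨j, hj⟩ := exists_pos_of_stdSimplex t
        have hj0 : (j : ℕ) ≠ 0 := fun h => by
          rw [show j = 0 from Fin.ext h, ht] at hj
          exact lt_irrefl _ hj
        refine ⟨⟨2 + j, by omega⟩, ?_⟩
        rw [realCoord_zero_index, realCoord_cons_orientedSimp, dif_neg (by simp only; omega), ht]
        simpa using hj
      · refine ⟨_, (hkj ⟨2 + i, by omega⟩).pullback
          (A := {q | consMap r q ∈ nonMax ⟨2 + i, by omega⟩}) _ (fun _ h => h), fun s t ht => ?_⟩
        have e1 : realCoord (consMap r (orientedSimp 1 s, orientedSimp r t)) ⟨2 + i, by omega⟩ =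
            - t 0 := by
          rw [realCoord_cons_orientedSimp, dif_neg (by simp only; omega)]
          simp [ht]
        obtain ⟨j, hj⟩ := exists_pos_of_stdSimplex t
        by_cases h0 : 0 < t 0
        · refine ⟨0, ?_⟩
          rw [e1, realCoord_zero_index]
          linarith
        · have hj0 : (j : ℕ) ≠ 0 := fun h => by
            rw [show j = 0 from Fin.ext h] at hj
            exact h0 hj
          refine ⟨⟨2 + j, by omega⟩, ?_⟩
          rw [e1, realCoord_cons_orientedSimp, dif_neg (by simp only; omega)]
          simp only [Nat.add_sub_cancel_left, Fin.eta]
          linarith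
  rw [hφ, ← hR, hL]

/-! ### Complex conjugation -/

/-- The map `z ↦ i z̄`. -/
def swapMap : C(Fin 1 → ℂ, Fin 1 → ℂ) :=
  ⟨fun z _ => Complex.I * (starRingEnd ℂ) (z 0), by fun_prop⟩

/-- z ↦ i z̄ exchanges real and imaginary parts, that is, the vertices 1 and 2 of the oriented
simplex. -/
theorem swapMap_comp_orientedSimp : swapMap.comp (orientedSimp 1) =
    (orientedSimp 1).pull 2 fun i => [0, 2, 1].getD i 0 := by
  ext t a
  obtain rfl : a = 0 := Subsingleton.elim _ _
  have h0 : stdSimplex.map (vtx 2 (2 * 1) fun i => [0, 2, 1].getD i 0) t 0 = t 0 := by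
    rw [stdSimplex_map_apply]
    simp [Fin.sum_univ_three, vtx, Fin.ext_iff]
  have h1 : stdSimplex.map (vtx 2 (2 * 1) fun i => [0, 2, 1].getD i 0) t 1 = t 2 := by
    rw [stdSimplex_map_apply]
    simp [Fin.sum_univ_three, vtx, Fin.ext_iff]
  have h2 : stdSimplex.map (vtx 2 (2 * 1) fun i => [0, 2, 1].getD i 0) t 2 = t 1 := by
    rw [stdSimplex_map_apply]
    simp [Fin.sum_univ_three, vtx, Fin.ext_iff]
  change Complex.I * (starRingEnd ℂ) (orientedSimp 1 t 0) = orientedSimp 1 _ 0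
  refine Complex.ext ?_ ?_
  · rw [orientedSimp_re]
    refine Eq.trans ?_ (congrArg₂ (· - ·) h1.symm h0.symm)
    simp [orientedSimp_im]
  · rw [orientedSimp_im]
    refine Eq.trans ?_ (congrArg₂ (· - ·) h2.symm h0.symm)
    simp [orientedSimp_re]

/-- Evaluate `f.d = 0` on the degenerate 3-simplex with vertices 0, 1, 2, 1. Two of its faces lack
the vertex 0 or the vertex 2 and hence avoid the origin; the other two are the oriented simplex and
its reflection, with equal signs. -/
theorem swap_value {f : Cochain (Fin 1 → ℂ)} (hf : f.d = 0) (hfT : VanOn {z | z ≠ 0} f) :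
    f ⟨2, swapMap.comp (orientedSimp 1)⟩ = - f ⟨2, orientedSimp 1⟩ := by
  have hz : ∀ (b : ℕ → ℕ) (i : Fin 3), (∀ j ≤ 2, min (b j) 2 ≠ i) →
      f ⟨2, (orientedSimp 1).pull 2 b⟩ = 0 := by
    intro b i hb
    refine hfT _ ?_
    rintro _ ⟨s, rfl⟩
    refine orientedSimp_ne_zero 1 _ i ?_
    change stdSimplex.map (vtx 2 (2 * 1) b) s i = 0
    rw [stdSimplex_map_apply]
    refine Finset.sum_eq_zero fun j _ => if_neg fun h => hb j (by omega) ?_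
    exact congrArg Fin.val h
  have h := congrFun hf ⟨3, (orientedSimp 1).pull 3 fun i => [0, 1, 2, 1].getD i 0⟩
  rw [d_succ] at h
  simp only [Finset.sum_range_succ, Finset.sum_range_zero, zero_add] at h
  have e : ∀ i, i ≤ 3 → ∀ b : ℕ → ℕ, (∀ j ≤ 2, [0, 1, 2, 1].getD (skip i j) 0 = b j) →
      f ⟨2, Simp.pull ((orientedSimp 1).pull 3 fun i => [0, 1, 2, 1].getD i 0) 2 (skip i)⟩ =
        f ⟨2, (orientedSimp 1).pull 2 b⟩ := by
    intro i hi b hj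
    rw [Simp.pull_pull _ _ _ (by intro j hj; rw [skip]; split_ifs <;> omega)]
    refine congrArg (fun ρ => f ⟨2, ρ⟩) (Simp.pull_congr _ fun j hj' => ?_)
    rw [Function.comp, hj j hj']
  rw [e 0 (by omega) (fun i => [1, 2, 1].getD i 0) (by intro j hj; interval_cases j <;> rfl),
    e 1 (by omega) (fun i => [0, 2, 1].getD i 0) (by intro j hj; interval_cases j <;> rfl),
    e 2 (by omega) (fun i => [0, 1, 1].getD i 0) (by intro j hj; interval_cases j <;> rfl),
    e 3 (by omega) id (by intro j hj; interval_cases j <;> rfl),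
    hz (fun i => [1, 2, 1].getD i 0) 0 (by intro j hj; interval_cases j <;> simp),
    hz (fun i => [0, 1, 1].getD i 0) 2 (by intro j hj; interval_cases j <;> simp),
    ← swapMap_comp_orientedSimp] at h
  have e3 : (orientedSimp 1).pull 2 id = orientedSimp 1 := Simp.pull_id (n := 2) _ fun _ _ => rfl
  rw [e3, zero_val] at h
  linear_combination -h

/-! ### Associated bundles of circle bundles -/

section Associated

variable {E : Type*} [TopologicalSpace E] [MulAction Circle E]

/-- `ϖ` identifies `T` with the quotient of `E × Y` by the diagonal action of the circle. -/
structure IsBorel {T : Type*} [TopologicalSpace T] (ρ : Circle →* Function.End Y)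
    (ϖ : E × Y → T) : Prop where
  isOpenQuotientMap : IsOpenQuotientMap ϖ
  eq_iff : ∀ a b, ϖ a = ϖ b ↔ ∃ g : Circle, b = (g • a.1, ρ g a.2)
  continuous_act : Continuous fun q : Circle × Y => ρ q.1 q.2

variable {T B : Type*} [TopologicalSpace T] [TopologicalSpace B]

theorem IsBorel.act_eq {ρ : Circle →* Function.End Y} {ϖ : E × Y → T} (h : IsBorel ρ ϖ)
    (g : Circle) (e : E) (y : Y) : ϖ (g • e, ρ g y) = ϖ (e, y) :=
  ((h.eq_iff (e, y) _).2 ⟨g, rfl⟩).symm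

theorem end_one_apply {Y : Type*} (ρ : Circle →* Function.End Y) (y : Y) : ρ 1 y = y := by
  rw [map_one]; rfl

theorem end_mul_apply {Y : Type*} (ρ : Circle →* Function.End Y) (g h : Circle) (y : Y) :
    ρ (g * h) y = ρ g (ρ h y) := by
  rw [map_mul]; rfl

/-- Over the part of the base where the circle bundle is trivial, the points of `T` have
normalised representatives. -/
theorem IsBorel.exists_slice (hE : IsUniversalCircleBundle E) {ρ : Circle →* Function.End Y}
    {ϖ : E × Y → T} (h : IsBorel ρ ϖ) {U : Set E} (hU : IsOpen U)
    (hUg : ∀ g : Circle, ∀ x ∈ U, g • x ∈ U) {s : E → Circle} (hs : ContinuousOn s U)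
    (hsg : ∀ g : Circle, ∀ x ∈ U, s (g • x) = g * s x) :
    ∃ (W : Set T) (sec : T → E) (κ : T → Y), IsOpen W ∧ ContinuousOn sec W ∧ ContinuousOn κ W ∧
      (∀ e y, ϖ (e, y) ∈ W ↔ e ∈ U) ∧ ∀ e ∈ U, ∀ y, sec (ϖ (e, y)) = (s e)⁻¹ • e ∧
        κ (ϖ (e, y)) = ρ (s e)⁻¹ y := by
  -- An arbitrary choice of representatives. Dividing by `s` makes the result independent of the
  -- choice, and continuity is checked after composition with the quotient map.
  let out : T → E × Y := Function.surjInv h.isOpenQuotientMap.surjective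
  have hout : ∀ e y, ∃ g : Circle, out (ϖ (e, y)) = (g • e, ρ g y) := fun e y =>
    (h.eq_iff (e, y) _).1 (Function.surjInv_eq h.isOpenQuotientMap.surjective _).symm
  have hW : ∀ e y, ϖ (e, y) ∈ ϖ '' (U ×ˢ Set.univ) ↔ e ∈ U := by
    intro e y
    constructor
    · rintro ⟨⟨e', y'⟩, ⟨h1, -⟩, h2⟩
      obtain ⟨g, hg⟩ := (h.eq_iff _ _).1 h2
      obtain rfl : e = g • e' := congrArg Prod.fst hg
      exact hUg g e' h1
    · exact fun he => ⟨(e, y), ⟨he, trivial⟩, rfl⟩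
  have hpre : ϖ ⁻¹' (ϖ '' (U ×ˢ Set.univ)) = U ×ˢ Set.univ := by
    ext ⟨e, y⟩
    rw [Set.mem_preimage, hW]
    simp
  have hopen : IsOpen (ϖ '' (U ×ˢ Set.univ)) :=
    h.isOpenQuotientMap.isOpenMap _ (hU.prod isOpen_univ)
  have hval : ∀ e ∈ U, ∀ y, (s (out (ϖ (e, y))).1)⁻¹ • (out (ϖ (e, y))).1 = (s e)⁻¹ • e ∧
      ρ (s (out (ϖ (e, y))).1)⁻¹ (out (ϖ (e, y))).2 = ρ (s e)⁻¹ y := by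
    intro e he y
    obtain ⟨g, hg⟩ := hout e y
    rw [hg]
    dsimp only
    rw [hsg g e he, mul_inv, smul_smul, ← end_mul_apply]
    have : g⁻¹ * (s e)⁻¹ * g = (s e)⁻¹ := by rw [mul_comm g⁻¹, inv_mul_cancel_right]
    rw [this]
    exact ⟨rfl, rfl⟩
  refine ⟨ϖ '' (U ×ˢ Set.univ), fun t => (s (out t).1)⁻¹ • (out t).1,
    fun t => ρ (s (out t).1)⁻¹ (out t).2, hopen, ?_, ?_, hW, hval⟩
  · rw [h.isOpenQuotientMap.isQuotientMap.continuousOn_isOpen_iff hopen, hpre]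
    have : ContinuousOn (fun a : E × Y => (s a.1)⁻¹ • a.1) (U ×ˢ Set.univ) :=
      hE.continuous_smul.comp_continuousOn
        ((hs.comp continuousOn_fst fun a ha => ha.1).inv.prodMk continuousOn_fst)
    exact this.congr fun a ha => (hval a.1 ha.1 a.2).1
  · rw [h.isOpenQuotientMap.isQuotientMap.continuousOn_isOpen_iff hopen, hpre]
    have : ContinuousOn (fun a : E × Y => ρ (s a.1)⁻¹ a.2) (U ×ˢ Set.univ) :=
      h.continuous_act.comp_continuousOn
        ((hs.comp continuousOn_fst fun a ha => ha.1).inv.prodMk continuousOn_snd)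
    exact this.congr fun a ha => (hval a.1 ha.1 a.2).2

/-- The bundle associated to an equivariant vector bundle `Y → Z` is a vector bundle. -/
theorem locTriv_borel (hE : IsUniversalCircleBundle E) {r : ℕ} {ρY : Circle →* Function.End Y}
    {ρZ : Circle →* Function.End Z} {πT : E × Y → T} {πB : E × Z → B} (hT : IsBorel ρY πT)
    (hB : IsBorel ρZ πB) {pY : C(Y, Z)} (heq : ∀ g y, pY (ρY g y) = ρZ g (pY y)) {p : C(T, B)}
    (hp : ∀ e y, p (πT (e, y)) = πB (e, pY y)) {Y₀ : Set Y} {framesY : Set C(Fin r → ℂ, Y)}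
    (hY : LocTriv r pY Y₀ framesY) {T₀ : Set T} (hT₀ : ∀ e y, πT (e, y) ∈ T₀ ↔ y ∈ Y₀)
    {frames : Set C(Fin r → ℂ, T)}
    (hf : ∀ (e : E), ∀ φ ∈ framesY, ∀ ψ : C(Fin r → ℂ, T), (∀ z, ψ z = πT (e, φ z)) → ψ ∈ frames) :
    LocTriv r p T₀ frames := by
  intro b
  obtain ⟨⟨e₀, z₀⟩, rfl⟩ := hB.isOpenQuotientMap.surjective b
  obtain ⟨U, hU, he₀, hUg, s, hs, hsg⟩ := hE.locally_trivial e₀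
  obtain ⟨WB, secB, κZ, hWB, hsecB, hκZ, hWB', hsB⟩ := hB.exists_slice hE hU hUg hs hsg
  obtain ⟨WT, secT, κY, hWT, hsecT, hκY, hWT', hsT⟩ := hT.exists_slice hE hU hUg hs hsg
  obtain ⟨W, hW, hz₀, Θ, ζ, hΘ, hζ, h1, h2, h3⟩ := hY (ρZ (s e₀)⁻¹ z₀)
  have hone : ∀ e ∈ U, (s e)⁻¹ • e ∈ U ∧ s ((s e)⁻¹ • e) = 1 := fun e he =>
    ⟨hUg _ e he, by rw [hsg _ e he, inv_mul_cancel]⟩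
  have hκΘ : ∀ e ∈ U, ∀ y, κY (πT ((s e)⁻¹ • e, y)) = y := fun e he y => by
    rw [(hsT _ (hone e he).1 y).2, (hone e he).2, inv_one, end_one_apply]
  -- A local trivialisation of Y → Z is transported along the slice e ↦ s(e)⁻¹ • e of the circle
  -- bundle. It is chosen near s(e₀)⁻¹z₀, the normalised representative of the given point.
  refine ⟨WB ∩ κZ ⁻¹' W, hκZ.isOpen_inter_preimage hWB hW, ⟨(hWB' _ _).2 he₀, ?_⟩,
    fun q => πT (secB q.1, Θ (κZ q.1, q.2)), fun t => ζ (κY t), ?_, ?_, ?_, ?_, ?_⟩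
  · rw [Set.mem_preimage, (hsB e₀ he₀ z₀).2]
    exact hz₀
  · refine hT.isOpenQuotientMap.continuous.comp_continuousOn (ContinuousOn.prodMk ?_ ?_)
    · exact hsecB.comp continuousOn_fst fun q hq => hq.1.1
    · exact hΘ.comp ((hκZ.comp continuousOn_fst fun q hq => hq.1.1).prodMk continuousOn_snd)
        fun q hq => ⟨hq.1.2, trivial⟩
  · refine hζ.comp (hκY.mono ?_) ?_
    · intro t ht
      obtain ⟨⟨e, y⟩, rfl⟩ := hT.isOpenQuotientMap.surjective t
      rw [Set.mem_preimage, hp] at ht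
      exact (hWT' _ _).2 ((hWB' _ _).1 ht.1)
    · intro t ht
      obtain ⟨⟨e, y⟩, rfl⟩ := hT.isOpenQuotientMap.surjective t
      rw [Set.mem_preimage, hp] at ht
      have he := (hWB' _ _).1 ht.1
      have ht2 := ht.2
      rw [Set.mem_preimage, (hsB e he _).2] at ht2
      rw [Set.mem_preimage, (hsT e he y).2, heq]
      exact ht2
  · rintro w ⟨hw, hw'⟩ x
    obtain ⟨⟨e, z⟩, rfl⟩ := hB.isOpenQuotientMap.surjective w
    have he := (hWB' _ _).1 hw
    rw [Set.mem_preimage] at hw'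
    obtain ⟨a1, a2, a3⟩ := h1 _ hw' x
    dsimp only
    rw [hp, a1, hT₀, a3, (hsB e he z).1, hκΘ e he, a2, (hsB e he z).2, hB.act_eq]
    exact ⟨rfl, rfl, Iff.rfl⟩
  · intro t ht
    obtain ⟨⟨e, y⟩, rfl⟩ := hT.isOpenQuotientMap.surjective t
    rw [hp] at ht
    have he := (hWB' _ _).1 ht.1
    have ht2 := ht.2
    rw [Set.mem_preimage, (hsB e he _).2, ← heq] at ht2
    dsimp only
    rw [hp, (hsB e he _).1, (hsB e he _).2, (hsT e he y).2, ← heq, h2 _ ht2, hT.act_eq]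
  · rintro w ⟨hw, hw'⟩
    obtain ⟨φ, hφ, hφz⟩ := h3 _ hw'
    refine ⟨⟨fun z => πT (secB w, φ z), hT.isOpenQuotientMap.continuous.comp (by fun_prop)⟩,
      hf (secB w) φ hφ _ fun z => rfl, fun z => ?_⟩
    change πT (secB w, φ z) = _
    rw [hφz]

theorem isBorel_mk (hE : IsUniversalCircleBundle E) (ρ : Circle →* Function.End Y)
    (hρ : Continuous fun q : Circle × Y => ρ q.1 q.2) :
    IsBorel ρ (Quotient.mk (borelSetoid E ρ)) where
  isOpenQuotientMap := by
    refine ⟨Quotient.mk_surjective, continuous_quotient_mk', fun V hV => ?_⟩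
    refine (isQuotientMap_quot_mk (r := (borelSetoid E ρ).r)).isOpen_preimage.1 ?_
    -- The saturation of an open set is the union of its translates.
    have : (Quotient.mk (borelSetoid E ρ) ⁻¹' (Quotient.mk (borelSetoid E ρ) '' V)) =
        ⋃ g : Circle, (fun a : E × Y => (g • a.1, ρ g a.2)) ⁻¹' V := by
      ext a
      simp only [Set.mem_preimage, Set.mem_image, Set.mem_iUnion]
      constructor
      · rintro ⟨b, hb, hab⟩
        obtain ⟨g, hg⟩ := Quotient.exact hab.symm
        exact ⟨g, hg ▸ hb⟩
      · rintro ⟨g, hg⟩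
        exact ⟨_, hg, (Quotient.sound (s := borelSetoid E ρ) ⟨g, rfl⟩).symm⟩
    refine (congrArg IsOpen this).mpr ?_
    refine isOpen_iUnion fun g => hV.preimage (Continuous.prodMk ?_ ?_)
    · exact hE.continuous_smul.comp (continuous_const.prodMk continuous_fst)
    · exact hρ.comp (continuous_const.prodMk continuous_snd)
  eq_iff a b := Quotient.eq (r := borelSetoid E ρ)
  continuous_act := hρ

theorem isOpenQuotientMap_mk_BS (hE : IsUniversalCircleBundle E) :
    IsOpenQuotientMap (fun e : E => (Quotient.mk _ e : BS E)) := by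
  have : ContinuousConstSMul Circle E :=
    ⟨fun g => hE.continuous_smul.comp (continuous_const.prodMk continuous_id)⟩
  exact ⟨Quotient.mk_surjective, continuous_quotient_mk', isOpenMap_quotient_mk'_mul⟩

theorem mk_BS_eq_iff {E : Type*} [MulAction Circle E] (a b : E) : (Quotient.mk _ a : BS E) = Quotient.mk _ b ↔
    ∃ g : Circle, b = g • a := by
  rw [Quotient.eq, MulAction.orbitRel_apply, MulAction.mem_orbit_iff]
  constructor
  · rintro ⟨g, rfl⟩
    exact ⟨g⁻¹, by rw [inv_smul_smul]⟩
  · rintro ⟨g, rfl⟩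
    exact ⟨g⁻¹, by rw [inv_smul_smul]⟩

/-- The base `BS¹ × M`. -/
theorem isBorel_prod (hE : IsUniversalCircleBundle E) (M : Type*) [TopologicalSpace M] :
    IsBorel (1 : Circle →* Function.End M)
      (fun a : E × M => ((Quotient.mk _ a.1 : BS E), a.2)) where
  isOpenQuotientMap := (isOpenQuotientMap_mk_BS hE).prodMap (IsOpenQuotientMap.id)
  eq_iff a b := by
    rw [Prod.mk.injEq, mk_BS_eq_iff, ← exists_and_right]
    refine exists_congr fun g => ?_
    rw [Prod.ext_iff, eq_comm (a := a.2)]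
    rfl
  continuous_act := continuous_snd

/-- The base `BS¹`. -/
theorem isBorel_unit (hE : IsUniversalCircleBundle E) :
    IsBorel (1 : Circle →* Function.End Unit) (fun a : E × Unit => (Quotient.mk _ a.1 : BS E)) where
  isOpenQuotientMap := (isOpenQuotientMap_mk_BS hE).comp
    (Homeomorph.prodUnique E Unit).isOpenQuotientMap
  eq_iff a b := by
    rw [mk_BS_eq_iff]
    refine exists_congr fun g => ?_
    rw [Prod.ext_iff]
    simp
  continuous_act := continuous_snd

end Associated

/-- Products of a vector bundle with a space. -/
theorem LocTriv.prod {T B : Type*} [TopologicalSpace T] [TopologicalSpace B] {r : ℕ} {p : C(T, B)}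
    {T₀ : Set T} {frames : Set C(Fin r → ℂ, T)} (h : LocTriv r p T₀ frames) (M : Type*)
    [TopologicalSpace M] : LocTriv r (p.prodMap (ContinuousMap.id M)) {q | q.1 ∈ T₀}
      {φ | ContinuousMap.fst.comp φ ∈ frames} := by
  rintro ⟨b, x⟩
  obtain ⟨W, hW, hb, Θ, ζ, hΘ, hζ, h1, h2, h3⟩ := h b
  refine ⟨Prod.fst ⁻¹' W, hW.preimage continuous_fst, hb, fun q => (Θ (q.1.1, q.2), q.1.2),
    fun t => ζ t.1, ?_, ?_, ?_, ?_, ?_⟩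
  · exact (hΘ.comp (by fun_prop) fun q hq => ⟨hq.1, trivial⟩).prodMk (by fun_prop)
  · exact hζ.comp continuousOn_fst fun q hq => hq
  · rintro ⟨w, x⟩ hw z
    obtain ⟨a1, a2, a3⟩ := h1 w hw z
    exact ⟨Prod.ext a1 rfl, a2, a3⟩
  · rintro ⟨t, x⟩ ht
    exact Prod.ext (h2 t ht) rfl
  · rintro ⟨w, x⟩ hw
    obtain ⟨φ, hφ, hφz⟩ := h3 w hw
    refine ⟨φ.prodMk (ContinuousMap.const _ x), ?_, fun z => Prod.ext (hφz z) rfl⟩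
    exact hφ

theorem LocTriv.isOpen {T B : Type*} [TopologicalSpace T] [TopologicalSpace B] {r : ℕ} {p : C(T, B)}
    {T₀ : Set T} {frames : Set C(Fin r → ℂ, T)} (h : LocTriv r p T₀ frames) : IsOpen T₀ := by
  rw [isOpen_iff_mem_nhds]
  intro t ht
  obtain ⟨W, hW, hb, Θ, ζ, hΘ, hζ, h1, h2, h3⟩ := h (p t)
  have ho : IsOpen (p ⁻¹' W ∩ ζ ⁻¹' {z | z ≠ 0}) :=
    hζ.isOpen_inter_preimage (hW.preimage p.continuous) isOpen_ne
  have hiff : ∀ t, p t ∈ W → (t ∈ T₀ ↔ ζ t ≠ 0) := fun t ht => by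
    have := (h1 _ ht (ζ t)).2.2
    rwa [h2 t ht] at this
  exact Filter.mem_of_superset (ho.mem_nhds ⟨hb, (hiff t hb).1 ht⟩) fun t' ht' =>
    (hiff t' ht'.1).2 ht'.2

/-! ### The total space of a vector bundle -/

section TotalSpace

variable {M : Type*} [TopologicalSpace M] (F : Type*) [NormedAddCommGroup F] [NormedSpace ℂ F]
  (N : M → Type*) [∀ x, AddCommGroup (N x)] [∀ x, Module ℂ (N x)] [∀ x, TopologicalSpace (N x)]
  [TopologicalSpace (TotalSpace F N)] [FiberBundle F N] [VectorBundle ℂ F N]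

theorem continuous_scale : Continuous fun q : ℂ × TotalSpace F N => scale F N q.1 q.2 := by
  rw [continuous_iff_continuousAt]
  rintro ⟨z, v⟩
  rw [FiberBundle.continuousAt_totalSpace]
  refine ⟨((FiberBundle.continuous_proj F N).comp continuous_snd).continuousAt, ?_⟩
  change ContinuousAt (fun q : ℂ × TotalSpace F N => (trivializationAt F N v.proj
    (scale F N q.1 q.2)).2) (z, v)
  set e := trivializationAt F N v.proj
  have hv : v.proj ∈ e.baseSet := FiberBundle.mem_baseSet_trivializationAt' v.proj
  have h1 : ContinuousAt (fun q : ℂ × TotalSpace F N => q.1 • (e q.2).2) (z, v) := by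
    refine continuousAt_fst.smul ?_
    have h2 : ContinuousAt (fun w : TotalSpace F N => (e w).2) v :=
      (continuous_snd.continuousAt (x := e v)).comp (e.continuousAt ((e.mem_source).2 hv))
    exact ContinuousAt.comp (f := Prod.snd) (x := (z, v)) h2 continuousAt_snd
  refine h1.congr ?_
  have hn : ∀ᶠ q : ℂ × TotalSpace F N in nhds (z, v), q.2.proj ∈ e.baseSet :=
    ((FiberBundle.continuous_proj F N).comp continuous_snd).continuousAt.eventually_mem
      (e.open_baseSet.mem_nhds hv)
  filter_upwards [hn] with q hq
  exact ((e.linear ℂ hq).map_smul q.1 q.2.snd).symm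

theorem continuous_zeroSection : Continuous (zeroSection F N) := by
  rw [continuous_iff_continuousAt]
  intro x
  rw [FiberBundle.continuousAt_totalSpace]
  refine ⟨continuousAt_id, ?_⟩
  change ContinuousAt (fun y => (trivializationAt F N x (zeroSection F N y)).2) x
  have hx : x ∈ (trivializationAt F N x).baseSet := FiberBundle.mem_baseSet_trivializationAt' x
  refine (continuousAt_const (y := (0 : F))).congr ?_
  filter_upwards [(trivializationAt F N x).open_baseSet.mem_nhds hx] with y hy
  exact (((trivializationAt F N x).linear ℂ hy).map_zero).symm

theorem continuous_scalarAction :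
    Continuous fun q : Circle × TotalSpace F N => scalarAction F N q.1 q.2 :=
  (continuous_scale F N).comp
    ((continuous_subtype_val.comp continuous_fst).prodMk continuous_snd)

/-- The projection of the vector bundle. -/
def bundleProj : C(TotalSpace F N, M) := ⟨TotalSpace.proj, FiberBundle.continuous_proj F N⟩

theorem locTriv_totalSpace [FiniteDimensional ℂ F] (r : ℕ) (hr : Module.finrank ℂ F = r) :
    LocTriv r (bundleProj F N) (nonzero F N)
      {φ | ∃ (x : M) (b : (Fin r → ℂ) ≃ₗ[ℂ] N x), ∀ z, φ z = ⟨x, b z⟩} := by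
  intro x
  let L : F ≃L[ℂ] (Fin r → ℂ) := ContinuousLinearEquiv.ofFinrankEq (by simp [hr])
  set e := trivializationAt F N x
  have hx : x ∈ e.baseSet := FiberBundle.mem_baseSet_trivializationAt' x
  have hb : ∀ w, ∀ hw : w ∈ e.baseSet, ∀ z, e.symm w (L.symm z) =
    (L.symm.toLinearEquiv.trans (e.linearEquivAt ℂ w hw).symm) z := fun w hw z => rfl
  have hcont : ContinuousOn (fun q : M × (Fin r → ℂ) =>
      (⟨q.1, e.symm q.1 (L.symm q.2)⟩ : TotalSpace F N)) (e.baseSet ×ˢ Set.univ) :=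
    e.continuousOn_symm.comp (continuousOn_fst.prodMk (L.symm.continuous.comp_continuousOn
      continuousOn_snd)) fun q hq => ⟨hq.1, trivial⟩
  refine ⟨e.baseSet, e.open_baseSet, hx, fun q => ⟨q.1, e.symm q.1 (L.symm q.2)⟩,
    fun v => L (e v).2, hcont, ?_, ?_, ?_, ?_⟩
  · refine L.continuous.comp_continuousOn (continuous_snd.comp_continuousOn ?_)
    exact e.continuousOn.mono fun v hv => e.mem_source.2 hv
  · intro w hw z
    refine ⟨rfl, ?_, ?_⟩
    · dsimp only
      rw [e.apply_mk_symm hw]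
      simp
    · change e.symm w (L.symm z) ≠ 0 ↔ z ≠ 0
      rw [hb w hw, Ne, LinearEquiv.map_eq_zero_iff]
  · intro v hv
    change (⟨v.proj, e.symm v.proj (L.symm (L (e v).2))⟩ : TotalSpace F N) = v
    rw [ContinuousLinearEquiv.symm_apply_apply, e.symm_proj_apply v hv]
  · intro w hw
    refine ⟨⟨fun z => ⟨w, e.symm w (L.symm z)⟩, ?_⟩, ⟨w,
      L.symm.toLinearEquiv.trans (e.linearEquivAt ℂ w hw).symm, fun z => rfl⟩, fun z => rfl⟩
    exact hcont.comp_continuous (continuous_const.prodMk continuous_id) fun z => ⟨hw, trivial⟩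

end TotalSpace

open Cochain

/-! ### Maps between associated bundles -/

section Descent

variable {E : Type*} [TopologicalSpace E] [MulAction Circle E]
  {T B : Type*} [TopologicalSpace T] [TopologicalSpace B]

theorem IsBorel.exists_desc {ρ : Circle →* Function.End Y} {πT : E × Y → T} (h : IsBorel ρ πT)
    {f : E × Y → X} (hf : Continuous f) (hfg : ∀ (g : Circle) e y, f (g • e, ρ g y) = f (e, y)) :
    ∃ φ : C(T, X), ∀ e y, φ (πT (e, y)) = f (e, y) := by
  have hs := h.isOpenQuotientMap.surjective
  have hφ : ∀ e y, f (Function.surjInv hs (πT (e, y))) = f (e, y) := by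
    intro e y
    obtain ⟨g, hg⟩ := (h.eq_iff (e, y) _).1 (Function.surjInv_eq hs (πT (e, y))).symm
    rw [hg, hfg]
  refine ⟨⟨fun t => f (Function.surjInv hs t), ?_⟩, hφ⟩
  rw [h.isOpenQuotientMap.isQuotientMap.continuous_iff]
  exact hf.congr fun a => (hφ a.1 a.2).symm

theorem IsBorel.exists_map {ρY : Circle →* Function.End Y} {ρZ : Circle →* Function.End Z}
    {πT : E × Y → T} {πB : E × Z → B} (hT : IsBorel ρY πT) (hB : IsBorel ρZ πB) {f : Y → Z}
    (hf : Continuous f) (heq : ∀ g y, f (ρY g y) = ρZ g (f y)) :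
    ∃ φ : C(T, B), ∀ e y, φ (πT (e, y)) = πB (e, f y) :=
  hT.exists_desc (f := fun a => πB (a.1, f a.2))
    (hB.isOpenQuotientMap.continuous.comp (continuous_fst.prodMk (hf.comp continuous_snd)))
    fun g e y => by dsimp only; rw [heq, hB.act_eq]

/-- The restriction of an action to an invariant subset. -/
def restrictAction {Y : Type*} (ρ : Circle →* Function.End Y) (Y₀ : Set Y)
    (h : ∀ g, ∀ y ∈ Y₀, ρ g y ∈ Y₀) : Circle →* Function.End Y₀ where
  toFun g := fun y => ⟨ρ g y, h g y y.2⟩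
  map_one' := funext fun y => Subtype.ext (end_one_apply ρ y)
  map_mul' g g' := funext fun y => Subtype.ext (end_mul_apply ρ g g' y)

/-- The product of two actions. -/
def prodAction {Y Z : Type*} (ρ : Circle →* Function.End Y) (ρ' : Circle →* Function.End Z) :
    Circle →* Function.End (Y × Z) where
  toFun g := Prod.map (ρ g) (ρ' g)
  map_one' := funext fun y => Prod.ext (end_one_apply ρ y.1) (end_one_apply ρ' y.2)
  map_mul' g g' := funext fun y =>
    Prod.ext (end_mul_apply ρ g g' y.1) (end_mul_apply ρ' g g' y.2)

theorem IsBorel.restrict {ρ : Circle →* Function.End Y} {πT : E × Y → T} (h : IsBorel ρ πT)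
    {Y₀ : Set Y} (hY₀ : IsOpen Y₀) {T₀ : Set T} (hT₀ : ∀ e y, πT (e, y) ∈ T₀ ↔ y ∈ Y₀)
    (hg : ∀ g, ∀ y ∈ Y₀, ρ g y ∈ Y₀) : IsBorel (restrictAction ρ Y₀ hg)
      (fun a : E × Y₀ => (⟨πT (a.1, a.2), (hT₀ _ _).2 a.2.2⟩ : T₀)) where
  isOpenQuotientMap := by
    have hcont : Continuous fun a : E × Y₀ => πT (a.1, a.2) :=
      h.isOpenQuotientMap.continuous.comp
        (continuous_fst.prodMk (continuous_subtype_val.comp continuous_snd))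
    refine ⟨?_, hcont.subtype_mk _, ?_⟩
    · rintro ⟨t, ht⟩
      obtain ⟨⟨e, y⟩, rfl⟩ := h.isOpenQuotientMap.surjective t
      exact ⟨(e, ⟨y, (hT₀ _ _).1 ht⟩), rfl⟩
    · intro V hV
      have h1 : IsOpen ((fun a : E × Y₀ => πT (a.1, a.2)) '' V) := by
        have : IsOpenMap fun a : E × Y₀ => (a.1, (a.2 : Y)) :=
          IsOpenMap.id.prodMap hY₀.isOpenMap_subtype_val
        have := h.isOpenQuotientMap.isOpenMap _ (this V hV)
        rwa [Set.image_image] at this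
      have h2 := h1.preimage (continuous_subtype_val : Continuous (Subtype.val : T₀ → T))
      convert h2 using 1
      ext t
      constructor
      · rintro ⟨a, ha, rfl⟩
        exact ⟨a, ha, rfl⟩
      · rintro ⟨a, ha, hat⟩
        exact ⟨a, ha, Subtype.ext hat⟩
  eq_iff a b := by
    rw [Subtype.mk_eq_mk, h.eq_iff]
    refine exists_congr fun g => ?_
    rw [Prod.ext_iff, Prod.ext_iff, Subtype.ext_iff]
    rfl
  continuous_act := Continuous.subtype_mk (h.continuous_act.comp
    (continuous_fst.prodMk (continuous_subtype_val.comp continuous_snd))) _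

theorem mk_mem_borelSet_iff {E : Type*} [MulAction Circle E] {Y : Type*} {ρ : Circle →* Function.End Y} {Y₀ : Set Y}
    (hg : ∀ g, ∀ y ∈ Y₀, ρ g y ∈ Y₀) (e : E) (y : Y) :
    (Quotient.mk (borelSetoid E ρ) (e, y)) ∈
      {t : Borel E ρ | ∃ (e : E) (y : Y), y ∈ Y₀ ∧ t = Quotient.mk _ (e, y)} ↔ y ∈ Y₀ := by
  constructor
  · rintro ⟨e', y', hy', h⟩
    obtain ⟨g, hg'⟩ := Quotient.exact h.symm
    have : y = ρ g y' := congrArg Prod.snd hg'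
    rw [this]
    exact hg g y' hy'
  · exact fun hy => ⟨e, y, hy, rfl⟩

end Descent

/-! ### Euler classes -/

section Euler

variable {T B : Type*} [TopologicalSpace T] [TopologicalSpace B] {r : ℕ} {p : C(T, B)}
  {T₀ : Set T} {frames : Set C(Fin r → ℂ, T)}

theorem IsEulerClass.exists_cocycle {e : Coh B} (he : IsEulerClass r p T₀ frames e) :
    ∃ f : cocycles T, IsThomCocycle r T₀ frames (f : Cochain T) ∧ Coh.map p e = Coh.mk f := by
  obtain ⟨u, hu, h⟩ := he
  obtain ⟨f, rfl, hf⟩ := hu.exists_cocycle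
  exact ⟨⟨f, hf.d_eq⟩, hf, h⟩

theorem Coh.map_injective_of_section {s : C(B, T)} (h : p.comp s = ContinuousMap.id B) :
    Function.Injective (Coh.map p) := fun a b hab => by
  have := congrArg (Coh.map s) hab
  rwa [← Coh.map_comp, ← Coh.map_comp, h, Coh.map_id, Coh.map_id] at this

/-- Cohomologous Thom cocycles. -/
theorem LocTriv.mk_eq_mk (hp : LocTriv r p T₀ frames) {u v : cocycles T}
    (hu : IsThomCocycle r T₀ frames (u : Cochain T))
    (hv : IsThomCocycle r T₀ frames (v : Cochain T)) : Coh.mk u = Coh.mk v := by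
  obtain ⟨g, -, hg⟩ := hp.unique hv hu
  exact Coh.mk_eq_iff.2 ⟨g, by rw [hg]; abel⟩

end Euler

/-! ### The universal line bundle -/

section Line

variable (E : Type*) [TopologicalSpace E] [MulAction Circle E]

/-- The complement of the zero section of the associated line bundle. -/
def lineNonzero (E : Type*) [MulAction Circle E] : Set (Borel E assocAction) :=
  {t | ∃ (e : E) (z : ℂ), z ≠ 0 ∧ t = Quotient.mk _ (e, z)}

/-- The isomorphisms from `ℂ` to the fibres of the associated line bundle. -/
def lineFrames : Set C(Fin 1 → ℂ, Borel E assocAction) :=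
  {φ | ∃ (e : E) (w : ℂ), w ≠ 0 ∧ ∀ z, φ z = Quotient.mk _ (e, z 0 * w)}

theorem continuous_assocAction : Continuous fun q : Circle × ℂ => assocAction q.1 q.2 := by
  change Continuous fun q : Circle × ℂ => ((q.1⁻¹ : Circle) : ℂ) * q.2
  have h : Continuous fun q : Circle × ℂ => (q.1⁻¹ : Circle) := continuous_inv.comp continuous_fst
  exact (continuous_subtype_val.comp h).mul continuous_snd

theorem assocAction_ne_zero (g : Circle) (z : ℂ) (hz : z ≠ 0) : assocAction g z ≠ 0 :=
  mul_ne_zero (Circle.coe_ne_zero _) hz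

variable {E}

theorem isBorel_line (hE : IsUniversalCircleBundle E) :
    IsBorel assocAction (Quotient.mk (borelSetoid E assocAction)) :=
  isBorel_mk hE _ continuous_assocAction

theorem mk_mem_lineNonzero_iff {E : Type*} [MulAction Circle E] (e : E) (z : ℂ) :
    Quotient.mk (borelSetoid E assocAction) (e, z) ∈ lineNonzero E ↔ z ≠ 0 :=
  mk_mem_borelSet_iff (Y₀ := {z | z ≠ 0}) (fun g z hz => assocAction_ne_zero g z hz) e z

theorem locTriv_line (hE : IsUniversalCircleBundle E) :
    LocTriv 1 (borelProj E assocAction) (lineNonzero E) (lineFrames E) := by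
  refine locTriv_borel hE (isBorel_line hE) (isBorel_unit hE) (pY := ContinuousMap.const _ ())
    (fun _ _ => rfl) (fun _ _ => rfl) (Y₀ := {z | z ≠ 0}) (framesY := {φ | ∀ z, φ z = z 0}) ?_
    mk_mem_lineNonzero_iff ?_
  · intro b
    refine ⟨Set.univ, isOpen_univ, trivial, fun q => q.2 0, fun z _ => z,
      Continuous.continuousOn (by fun_prop), Continuous.continuousOn (by fun_prop),
      fun w _ z => ⟨rfl, ?_, ?_⟩, fun t _ => rfl, fun w _ => ⟨⟨fun z => z 0, by fun_prop⟩,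
        fun z => rfl, fun z => rfl⟩⟩
    · funext i
      rw [Subsingleton.elim i 0]
    · change z 0 ≠ 0 ↔ z ≠ 0
      refine not_congr ⟨fun h => funext fun i => ?_, fun h => by rw [h]; rfl⟩
      rw [Subsingleton.elim i 0, h]
      rfl
  · rintro e φ hφ ψ hψ
    exact ⟨e, 1, one_ne_zero, fun z => by rw [hψ, hφ, mul_one]⟩

theorem exists_line_zeroSection (hE : IsUniversalCircleBundle E) :
    ∃ s : C(BS E, Borel E assocAction), (borelProj E assocAction).comp s = ContinuousMap.id _ := by
  obtain ⟨s, hs⟩ := (isBorel_unit hE).exists_map (isBorel_line hE) (f := fun _ => (0 : ℂ))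
    continuous_const (fun g _ => (mul_zero _).symm)
  refine ⟨s, ContinuousMap.ext fun b => ?_⟩
  obtain ⟨e, rfl⟩ := Quotient.mk_surjective b
  exact congrArg (borelProj E assocAction) (hs e ())

theorem IsUniversalChernClass.exists_cocycle {c : Coh (BS E)} (hc : IsUniversalChernClass E c) :
    ∃ f : cocycles (Borel E assocAction), IsThomCocycle 1 (lineNonzero E) (lineFrames E)
      (f : Cochain (Borel E assocAction)) ∧ Coh.map (borelProj E assocAction) c = Coh.mk f :=
  IsEulerClass.exists_cocycle hc

/-- The Euler class is specified only through its pull-back to the line bundle; the zero section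
recovers the class, and with it the degree. -/
theorem IsUniversalChernClass.inDegree (hE : IsUniversalCircleBundle E) {c : Coh (BS E)}
    (hc : IsUniversalChernClass E c) : Coh.InDegree 2 c := by
  obtain ⟨f, hf, h⟩ := hc.exists_cocycle
  obtain ⟨s, hs⟩ := exists_line_zeroSection hE
  have : c = Coh.map s (Coh.mk f) := by rw [← h, ← Coh.map_comp, hs, Coh.map_id]
  rw [this]
  exact Coh.InDegree.map ⟨f, rfl, hf.supp⟩ s

/-- The complement of the zero section of the universal line bundle is contractible. -/
theorem exists_contraction_lineNonzero (hE : IsUniversalCircleBundle E) :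
    ∃ (t₀ : lineNonzero E) (H : C(lineNonzero E × unitInterval, lineNonzero E)),
      (∀ t, H (t, 1) = t) ∧ ∀ t, H (t, 0) = t₀ := by
  have hL := (isBorel_line hE).restrict (Y₀ := {z : ℂ | z ≠ 0}) isOpen_ne (T₀ := lineNonzero E)
    mk_mem_lineNonzero_iff assocAction_ne_zero
  have hunit : ∀ z : {z : ℂ | z ≠ 0}, (z : ℂ) / ‖(z : ℂ)‖ ∈ Submonoid.unitSphere ℂ := by
    intro z
    refine mem_sphere_zero_iff_norm.2 ?_
    rw [norm_div, Complex.norm_real, norm_norm,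
      div_self (norm_ne_zero_iff.2 z.2)]
  -- The complement of the zero section is E × ℝ_{>0}: the point [e, z] corresponds to ((z/|z|) • e,
  -- |z|), which is well defined because the circle acts on ℂ through the inverse. The contraction
  -- moves the first component by a contraction of E and the second linearly to 1.
  let dir : {z : ℂ | z ≠ 0} → Circle := fun z => ⟨(z : ℂ) / ‖(z : ℂ)‖, hunit z⟩
  have hdir : Continuous dir := by
    refine Continuous.subtype_mk ?_ _
    refine continuous_subtype_val.div (Complex.continuous_ofReal.comp
      (continuous_norm.comp continuous_subtype_val)) fun z => ?_
    rw [Complex.ofReal_ne_zero]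
    exact norm_ne_zero_iff.2 z.2
  have hnorm : ∀ (g : Circle) (z : ℂ), ‖assocAction g z‖ = ‖z‖ := fun g z => by
    change ‖((g⁻¹ : Circle) : ℂ) * z‖ = ‖z‖
    rw [norm_mul, Circle.norm_coe, one_mul]
  have hdirg : ∀ (g : Circle) (z : {z : ℂ | z ≠ 0}),
      dir (restrictAction assocAction {z : ℂ | z ≠ 0} assocAction_ne_zero g z) = g⁻¹ * dir z := by
    intro g z
    refine Circle.ext ?_
    change (((g⁻¹ : Circle) : ℂ) * z) / ‖assocAction g z‖ = ((g⁻¹ : Circle) : ℂ) * (z / ‖(z : ℂ)‖)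
    rw [hnorm, mul_div_assoc]
  obtain ⟨Φ, hΦ⟩ := hL.exists_desc (f := fun a => dir a.2 • a.1)
    (hE.continuous_smul.comp ((hdir.comp continuous_snd).prodMk continuous_fst))
    (fun g e z => by
      dsimp only
      rw [hdirg, smul_smul, mul_comm g⁻¹, inv_mul_cancel_right])
  obtain ⟨ν, hν⟩ := hL.exists_desc (f := fun a => ‖(a.2 : ℂ)‖)
    (continuous_norm.comp (continuous_subtype_val.comp continuous_snd)) (fun g e z => hnorm g z)
  have hνpos : ∀ t, 0 < ν t := by
    intro t
    obtain ⟨⟨e, z⟩, rfl⟩ := hL.isOpenQuotientMap.surjective t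
    rw [hν]
    exact norm_pos_iff.2 z.2
  have := hE.contractible
  obtain ⟨e₀, ⟨h⟩⟩ := id_nullhomotopic E
  have hpos : ∀ q : lineNonzero E × unitInterval,
      0 < (q.2 : ℝ) * ν q.1 + (1 - (q.2 : ℝ)) := by
    intro q
    have h0 := q.2.2.1
    have h1 := q.2.2.2
    rcases h0.eq_or_lt with h' | h'
    · rw [← h']; simp
    · have := mul_pos h' (hνpos q.1); linarith
  have hne : ∀ q : lineNonzero E × unitInterval,
      (((q.2 : ℝ) * ν q.1 + (1 - (q.2 : ℝ)) : ℝ) : ℂ) ∈ {z : ℂ | z ≠ 0} := fun q =>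
    Complex.ofReal_ne_zero.2 (hpos q).ne'
  let H : C(lineNonzero E × unitInterval, lineNonzero E) :=
    ⟨fun q => ⟨Quotient.mk (borelSetoid E assocAction) (h (unitInterval.symm q.2, Φ q.1),
      (((q.2 : ℝ) * ν q.1 + (1 - (q.2 : ℝ)) : ℝ) : ℂ)), (mk_mem_lineNonzero_iff _ _).2 (hne q)⟩, by
        refine Continuous.subtype_mk (continuous_quotient_mk'.comp (Continuous.prodMk ?_ ?_)) _
        · exact h.continuous.comp (by fun_prop)
        · exact Complex.continuous_ofReal.comp (by fun_prop)⟩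
  refine ⟨⟨Quotient.mk (borelSetoid E assocAction) (e₀, 1),
    (mk_mem_lineNonzero_iff _ _).2 one_ne_zero⟩, H, fun t => ?_, fun t => ?_⟩
  · obtain ⟨⟨e, z⟩, rfl⟩ := hL.isOpenQuotientMap.surjective t
    refine Subtype.ext ?_
    change Quotient.mk (borelSetoid E assocAction) (h (unitInterval.symm 1, Φ _), _) =
      Quotient.mk (borelSetoid E assocAction) (e, (z : ℂ))
    rw [hΦ, hν, unitInterval.symm_one, h.apply_zero]
    refine Quotient.sound (s := borelSetoid E assocAction) ((borelSetoid E assocAction).symm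
      ⟨dir z, Prod.ext rfl ?_⟩)
    change ((1 * ‖(z : ℂ)‖ + (1 - 1) : ℝ) : ℂ) = (((dir z)⁻¹ : Circle) : ℂ) * z
    have hz : ((‖(z : ℂ)‖ : ℝ) : ℂ) ≠ 0 := Complex.ofReal_ne_zero.2 (norm_ne_zero_iff.2 z.2)
    rw [Circle.coe_inv]
    change _ = ((z : ℂ) / ‖(z : ℂ)‖)⁻¹ * z
    have hz' : (z : ℂ) ≠ 0 := z.2
    push_cast
    field_simp
    ring
  · refine Subtype.ext ?_
    change Quotient.mk (borelSetoid E assocAction) (h (unitInterval.symm 0, Φ t), _) = _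
    rw [unitInterval.symm_zero, h.apply_one]
    congr 2
    change ((0 * ν t + (1 - 0) : ℝ) : ℂ) = 1
    simp

/-- Multiplication by the universal first Chern class is injective. -/
theorem eq_zero_of_chern_mul (hE : IsUniversalCircleBundle E) {c : Coh (BS E)}
    (hc : IsUniversalChernClass E c) {M : Type*} [TopologicalSpace M] {y : Coh (BS E × M)}
    (h : Coh.map ContinuousMap.fst c * y = 0) : y = 0 := by
  obtain ⟨u, hu, huc⟩ := hc.exists_cocycle
  obtain ⟨t₀, H, hH1, hH0⟩ := exists_contraction_lineNonzero hE
  have hT := (locTriv_line hE).prod M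
  have hû : IsThomCocycle 1 {q : Borel E assocAction × M | q.1 ∈ lineNonzero E}
      {φ | ContinuousMap.fst.comp φ ∈ lineFrames E}
      (pullback ContinuousMap.fst (u : Cochain (Borel E assocAction))) :=
    hu.pullback _ (fun t ht => ht) (fun ψ hψ => hψ)
  have hiso := hT.isThomIso hû
  obtain ⟨f, rfl⟩ := Coh.mk_surjective y
  set p := (borelProj E assocAction).prodMap (ContinuousMap.id M) with hp
  have h1 : Coh.mk (cocyclesPullback ContinuousMap.fst u * cocyclesPullback p f) = 0 := by
    have h2 := congrArg (Coh.map p) h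
    rw [RingHom.map_mul, RingHom.map_zero, ← Coh.map_comp, Coh.map_mk] at h2
    rw [RingHom.map_mul, ← h2]
    congr 1
    rw [← Coh.map_mk, ← huc, ← Coh.map_comp]
    rfl
  -- The Gysin argument. Off the zero section `u` vanishes, so `g` is a cocycle there; that
  -- complement is homotopy equivalent to M, so up to a coboundary `g` is the pull-back of a cocycle
  -- `b` on M, which is defined on the whole total space. Subtracting both yields a relative
  -- primitive of `u * y`, and the Thom isomorphism gives y = 0.
  obtain ⟨g, hg⟩ := Coh.mk_eq_zero_iff.1 h1
  replace hg : g.d = pullback ContinuousMap.fst (u : Cochain (Borel E assocAction)) *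
    pullback p (f : Cochain (BS E × M)) := hg
  let j : C(lineNonzero E × M, Borel E assocAction × M) :=
    (⟨Subtype.val, continuous_subtype_val⟩ : C(lineNonzero E, Borel E assocAction)).prodMap
      (ContinuousMap.id M)
  have hj : Topology.IsEmbedding j := Topology.IsEmbedding.subtypeVal.prodMap .id
  have hjr : Set.range j = {q : Borel E assocAction × M | q.1 ∈ lineNonzero E} := by
    ext ⟨t, x⟩
    exact ⟨by rintro ⟨⟨t', x'⟩, h⟩; rw [← h]; exact t'.2, fun ht => ⟨(⟨t, ht⟩, x), rfl⟩⟩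
  have hjd : (pullback j g).d = 0 := by
    rw [d_pullback, hg]
    refine vanOn_univ ((hû.vanOn.mul_right _).pullback j fun q _ => ?_)
    exact q.1.2
  obtain ⟨K, hK, -⟩ := exists_homotopy
    (⟨fun q => (H (q.1.1, q.2), q.1.2), by fun_prop⟩ :
      C((lineNonzero E × M) × unitInterval, lineNonzero E × M)) (pullback j g) hjd
  let i : C(M, lineNonzero E × M) := (ContinuousMap.const M t₀).prodMk (ContinuousMap.id M)
  have e1 : (⟨fun q => (H (q.1.1, q.2), q.1.2), by fun_prop⟩ :
      C((lineNonzero E × M) × unitInterval, lineNonzero E × M)).comp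
        ((ContinuousMap.id _).prodMk (ContinuousMap.const _ 1)) = ContinuousMap.id _ :=
    ContinuousMap.ext fun q => Prod.ext (hH1 q.1) rfl
  have e0 : (⟨fun q => (H (q.1.1, q.2), q.1.2), by fun_prop⟩ :
      C((lineNonzero E × M) × unitInterval, lineNonzero E × M)).comp
        ((ContinuousMap.id _).prodMk (ContinuousMap.const _ 0)) =
          i.comp (ContinuousMap.snd.comp j) :=
    ContinuousMap.ext fun q => Prod.ext (hH0 q.1) rfl
  rw [e1, e0, pullback_id, pullback_comp, pullback_comp] at hK
  obtain ⟨K', hK', -⟩ := exists_extend j hj K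
  set b := pullback i (pullback j g) with hb
  have hbd : b.d = 0 := by rw [hb, d_pullback, hjd, pullback_zero]
  obtain ⟨k, hk⟩ := hiso.inj (f : Cochain (BS E × M)) f.2
    (g - K'.d - pullback ContinuousMap.snd b) (by
      rw [← hjr]
      refine eqOn_range_of_pullback_eq hj (g := 0) ?_
      rw [pullback_sub, pullback_sub, ← d_pullback, hK', hK, pullback_zero]
      abel)
    (by rw [d_sub, d_sub, d_d, d_pullback, hbd, pullback_zero, sub_zero, sub_zero, hg])
  exact Coh.mk_eq_zero_iff.2 ⟨k, hk⟩

end Line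

open Cochain

/-! ### Sums of copies of the dual of the universal line bundle -/

section Pi

/-- The action of the circle on `ℂ^r` by scalar multiplication. -/
def piAction (r : ℕ) : Circle →* Function.End (Fin r → ℂ) where
  toFun g := fun z => (g : ℂ) • z
  map_one' := by
    funext z
    change ((1 : Circle) : ℂ) • z = z
    rw [Circle.coe_one, one_smul]
  map_mul' g h := by
    funext z
    change ((g * h : Circle) : ℂ) • z = (g : ℂ) • (h : ℂ) • z
    rw [Circle.coe_mul, mul_smul]

theorem continuous_piAction (r : ℕ) :
    Continuous fun q : Circle × (Fin r → ℂ) => piAction r q.1 q.2 :=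
  (continuous_subtype_val.comp continuous_fst).smul continuous_snd

theorem piAction_ne_zero {r : ℕ} (g : Circle) (z : Fin r → ℂ) (hz : z ≠ 0) :
    piAction r g z ≠ 0 :=
  smul_ne_zero (Circle.coe_ne_zero g) hz

variable (E : Type*) [MulAction Circle E]

/-- The complement of the zero section of `E ×_{S¹} ℂ^r`. -/
def piNonzero (r : ℕ) : Set (Borel E (piAction r)) :=
  {t | ∃ (e : E) (z : Fin r → ℂ), z ∈ {z : Fin r → ℂ | z ≠ 0} ∧ t = Quotient.mk _ (e, z)}

theorem mk_mem_piNonzero_iff {r : ℕ} (e : E) (z : Fin r → ℂ) :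
    Quotient.mk (borelSetoid E (piAction r)) (e, z) ∈ piNonzero E r ↔ z ≠ 0 :=
  mk_mem_borelSet_iff (Y₀ := {z | z ≠ 0}) (fun g z hz => piAction_ne_zero g z hz) e z

variable [TopologicalSpace E]

/-- The tautological isomorphisms from `ℂ^r` to the fibres of `E ×_{S¹} ℂ^r`. -/
def piFrames (r : ℕ) : Set C(Fin r → ℂ, Borel E (piAction r)) :=
  {φ | ∃ e : E, ∀ z, φ z = Quotient.mk _ (e, z)}

variable {E}

/-- The isomorphism from `ℂ^r` to a fibre given by a point of `E`. -/
def piFrame (r : ℕ) (e : E) : C(Fin r → ℂ, Borel E (piAction r)) :=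
  ⟨fun z => Quotient.mk _ (e, z), continuous_quotient_mk'.comp (by fun_prop)⟩

theorem isBorel_pi (hE : IsUniversalCircleBundle E) (r : ℕ) :
    IsBorel (piAction r) (Quotient.mk (borelSetoid E (piAction r))) :=
  isBorel_mk hE _ (continuous_piAction r)

theorem locTriv_pi (hE : IsUniversalCircleBundle E) (r : ℕ) :
    LocTriv r (borelProj E (piAction r)) (piNonzero E r) (piFrames E r) := by
  refine locTriv_borel hE (isBorel_pi hE r) (isBorel_unit hE) (pY := ContinuousMap.const _ ())
    (fun _ _ => rfl) (fun _ _ => rfl) (locTriv_unit r) (mk_mem_piNonzero_iff E) ?_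
  rintro e _ rfl ψ hψ
  exact ⟨e, hψ⟩

/-- With the scalar action, E ×_{S¹} ℂ is the dual of the universal line bundle. Conjugation maps it
to the universal line bundle and reverses the orientation of the fibres, whence the sign. -/
theorem exists_thomCocycle_pi_one (hE : IsUniversalCircleBundle E) {c : Coh (BS E)}
    (hc : IsUniversalChernClass E c) : ∃ U : cocycles (Borel E (piAction 1)),
      IsThomCocycle 1 (piNonzero E 1) (piFrames E 1) (U : Cochain (Borel E (piAction 1))) ∧
        Coh.mk U = - Coh.map (borelProj E (piAction 1)) c := by
  obtain ⟨u, hu, huc⟩ := hc.exists_cocycle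
  obtain ⟨cj, hcj⟩ := (isBorel_pi hE 1).exists_map (isBorel_line hE)
    (f := fun z => (starRingEnd ℂ) (z 0)) (by fun_prop) (fun g z => by
      change (starRingEnd ℂ) ((g : ℂ) * z 0) = ((g⁻¹ : Circle) : ℂ) * (starRingEnd ℂ) (z 0)
      rw [map_mul, Circle.coe_inv_eq_conj])
  refine ⟨-cocyclesPullback cj u, ⟨?_, (-cocyclesPullback cj u).2, ?_, ?_⟩, ?_⟩
  · intro σ h
    change - (u : Cochain (Borel E assocAction)) _ = 0
    rw [hu.supp (σ.push cj) h, neg_zero]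
  · refine VanOn.neg (hu.vanOn.pullback cj fun t ht => ?_)
    obtain ⟨⟨e, z⟩, rfl⟩ := Quotient.mk_surjective t
    rw [hcj]
    refine (mk_mem_lineNonzero_iff _ _).2 ?_
    have hz := (mk_mem_piNonzero_iff E e z).1 ht
    intro h0
    refine hz (funext fun i => ?_)
    rw [Subsingleton.elim i 0]
    exact (map_eq_zero _).1 h0
  · rintro φ ⟨e, hφ⟩
    -- The factor -i cancels the i of `swapMap`, so that `φ'` after `swapMap` is the conjugate of
    -- `φ`.
    let φ' : C(Fin 1 → ℂ, Borel E assocAction) :=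
      ⟨fun z => Quotient.mk _ (e, z 0 * (-Complex.I)), continuous_quotient_mk'.comp (by fun_prop)⟩
    have hφ' : φ' ∈ lineFrames E := ⟨e, -Complex.I, neg_ne_zero.2 Complex.I_ne_zero, fun z => rfl⟩
    have h1 := swap_value (f := pullback φ' (u : Cochain (Borel E assocAction)))
      (by rw [d_pullback, hu.d_eq, pullback_zero]) (hu.vanOn.pullback φ' fun z hz => by
        refine (mk_mem_lineNonzero_iff _ _).2 (mul_ne_zero (fun h0 => hz (funext fun i => ?_))
          (neg_ne_zero.2 Complex.I_ne_zero))
        rw [Subsingleton.elim i 0]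
        exact h0)
    have h2 : cj.comp φ = φ'.comp swapMap := by
      ext z
      change cj (φ z) = Quotient.mk _ (e, Complex.I * (starRingEnd ℂ) (z 0) * (-Complex.I))
      rw [hφ, hcj]
      congr 2
      linear_combination ((starRingEnd ℂ) (z 0)) * Complex.I_mul_I
    have h3 := hu.value φ' hφ'
    change - (u : Cochain (Borel E assocAction)) ⟨2, (cj.comp φ).comp (orientedSimp 1)⟩ = 1
    rw [h2]
    change (u : Cochain (Borel E assocAction)) ⟨2, (φ'.comp swapMap).comp (orientedSimp 1)⟩ =
      - (u : Cochain (Borel E assocAction)) ⟨2, φ'.comp (orientedSimp 1)⟩ at h1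
    rw [h1, neg_neg]
    exact h3
  · rw [RingHom.map_neg, ← Coh.map_mk, ← huc, ← Coh.map_comp]
    congr 2
    congr 1
    ext t
    obtain ⟨⟨e, z⟩, rfl⟩ := Quotient.mk_surjective t
    change borelProj E assocAction (cj _) = _
    rw [hcj]
    rfl

/-- The Thom class of the sum of `r` copies of the dual of the universal line bundle restricts to
`(-c)^r`. -/
theorem exists_thomCocycle_pi (hE : IsUniversalCircleBundle E) {c : Coh (BS E)}
    (hc : IsUniversalChernClass E c) (r : ℕ) : ∃ U : cocycles (Borel E (piAction r)),
      IsThomCocycle r (piNonzero E r) (piFrames E r) (U : Cochain (Borel E (piAction r))) ∧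
        Coh.mk U = (- Coh.map (borelProj E (piAction r)) c) ^ r := by
  induction r with
  | zero =>
    refine ⟨1, ⟨supp_one, d_one, fun σ hσ => ?_, fun φ _ => rfl⟩, by
      rw [pow_zero]; exact RingHom.map_one _⟩
    obtain ⟨e, z, hz, -⟩ := hσ ⟨vert σ.1 0, rfl⟩
    exact (hz (Subsingleton.elim _ _)).elim
  | succ r ih =>
    obtain ⟨V, hV, hVc⟩ := ih
    obtain ⟨U₁, hU₁, hU₁c⟩ := exists_thomCocycle_pi_one hE hc
    obtain ⟨head, hhead⟩ := (isBorel_pi hE (r + 1)).exists_map (isBorel_pi hE 1)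
      (f := fun z _ => z 0) (by fun_prop) (fun g z => rfl)
    obtain ⟨tail, htail⟩ := (isBorel_pi hE (r + 1)).exists_map (isBorel_pi hE r)
      (f := fun z => Fin.tail z) (by unfold Fin.tail; fun_prop) (fun g z => rfl)
    -- The product vanishes where the head is nonzero and where the tail is nonzero, but not on
    -- simplices that lie in neither open set. Excision corrects it to a relative cocycle for their
    -- union.
    set f : cocycles (Borel E (piAction (r + 1))) :=
      cocyclesPullback head U₁ * cocyclesPullback tail V with hf
    have hfs : Supp (2 * (r + 1)) (f : Cochain (Borel E (piAction (r + 1)))) := by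
      have := (hU₁.supp.pullback head).mul (hV.supp.pullback tail)
      rwa [show 2 * 1 + 2 * r = 2 * (r + 1) by omega] at this
    have hfU : VanOn (head ⁻¹' piNonzero E 1) (f : Cochain (Borel E (piAction (r + 1)))) :=
      (hU₁.vanOn.pullback head fun t ht => ht).mul_right _
    have hfV : VanOn (tail ⁻¹' piNonzero E r) (f : Cochain (Borel E (piAction (r + 1)))) :=
      (hV.vanOn.pullback tail fun t ht => ht).mul_left _
    obtain ⟨h, hh, hhC⟩ := exists_correction ((locTriv_pi hE 1).isOpen.preimage head.continuous)
      ((locTriv_pi hE r).isOpen.preimage tail.continuous) hfU hfV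
      (fun σ _ => by rw [cocycles_d]; rfl)
    have hsub : ∀ t ∈ piNonzero E (r + 1), t ∈ head ⁻¹' piNonzero E 1 ∪ tail ⁻¹' piNonzero E r := by
      intro t ht
      obtain ⟨⟨e, z⟩, rfl⟩ := Quotient.mk_surjective t
      rw [mk_mem_piNonzero_iff] at ht
      by_contra hcon
      rw [Set.mem_union, Set.mem_preimage, Set.mem_preimage, hhead, htail, mk_mem_piNonzero_iff,
        mk_mem_piNonzero_iff, not_or, not_not, not_not] at hcon
      refine ht (funext fun i => ?_)
      refine Fin.cases ?_ (fun i => ?_) i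
      · exact congrFun hcon.1 0
      · exact congrFun hcon.2 i
    have hUe : comp (2 * (r + 1)) ((f : Cochain (Borel E (piAction (r + 1)))) - h.d) =
        (f : Cochain (Borel E (piAction (r + 1)))) - (comp (2 * r + 1) h).d := by
      rw [comp_sub, hfs.comp_eq, ← comp_succ_d]
      rfl
    set U : Cochain (Borel E (piAction (r + 1))) := f - (comp (2 * r + 1) h).d with hU
    have hUd : U.d = 0 := by rw [hU, d_sub, d_d, cocycles_d, sub_zero]
    have hUs : Supp (2 * (r + 1)) U := by rw [← hUe]; exact supp_comp _ _
    have hUT : VanOn (piNonzero E (r + 1)) U := by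
      rw [← hUe]
      exact (hh.mono hsub).comp _
    refine ⟨⟨U, hUd⟩, ⟨hUs, hUd, hUT, ?_⟩, ?_⟩
    · rintro φ ⟨e, hφ⟩
      have hφ0 : ∀ z : Fin (r + 1) → ℂ, z ≠ 0 → φ z ∈ piNonzero E (r + 1) := fun z hz => by
        rw [hφ]; exact (mk_mem_piNonzero_iff E e z).2 hz
      have hc1 : head.comp (φ.comp (consMap r)) = (piFrame 1 e).comp ContinuousMap.fst := by
        ext q
        change head (φ _) = Quotient.mk _ (e, q.1)
        rw [hφ, hhead]
        congr 2
        funext i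
        rw [Subsingleton.elim i 0]
        rfl
      have hc2 : tail.comp (φ.comp (consMap r)) = (piFrame r e).comp ContinuousMap.snd := by
        ext q
        change tail (φ _) = Quotient.mk _ (e, q.2)
        rw [hφ, htail]
        congr 2
      have hp1 : pullback ContinuousMap.fst (pullback (piFrame 1 e) (U₁ : Cochain _)) =
          pullback (consMap r) (pullback φ (pullback head (U₁ : Cochain _))) := by
        rw [← pullback_comp, ← hc1]; rfl
      have hp2 : pullback ContinuousMap.snd (pullback (piFrame r e) (V : Cochain _)) =
          pullback (consMap r) (pullback φ (pullback tail (V : Cochain _))) := by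
        rw [← pullback_comp (ContinuousMap.snd : C((Fin 1 → ℂ) × (Fin r → ℂ), Fin r → ℂ)), ← hc2]; rfl
      have key := cross_value (u := pullback (piFrame 1 e) (U₁ : Cochain (Borel E (piAction 1))))
        (v := pullback (piFrame r e) (V : Cochain (Borel E (piAction r))))
        (hU₁.supp.pullback _) (by rw [d_pullback, hU₁.d_eq, pullback_zero])
        (hU₁.vanOn.pullback _ fun z hz => (mk_mem_piNonzero_iff E e z).2 hz)
        (hV.supp.pullback _) (by rw [d_pullback, hV.d_eq, pullback_zero])
        (hV.vanOn.pullback _ fun z hz => (mk_mem_piNonzero_iff E e z).2 hz)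
        (U := pullback φ U) (h := - pullback φ (comp (2 * r + 1) h))
        (hUs.pullback _) (by rw [d_pullback, hUd, pullback_zero])
        (hUT.pullback _ fun z hz => hφ0 z hz)
        (VanOn.neg (((hhC _ hfU).comp _).pullback φ fun z hz => by
          rw [Set.mem_preimage, hφ, hhead, mk_mem_piNonzero_iff]
          exact fun h0 => hz (congrFun h0 0)))
        (VanOn.neg (((hhC _ hfV).comp _).pullback φ fun z hz => by
          rw [Set.mem_preimage, hφ, htail, mk_mem_piNonzero_iff]
          exact hz))
        (by
          rw [hp1, hp2, hU]
          change _ = _ + (-(pullback (consMap r) (pullback φ (comp (2 * r + 1) h)))).d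
          rw [d_neg, d_pullback, d_pullback, pullback_sub, pullback_sub, sub_eq_add_neg]
          rfl)
      have e1 := hU₁.value (piFrame 1 e) ⟨e, fun z => rfl⟩
      have e2 := hV.value (piFrame r e) ⟨e, fun z => rfl⟩
      change U ⟨2 * (r + 1), φ.comp (orientedSimp (r + 1))⟩ =
        (U₁ : Cochain (Borel E (piAction 1))) ⟨2 * 1, (piFrame 1 e).comp (orientedSimp 1)⟩ *
        (V : Cochain (Borel E (piAction r))) ⟨2 * r, (piFrame r e).comp (orientedSimp r)⟩ at key
      exact key.trans (by rw [e1, e2, mul_one])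
    · have e1 : Coh.mk (⟨U, hUd⟩ : cocycles (Borel E (piAction (r + 1)))) = Coh.mk f :=
        Coh.mk_eq_iff.2 ⟨-(comp (2 * r + 1) h), by
          change _ = U - (f : Cochain (Borel E (piAction (r + 1))))
          rw [hU, d_neg]; abel⟩
      have p1 : (borelProj E (piAction 1)).comp head = borelProj E (piAction (r + 1)) := by
        ext t
        obtain ⟨⟨e, z⟩, rfl⟩ := Quotient.mk_surjective t
        change borelProj E (piAction 1) (head _) = _
        rw [hhead]
        rfl
      have p2 : (borelProj E (piAction r)).comp tail = borelProj E (piAction (r + 1)) := by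
        ext t
        obtain ⟨⟨e, z⟩, rfl⟩ := Quotient.mk_surjective t
        change borelProj E (piAction r) (tail _) = _
        rw [htail]
        rfl
      rw [e1, hf, RingHom.map_mul, ← Coh.map_mk, ← Coh.map_mk, hU₁c, hVc, RingHom.map_neg,
        RingHom.map_pow, RingHom.map_neg, ← Coh.map_comp, ← Coh.map_comp, p1, p2, ← pow_succ']

end Pi

open Cochain

/-! ### Restriction to points and to subspaces -/

/-- The cohomology of a point vanishes in positive even degrees. -/
theorem Coh.map_const_eq_zero {n : ℕ} (hn : Even n) (h0 : n ≠ 0) {a : Coh Y}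
    (ha : a.InDegree n) (y : Y) : Coh.map (ContinuousMap.const X y) a = 0 := by
  obtain ⟨f, rfl, hf⟩ := ha
  obtain ⟨m, rfl⟩ := Nat.exists_eq_succ_of_ne_zero h0
  rw [Coh.map_mk, Coh.mk_eq_zero_iff]
  let g : Cochain X := of fun σ => if σ.1 = m then
    (f : Cochain Y) ⟨m + 1, ContinuousMap.const _ y⟩ else 0
  refine ⟨g, ext fun k σ => ?_⟩
  by_cases hk : k = m + 1
  · subst hk
    have hg : ∀ τ : Simp m X, g ⟨m, τ⟩ = (f : Cochain Y) ⟨m + 1, ContinuousMap.const _ y⟩ :=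
      fun τ => if_pos rfl
    rw [d_succ]
    simp only [hg]
    rw [← Finset.sum_mul]
    -- All faces of a constant simplex coincide, and their number m + 2 is odd.
    have : ∑ i ∈ Finset.range (m + 2), (-1 : ℤ) ^ i = 1 := by
      rw [neg_one_geom_sum, if_neg]
      rw [Nat.not_even_iff_odd]
      exact hn.add_one
    rw [this, one_mul]
    rfl
  · have hg : Supp m g := fun τ h => if_neg h
    exact (hg.d ⟨k, σ⟩ hk).trans (hf _ hk).symm

/-- A class that vanishes on a subspace comes from a relative class. -/
theorem exists_relCocycle {T₀ : Set X} {n : ℕ} {f : cocycles X} (hf : Supp n (f : Cochain X))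
    (h : Coh.map (⟨Subtype.val, continuous_subtype_val⟩ : C(T₀, X)) (Coh.mk f) = 0) :
    ∃ w : cocycles X, Supp n (w : Cochain X) ∧ VanOn T₀ (w : Cochain X) ∧ Coh.mk f = Coh.mk w := by
  rw [Coh.map_mk, Coh.mk_eq_zero_iff] at h
  obtain ⟨k, hk⟩ := h
  have hι : Topology.IsEmbedding (⟨Subtype.val, continuous_subtype_val⟩ : C(T₀, X)) :=
    Topology.IsEmbedding.subtypeVal
  obtain ⟨K, hK, -⟩ := exists_extend _ hι k
  have hvan : VanOn T₀ ((f : Cochain X) - K.d) := by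
    have := eqOn_range_of_pullback_eq hι (f := (f : Cochain X) - K.d) (g := 0) (by
      rw [pullback_sub, ← d_pullback, hK, hk, pullback_zero]
      exact sub_self _)
    have hr : Set.range (⟨Subtype.val, continuous_subtype_val⟩ : C(T₀, X)) = T₀ :=
      Subtype.range_coe
    rwa [hr] at this
  have hvan' := hvan.comp n
  have hs : Supp n (comp n ((f : Cochain X) - K.d)) := supp_comp _ _
  have hex : ∃ K' : Cochain X, comp n ((f : Cochain X) - K.d) = f - K'.d := by
    rw [comp_sub, hf.comp_eq]
    cases n with
    | zero => exact ⟨0, by rw [comp_zero_d, d_zero]⟩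
    | succ n => exact ⟨comp n K, by rw [comp_succ_d]⟩
  obtain ⟨K', hK'⟩ := hex
  rw [hK'] at hvan' hs
  refine ⟨⟨f - K'.d, ?_⟩, hs, hvan', Coh.mk_eq_iff.2 ⟨K', ?_⟩⟩
  · change ((f : Cochain X) - K'.d).d = 0
    rw [d_sub, d_d, cocycles_d, sub_zero]
  · change _ = (f : Cochain X) - (f - K'.d)
    abel

theorem locTriv_prod_line (Z : Type*) [TopologicalSpace Z] :
    LocTriv 1 (ContinuousMap.fst : C(Z × ℂ, Z)) {y | y.2 ≠ 0} {φ | ∃ v, ∀ z, φ z = (v, z 0)} := by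
  intro b
  refine ⟨Set.univ, isOpen_univ, trivial, fun q => (q.1, q.2 0), fun y _ => y.2,
    Continuous.continuousOn (by fun_prop), Continuous.continuousOn (by fun_prop),
    fun w _ z => ⟨rfl, ?_, ?_⟩, fun t _ => rfl, fun w _ => ⟨⟨fun z => (w, z 0), by fun_prop⟩,
      ⟨w, fun z => rfl⟩, fun z => rfl⟩⟩
  · funext i
    rw [Subsingleton.elim i 0]
  · change z 0 ≠ 0 ↔ z ≠ 0
    refine not_congr ⟨fun h => funext fun i => ?_, fun h => by rw [h]; rfl⟩
    rw [Subsingleton.elim i 0, h]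
    rfl

/-! ### The equivariant Euler class -/

section BorelBundle

variable {M : Type*} [TopologicalSpace M] (F : Type*) [NormedAddCommGroup F] [NormedSpace ℂ F]
  (N : M → Type*) [∀ x, AddCommGroup (N x)] [∀ x, Module ℂ (N x)] [∀ x, TopologicalSpace (N x)]
  [TopologicalSpace (TotalSpace F N)] [FiberBundle F N] [VectorBundle ℂ F N]

theorem continuous_totalSpace_mk_linearMap {r : ℕ} (x : M) (b : (Fin r → ℂ) →ₗ[ℂ] N x) :
    Continuous fun z => (⟨x, b z⟩ : TotalSpace F N) := by
  set e := trivializationAt F N x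
  have hx : x ∈ e.baseSet := FiberBundle.mem_baseSet_trivializationAt' x
  let L : (Fin r → ℂ) →ₗ[ℂ] F := (e.linearEquivAt ℂ x hx).toLinearMap.comp b
  have hL : Continuous L := L.continuous_of_finiteDimensional
  have h1 : Continuous fun z => (⟨x, e.symm x (L z)⟩ : TotalSpace F N) :=
    e.continuousOn_symm.comp_continuous (continuous_const.prodMk hL) fun z => ⟨hx, trivial⟩
  refine h1.congr fun z => ?_
  have : e.symm x (L z) = b z := (e.linearEquivAt ℂ x hx).symm_apply_apply (b z)
  rw [this]

variable {E : Type*} [TopologicalSpace E] [MulAction Circle E]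

theorem isBorel_borelBundle (hE : IsUniversalCircleBundle E) :
    IsBorel (scalarAction F N) (Quotient.mk (borelSetoid E (scalarAction F N))) :=
  isBorel_mk hE _ (continuous_scalarAction F N)

theorem scalarAction_mem_nonzero {M : Type*} (F : Type*) (N : M → Type*)
    [∀ x, AddCommGroup (N x)] [∀ x, Module ℂ (N x)] (g : Circle) (v : TotalSpace F N) (hv : v ∈ nonzero F N) :
    scalarAction F N g v ∈ nonzero F N :=
  smul_ne_zero (Circle.coe_ne_zero g) hv

theorem mk_mem_borelNonzero_iff {M : Type*} (F : Type*) (N : M → Type*)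
    [∀ x, AddCommGroup (N x)] [∀ x, Module ℂ (N x)] {E : Type*} [MulAction Circle E] (e : E) (v : TotalSpace F N) :
    Quotient.mk (borelSetoid E (scalarAction F N)) (e, v) ∈ borelNonzero E F N ↔
      v ∈ nonzero F N :=
  mk_mem_borelSet_iff (scalarAction_mem_nonzero F N) e v

theorem locTriv_borelBundle [FiniteDimensional ℂ F] (hE : IsUniversalCircleBundle E) {r : ℕ}
    (hr : Module.finrank ℂ F = r) : LocTriv r ((piB E F N).prodMk (piM E F N))
      (borelNonzero E F N) (borelFrames E F N r) := by
  refine locTriv_borel hE (isBorel_borelBundle F N hE) (isBorel_prod hE M)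
    (pY := bundleProj F N) (fun _ _ => rfl) (fun _ _ => rfl) (locTriv_totalSpace F N r hr)
    (mk_mem_borelNonzero_iff F N) ?_
  rintro e φ ⟨x, b, hb⟩ ψ hψ
  exact ⟨e, x, b, fun z => by rw [hψ, hb]⟩

theorem exists_borelBundle_zeroSection (hE : IsUniversalCircleBundle E) :
    ∃ s : C(BS E × M, BorelBundle E F N),
      ((piB E F N).prodMk (piM E F N)).comp s = ContinuousMap.id _ := by
  obtain ⟨s, hs⟩ := (isBorel_prod hE M).exists_map (isBorel_borelBundle F N hE)
    (continuous_zeroSection F N) (fun g x => by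
      change zeroSection F N x = scale F N g (zeroSection F N x)
      exact congrArg (TotalSpace.mk x) (smul_zero _).symm)
  refine ⟨s, ContinuousMap.ext fun b => ?_⟩
  obtain ⟨b, x⟩ := b
  obtain ⟨e, rfl⟩ := Quotient.mk_surjective b
  exact congrArg ((piB E F N).prodMk (piM E F N)) (hs e x)

/-- Away from the zero section, the universal line bundle is the pull-back of the tautological line
bundle over the projective bundle. -/
theorem exists_map_projBundle [FiniteDimensional ℂ F] (hE : IsUniversalCircleBundle E)
    {c : Coh (BS E)} (hc : IsUniversalChernClass E c) {e : Coh (ProjBundle F N)}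
    (he : IsEulerClass 1 (tautProj F N) (tautNonzero F N) (tautFrames F N) e) :
    ∃ q : C(borelNonzero E F N, ProjBundle F N),
      (projBundleProj F N).comp q =
        (piM E F N).comp ⟨Subtype.val, continuous_subtype_val⟩ ∧
      Coh.map ((piB E F N).comp ⟨Subtype.val, continuous_subtype_val⟩) c = Coh.map q e := by
  have hopen : IsOpen (nonzero F N) := (locTriv_totalSpace F N _ rfl).isOpen
  have hT := (isBorel_borelBundle F N hE).restrict hopen (mk_mem_borelNonzero_iff F N)
    (scalarAction_mem_nonzero F N)
  have hproj : ∀ (g : Circle) (v : nonzero F N),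
      (Quotient.mk (projSetoid F N) ⟨scale F N g v, scalarAction_mem_nonzero F N g v v.2⟩) =
        Quotient.mk (projSetoid F N) v := fun g v =>
    (Quotient.sound (s := projSetoid F N) ⟨g, Circle.coe_ne_zero g, rfl⟩).symm
  obtain ⟨q, hq⟩ := hT.exists_desc (f := fun a => (Quotient.mk (projSetoid F N) a.2))
    (continuous_quotient_mk'.comp continuous_snd) (fun g e v => hproj g v)
  set ρ := restrictAction (scalarAction F N) (nonzero F N) (scalarAction_mem_nonzero F N) with hρ
  -- This is the total space of the universal line bundle pulled back to the complement of the zero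
  -- section. It maps fibrewise isomorphically to the universal line bundle by `G₁` and to the
  -- tautological bundle by `G₂`.
  have hL : IsBorel (prodAction ρ assocAction)
      (Quotient.mk (borelSetoid E (prodAction ρ assocAction))) := by
    refine isBorel_mk hE _ (Continuous.prodMk ?_ ?_)
    · exact hT.continuous_act.comp (continuous_fst.prodMk (continuous_fst.comp continuous_snd))
    · exact continuous_assocAction.comp
        (continuous_fst.prodMk (continuous_snd.comp continuous_snd))
  obtain ⟨p, hp⟩ := hL.exists_map hT (f := Prod.fst) continuous_fst (fun g y => rfl)
  obtain ⟨s, hs⟩ := hT.exists_map hL (f := fun v => (v, (0 : ℂ))) (by fun_prop)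
    (fun g y => Prod.ext rfl (mul_zero _).symm)
  have hps : p.comp s = ContinuousMap.id _ := by
    refine ContinuousMap.ext fun t => ?_
    obtain ⟨⟨e, v⟩, rfl⟩ := hT.isOpenQuotientMap.surjective t
    rw [ContinuousMap.comp_apply, hs, hp]
    rfl
  let L₀ : Set (Borel E (prodAction ρ assocAction)) :=
    {t | ∃ (e : E) (y : nonzero F N × ℂ), y ∈ {y : nonzero F N × ℂ | y.2 ≠ 0} ∧
      t = Quotient.mk _ (e, y)}
  have hL₀ : ∀ e y, Quotient.mk (borelSetoid E (prodAction ρ assocAction)) (e, y) ∈ L₀ ↔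
      y ∈ {y : nonzero F N × ℂ | y.2 ≠ 0} :=
    mk_mem_borelSet_iff fun g y hy => assocAction_ne_zero g y.2 hy
  have htriv : LocTriv 1 p L₀ {φ | ∃ (e : E) (v : nonzero F N), ∀ z,
      φ z = Quotient.mk (borelSetoid E (prodAction ρ assocAction)) (e, (v, z 0))} := by
    refine locTriv_borel hE hL hT (fun g y => rfl) hp (locTriv_prod_line (nonzero F N)) hL₀ ?_
    rintro e φ ⟨v, hφ⟩ ψ hψ
    exact ⟨e, v, fun z => by rw [hψ, hφ]⟩
  obtain ⟨G₁, hG₁⟩ := hL.exists_map (isBorel_line hE) (f := Prod.snd) continuous_snd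
    (fun g y => rfl)
  -- [e, v, z] is sent to the line of v together with the vector z v. This is well defined since
  -- (g⁻¹z)(gv) = zv, so it is the tautological bundle, and not its dual, that matches the universal
  -- one.
  obtain ⟨G₂, hG₂⟩ := hL.exists_desc (X := Taut F N)
    (f := fun a => ⟨(Quotient.mk (projSetoid F N) a.2.1, scale F N a.2.2 a.2.1), a.2.1, a.2.2, rfl⟩)
    (by
      refine Continuous.subtype_mk (Continuous.prodMk ?_ ?_) _
      · exact continuous_quotient_mk'.comp (continuous_fst.comp continuous_snd)
      · exact (continuous_scale F N).comp ((continuous_snd.comp continuous_snd).prodMk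
          (continuous_subtype_val.comp (continuous_fst.comp continuous_snd))))
    (fun g e y => by
      refine Subtype.ext (Prod.ext (hproj g y.1) ?_)
      change scale F N (((g⁻¹ : Circle) : ℂ) * y.2) (scale F N g y.1) = scale F N y.2 y.1
      rw [scale_scale, Circle.coe_inv, mul_right_comm, inv_mul_cancel₀ (Circle.coe_ne_zero g),
        one_mul])
  obtain ⟨u, hu, huc⟩ := hc.exists_cocycle
  obtain ⟨v, hv, hve⟩ := he.exists_cocycle
  have h1 := hu.pullback (T₀' := L₀) (frames' := {φ | ∃ (e : E) (v : nonzero F N), ∀ z,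
      φ z = Quotient.mk (borelSetoid E (prodAction ρ assocAction)) (e, (v, z 0))}) G₁
    (by
      rintro _ ⟨e, y, hy, rfl⟩
      rw [hG₁]
      exact (mk_mem_lineNonzero_iff _ _).2 hy)
    (by
      rintro ψ ⟨e, v, hψ⟩
      exact ⟨e, 1, one_ne_zero, fun z => by rw [ContinuousMap.comp_apply, hψ, hG₁, mul_one]⟩)
  have h2 := hv.pullback (T₀' := L₀) (frames' := {φ | ∃ (e : E) (v : nonzero F N), ∀ z,
      φ z = Quotient.mk (borelSetoid E (prodAction ρ assocAction)) (e, (v, z 0))}) G₂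
    (by
      rintro _ ⟨e, y, hy, rfl⟩
      rw [hG₂]
      exact smul_ne_zero hy y.1.2)
    (by
      rintro ψ ⟨e, v, hψ⟩
      exact ⟨v, fun z => by rw [ContinuousMap.comp_apply, hψ, hG₂]⟩)
  -- Both pulled-back cocycles are Thom cocycles of the same line bundle, hence cohomologous. The
  -- zero section `s` then removes the pull-back along `p`.
  have h3 := htriv.mk_eq_mk (u := cocyclesPullback G₁ u) (v := cocyclesPullback G₂ v) h1 h2
  rw [← Coh.map_mk, ← Coh.map_mk, ← huc, ← hve, ← Coh.map_comp, ← Coh.map_comp] at h3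
  have e1 : (borelProj E assocAction).comp G₁ =
      ((piB E F N).comp ⟨Subtype.val, continuous_subtype_val⟩).comp p := by
    refine ContinuousMap.ext fun t => ?_
    obtain ⟨⟨e, y⟩, rfl⟩ := Quotient.mk_surjective t
    rw [ContinuousMap.comp_apply, ContinuousMap.comp_apply, hG₁, hp]
    rfl
  have e2 : (tautProj F N).comp G₂ = q.comp p := by
    refine ContinuousMap.ext fun t => ?_
    obtain ⟨⟨e, y⟩, rfl⟩ := Quotient.mk_surjective t
    rw [ContinuousMap.comp_apply, ContinuousMap.comp_apply, hG₂, hp, hq]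
    rfl
  rw [e1, e2, Coh.map_comp p, Coh.map_comp p] at h3
  refine ⟨q, ?_, Coh.map_injective_of_section hps h3⟩
  refine ContinuousMap.ext fun t => ?_
  obtain ⟨⟨e, v⟩, rfl⟩ := hT.isOpenQuotientMap.surjective t
  rw [ContinuousMap.comp_apply, hq]
  rfl

end BorelBundle

open Cochain

/-! ### The equivariant Thom class restricts to the Chern polynomial -/

section Euler

variable {E : Type*} [TopologicalSpace E] [MulAction Circle E]

theorem eq_zero_of_chern_pow_mul (hE : IsUniversalCircleBundle E) {c : Coh (BS E)}
    (hc : IsUniversalChernClass E c) {M : Type*} [TopologicalSpace M] (n : ℕ) {y : Coh (BS E × M)}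
    (h : Coh.map ContinuousMap.fst c ^ n * y = 0) : y = 0 := by
  induction n with
  | zero => rwa [pow_zero, one_mul] at h
  | succ n ih =>
    rw [pow_succ', mul_assoc] at h
    exact ih (eq_zero_of_chern_mul hE hc h)

theorem eq_zero_of_chern_pow_mul_BS (hE : IsUniversalCircleBundle E) {c : Coh (BS E)}
    (hc : IsUniversalChernClass E c) (n : ℕ) {y : Coh (BS E)} (h : c ^ n * y = 0) : y = 0 := by
  have hs : (ContinuousMap.fst : C(BS E × Unit, BS E)).comp
      ((ContinuousMap.id _).prodMk (ContinuousMap.const _ ())) = ContinuousMap.id _ := rfl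
  refine Coh.map_injective_of_section hs ?_
  rw [RingHom.map_zero]
  refine eq_zero_of_chern_pow_mul hE hc n ?_
  rw [← RingHom.map_pow, ← RingHom.map_mul, h, RingHom.map_zero]

theorem exists_pi_zeroSection (hE : IsUniversalCircleBundle E) (r : ℕ) :
    ∃ s : C(BS E, Borel E (piAction r)),
      (borelProj E (piAction r)).comp s = ContinuousMap.id _ := by
  obtain ⟨s, hs⟩ := (isBorel_unit hE).exists_map (isBorel_pi hE r) (f := fun _ => 0)
    continuous_const (fun g _ => (smul_zero (g : ℂ)).symm)
  refine ⟨s, ContinuousMap.ext fun b => ?_⟩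
  obtain ⟨e, rfl⟩ := Quotient.mk_surjective b
  exact congrArg (borelProj E (piAction r)) (hs e ())

variable {M : Type*} [TopologicalSpace M] {F : Type*} [NormedAddCommGroup F] [NormedSpace ℂ F]
  {N : M → Type*} [∀ x, AddCommGroup (N x)] [∀ x, Module ℂ (N x)] [∀ x, TopologicalSpace (N x)]
  [TopologicalSpace (TotalSpace F N)] [FiberBundle F N]

/-- The polynomial in the universal Chern class whose coefficients are the Chern classes. -/
def chernPoly (r : ℕ) (C : Coh X) (ch : ℕ → Coh X) : Coh X :=
  ∑ i ∈ Finset.range (r + 1), ch i * (-C) ^ (r - i)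

theorem map_chernPoly (φ : C(X, Y)) (r : ℕ) (C : Coh Y) (ch : ℕ → Coh Y) :
    Coh.map φ (chernPoly r C ch) = chernPoly r (Coh.map φ C) (fun i => Coh.map φ (ch i)) := by
  simp only [chernPoly, map_sum, RingHom.map_mul, RingHom.map_pow, RingHom.map_neg]

theorem chernPoly_inDegree {r : ℕ} {C : Coh X} {ch : ℕ → Coh X} (hC : C.InDegree 2)
    (hch : ∀ i, (ch i).InDegree (2 * i)) : (chernPoly r C ch).InDegree (2 * r) := by
  refine Coh.InDegree.sum fun i hi => ?_
  have := (hch i).mul (hC.neg.pow (r - i))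
  rw [Finset.mem_range] at hi
  rwa [← mul_add, show i + (r - i) = r by omega] at this

variable [VectorBundle ℂ F N]

/-- A relative class restricting to the Chern polynomial has value one on the fibres. -/
theorem value_eq_one_of_mk_eq_chernPoly (hE : IsUniversalCircleBundle E) {c : Coh (BS E)}
    (hc : IsUniversalChernClass E c) {r : ℕ} {ch : ℕ → Coh M} (hch : IsChernClasses F N r ch)
    {w : cocycles (BorelBundle E F N)} (hws : Supp (2 * r) (w : Cochain (BorelBundle E F N)))
    (hwT : VanOn (borelNonzero E F N) (w : Cochain (BorelBundle E F N)))
    (hw : Coh.mk w = chernPoly r (Coh.map (piB E F N) c) (fun i => Coh.map (piM E F N) (ch i))) :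
    ∀ φ ∈ borelFrames E F N r,
      (w : Cochain (BorelBundle E F N)) ⟨2 * r, φ.comp (orientedSimp r)⟩ = 1 := by
  rintro φ ⟨e, x, b, hφ⟩
  -- The frame `b` is equivariant and so induces a bundle map over all of BS¹ × {x}. A single fibre
  -- would not suffice, because the value is detected in the cohomology of BS¹.
  obtain ⟨ψ, hψ⟩ := (isBorel_pi hE r).exists_map (isBorel_borelBundle F N hE)
    (continuous_totalSpace_mk_linearMap F N x b.toLinearMap) (fun g z =>
      congrArg (TotalSpace.mk x) (b.map_smul (g : ℂ) z))
  obtain ⟨U, hU, hUc⟩ := exists_thomCocycle_pi hE hc r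
  have hvT : VanOn (piNonzero E r) (pullback ψ (w : Cochain (BorelBundle E F N))) := by
    refine hwT.pullback ψ ?_
    rintro _ ⟨e, z, hz, rfl⟩
    rw [hψ, mk_mem_borelNonzero_iff]
    exact (LinearEquiv.map_ne_zero_iff b).2 hz
  obtain ⟨a, g, had, has, hg, hag, -⟩ := (locTriv_pi hE r).exists_eq_mul hU
    (f := pullback ψ (w : Cochain (BorelBundle E F N)))
    (by rw [d_pullback, cocycles_d, pullback_zero]) hvT (hws.pullback ψ)
  have hψB : (piB E F N).comp ψ = borelProj E (piAction r) := by
    refine ContinuousMap.ext fun t => ?_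
    obtain ⟨⟨e, z⟩, rfl⟩ := Quotient.mk_surjective t
    rw [ContinuousMap.comp_apply, hψ]
    rfl
  have hψM : (piM E F N).comp ψ = ContinuousMap.const _ x := by
    refine ContinuousMap.ext fun t => ?_
    obtain ⟨⟨e, z⟩, rfl⟩ := Quotient.mk_surjective t
    rw [ContinuousMap.comp_apply, hψ]
    rfl
  let a' : cocycles (BS E) := ⟨a, had⟩
  have h1 : Coh.map ψ (Coh.mk w) = Coh.mk U * Coh.map (borelProj E (piAction r)) (Coh.mk a') := by
    rw [Coh.map_mk, Coh.map_mk, ← RingHom.map_mul]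
    refine Coh.mk_eq_iff.2 ⟨g, ?_⟩
    change g.d = pullback ψ (w : Cochain (BorelBundle E F N)) -
      (U : Cochain (Borel E (piAction r))) * pullback _ a
    rw [hag]
    abel
  -- The Chern classes of positive degree restrict to zero at the point `x`, so only the term with
  -- index 0 remains.
  have h2 : Coh.map ψ (Coh.mk w) = (-Coh.map (borelProj E (piAction r)) c) ^ r := by
    rw [hw, map_chernPoly]
    simp only [← Coh.map_comp, hψB, hψM]
    rw [chernPoly, Finset.sum_range_succ', Finset.sum_eq_zero, hch.zero, RingHom.map_one, zero_add,
      one_mul, Nat.sub_zero]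
    intro i _
    rw [Coh.map_const_eq_zero (even_two_mul (i + 1)) (by omega) (hch.degree (i + 1)), zero_mul]
  -- Comparing the two expressions gives (-c)^r a = (-c)^r on the total space; the zero section
  -- brings this down to BS¹.
  have h3 : c ^ r * (Coh.mk a' - 1) = 0 := by
    obtain ⟨s, hs⟩ := exists_pi_zeroSection hE r
    refine Coh.map_injective_of_section hs ?_
    rw [h1, hUc, neg_pow, mul_assoc] at h2
    have h4 := (isUnit_one.neg.pow r).mul_left_cancel h2
    rw [RingHom.map_mul, RingHom.map_sub, RingHom.map_pow, RingHom.map_one, RingHom.map_zero,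
      mul_sub, h4, mul_one, sub_self]
  have h4 := eq_zero_of_chern_pow_mul_BS hE hc r h3
  rw [← RingHom.map_one (Coh.mk : cocycles (BS E) →+* Coh (BS E)), ← RingHom.map_sub] at h4
  have h5 : a - 1 = 0 := Coh.InDegree.mk_eq_zero (f := a' - 1) (has.sub supp_one) h4
  rw [sub_eq_zero.1 h5, pullback_one, mul_one] at hag
  have h6 := d_orientedSimp_eq_zero (A := piNonzero E r) (piFrame r e)
    (fun z hz => (mk_mem_piNonzero_iff E e z).2 hz) hg
  have h7 := hU.value (piFrame r e) ⟨e, fun z => rfl⟩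
  have h8 : ψ.comp (piFrame r e) = φ := by
    refine ContinuousMap.ext fun z => ?_
    rw [hφ]
    exact hψ e z
  have h9 := congrFun hag ⟨2 * r, (piFrame r e).comp (orientedSimp r)⟩
  rw [add_val, h6, h7, add_zero] at h9
  rw [← h8]
  exact h9

/-- The restriction of the equivariant Thom class is the pull-back of the Chern polynomial. -/
theorem toCoh_thom [FiniteDimensional ℂ F] (hE : IsUniversalCircleBundle E) {c : Coh (BS E)}
    (hc : IsUniversalChernClass E c) {r : ℕ} (hr : Module.finrank ℂ F = r) {ch : ℕ → Coh M}
    (hch : IsChernClasses F N r ch) {Th : RelCoh (borelNonzero E F N)}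
    (hTh : IsEquivariantThomClass E F N r Th) :
    RelCoh.toCoh Th = chernPoly r (Coh.map (piB E F N) c) (fun i => Coh.map (piM E F N) (ch i)) := by
  obtain ⟨f, hf, hfs⟩ := chernPoly_inDegree (r := r) ((hc.inDegree hE).map (piB E F N))
    (fun i => (hch.degree i).map (piM E F N))
  -- Off the zero section the Chern polynomial is the pull-back along `q` of the relation that
  -- defines the Chern classes in the cohomology of P(N), hence zero; so it lifts to a relative
  -- cocycle.
  obtain ⟨w, hws, hwT, hfw⟩ := exists_relCocycle (T₀ := borelNonzero E F N) hfs (by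
    obtain ⟨e, he, hrel⟩ := hch.relation
    obtain ⟨q, hqM, hqB⟩ := exists_map_projBundle F N hE hc he
    rw [hf, map_chernPoly]
    simp only [← Coh.map_comp]
    rw [hqB, ← hqM]
    have := congrArg (Coh.map q) hrel
    rw [RingHom.map_zero] at this
    rw [← this]
    simp only [chernPoly, map_sum, RingHom.map_mul, RingHom.map_pow, RingHom.map_neg, Coh.map_comp])
  have hw := hfw.symm.trans hf
  obtain ⟨u, rfl, hu⟩ := IsThomClass.exists_cocycle hTh
  have hwu := (locTriv_borelBundle F N hE hr).mk_eq_mk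
    (u := (⟨u, hu.d_eq⟩ : cocycles (BorelBundle E F N))) (v := w) hu
    ⟨hws, cocycles_d w, hwT, value_eq_one_of_mk_eq_chernPoly hE hc hch hws hwT hw⟩
  exact hwu.trans hw

end Euler

open Cochain

/-! ### Division by the Euler class -/

theorem map_segre {R S : Type*} [Ring R] [Ring S] (f : R →+* S) (c : ℕ → R) (n : ℕ) :
    f (segre c n) = segre (fun i => f (c i)) n := by
  induction n using Nat.strong_induction_on with
  | _ n ih =>
    cases n with
    | zero => rw [segre, segre, map_one]
    | succ n =>
      rw [segre, segre, map_neg, map_sum]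
      refine congrArg _ (Finset.sum_congr rfl fun i _ => ?_)
      rw [map_mul, ih i (by omega)]

theorem segre_inDegree {ch : ℕ → Coh X} (hch : ∀ i, (ch i).InDegree (2 * i)) (n : ℕ) :
    (segre ch n).InDegree (2 * n) := by
  induction n using Nat.strong_induction_on with
  | _ n ih =>
    cases n with
    | zero => rw [segre]; exact Coh.InDegree.one
    | succ n =>
      rw [segre]
      refine (Coh.InDegree.sum fun i _ => ?_).neg
      have := (ih i (by omega)).mul (hch (n + 1 - i))
      rwa [← mul_add, show (i : ℕ) + (n + 1 - i) = n + 1 by omega] at this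

/-- The rectangle is contained in the triangle i + j ≤ r + k, and `t` vanishes on the rest of the
triangle. -/
theorem sum_rectangle_eq {R : Type*} [AddCommMonoid R] (r k : ℕ) (t : ℕ → ℕ → R)
    (hr : ∀ i j, r < i → t j i = 0) (hk : ∀ i j, k < j → t j i = 0) :
    ∑ j ∈ Finset.range (k + 1), ∑ i ∈ Finset.range (r + 1), t j i =
      ∑ n ∈ Finset.range (r + k + 1), ∑ j ∈ Finset.range (n + 1), t j (n - j) := by
  rw [Finset.sum_range_diag_flip]
  have h1 : Finset.range (k + 1) ⊆ Finset.range (r + k + 1) :=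
    Finset.range_mono (by omega)
  rw [← Finset.sum_subset h1 fun j _ hj => Finset.sum_eq_zero fun i _ => hk i j (by
    rw [Finset.mem_range] at hj; omega)]
  refine Finset.sum_congr rfl fun j hj => ?_
  rw [Finset.mem_range] at hj
  exact Finset.sum_subset (Finset.range_mono (by omega)) fun i _ hi => hr i j (by
    rw [Finset.mem_range] at hi; omega)

/-- Sorted by n = i + j, the coefficient of (-1)^n C^{m-n} is α times the degree-n part of the
product of the total Segre and Chern classes, which is zero for n > 0. The bound `k + r ≤ m` makes
every exponent of C a true difference. -/
theorem chernPoly_mul_sum {r k m : ℕ} (hm : k + r ≤ m) {C α : Coh X} {ch : ℕ → Coh X}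
    (hC : ∀ b, Commute C b) (hch : ∀ i b, Commute (ch i) b) (h0 : ch 0 = 1)
    (hr : ∀ i, r < i → ch i = 0) (hα : ∀ j, k < j → α * segre ch j = 0) :
    chernPoly r C ch * ∑ j ∈ Finset.range (k + 1),
      (-1) ^ (r + j) * (C ^ (m - r - j) * (α * segre ch j)) = C ^ m * α := by
  have hterm : ∀ i ∈ Finset.range (r + 1), ∀ j ∈ Finset.range (k + 1),
      ch i * (-C) ^ (r - i) * ((-1) ^ (r + j) * (C ^ (m - r - j) * (α * segre ch j))) =
        (-1) ^ (j + i) * (C ^ (m - (j + i)) * (α * segre ch j * ch i)) := by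
    intro i hi j hj
    rw [Finset.mem_range] at hi hj
    -- The two exponents differ by twice `r - i`.
    have h1 : ((-1 : Coh X)) ^ (r - i) * (-1) ^ (r + j) = (-1) ^ (j + i) := by
      rw [← pow_add, show r - i + (r + j) = j + i + 2 * (r - i) by omega, pow_add, pow_mul,
        neg_one_sq, one_pow, mul_one]
    have h2 : C ^ (r - i) * C ^ (m - r - j) = C ^ (m - (j + i)) := by
      rw [← pow_add]
      congr 1
      omega
    have h3 : C ^ (r - i) * (-1) ^ (r + j) = (-1) ^ (r + j) * C ^ (r - i) :=
      ((hC _).pow_left _).eq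
    rw [mul_assoc, (hch i _).eq, neg_pow, ← h1, ← h2]
    simp only [mul_assoc]
    rw [← mul_assoc (C ^ (r - i)) ((-1) ^ (r + j)), h3]
    simp only [mul_assoc]
  rw [chernPoly, Finset.sum_mul_sum, Finset.sum_congr rfl fun i hi =>
    Finset.sum_congr rfl (hterm i hi), Finset.sum_comm, sum_rectangle_eq r k
    (fun j i => (-1) ^ (j + i) * (C ^ (m - (j + i)) * (α * segre ch j * ch i)))
    (fun i j h => by rw [hr i h]; simp) (fun i j h => by rw [hα j h]; simp)]
  have hn : ∀ n ∈ Finset.range (r + k + 1), (∑ j ∈ Finset.range (n + 1), (-1) ^ (j + (n - j)) *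
      (C ^ (m - (j + (n - j))) * (α * segre ch j * ch (n - j)))) =
        (-1) ^ n * (C ^ (m - n) * (α * if n = 0 then 1 else 0)) := by
    intro n _
    rw [← sum_segre_mul ch h0 n, Finset.mul_sum, Finset.mul_sum, Finset.mul_sum]
    refine Finset.sum_congr rfl fun j hj => ?_
    rw [Finset.mem_range] at hj
    rw [show j + (n - j) = n by omega, mul_assoc α]
  rw [Finset.sum_congr rfl hn, Finset.sum_range_succ', Finset.sum_eq_zero fun i _ => by
    rw [if_neg (Nat.succ_ne_zero i)]; simp]
  simp

theorem chernPoly_commute {r : ℕ} {C : Coh X} {ch : ℕ → Coh X} (hC : ∀ b, Commute C b)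
    (hch : ∀ i b, Commute (ch i) b) (b : Coh X) : Commute (chernPoly r C ch) b :=
  Finset.sum_induction _ (fun x => Commute x b) (fun _ _ h h' => h.add_left h')
    (Commute.zero_left b) fun i _ => (hch i b).mul_left ((hC b).neg_left.pow_left _)

theorem pairing_eq_zero {n d : ℕ} (hnd : n ≠ d) {b : Coh X} (hb : b.InDegree n) {z : Hml X}
    (hz : z.InDegree d) : pairing b z = 0 := by
  obtain ⟨f, rfl, hf⟩ := hb
  obtain ⟨w, rfl, hw⟩ := hz
  change Cochain.eval (f : Cochain X) (w : Sing X →₀ ℤ) = 0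
  rw [Cochain.eval, Finsupp.linearCombination_apply]
  refine Finset.sum_eq_zero fun σ _ => ?_
  change (w : Sing X →₀ ℤ) σ * (f : Cochain X) σ = 0
  by_cases h : σ.1 = n
  · have : (w : Sing X →₀ ℤ) σ = 0 := hw σ (by rw [h]; exact hnd)
    rw [this, zero_mul]
  · have : (f : Cochain X) σ = 0 := hf σ h
    rw [this, mul_zero]

/-- In degree two a cocycle may be replaced by a normalised one, and powers of normalised cocycles
are normalised; so the formula for cross products applies to every power of `c`. -/
theorem slant_pow_mul {c : Coh X} (hc : c.InDegree 2) {n d : ℕ} (hn : n ≤ d) {b : Coh Y}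
    (hb : b.InDegree n) {z : Hml Y} (hz : z.InDegree d) (l : ℕ) :
    slant (Coh.map ContinuousMap.fst c ^ l * Coh.map ContinuousMap.snd b) z =
      pairing b z • c ^ l := by
  obtain ⟨f, rfl, hf⟩ := hc
  obtain ⟨g, hg, hgs, -⟩ := exists_normalized (cocycles_d f) hf
  let f' : cocycles X := ⟨f - g.d, by
    change ((f : Cochain X) - g.d).d = 0
    rw [d_sub, d_d, cocycles_d, sub_zero]⟩
  have hff : Coh.mk f = Coh.mk f' := Coh.mk_eq_iff.2 ⟨g, by
    change _ = (f : Cochain X) - (f - g.d)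
    abel⟩
  rw [hff, ← RingHom.map_pow, ← RingHom.map_pow]
  exact slant_cross hn (p := 2 * l) (a := f' ^ l) (hg.pow l) ((Supp.sub hf hgs.d).pow l) hb hz

end S1Loc
end

/-! ### The localisation formula and the pushforward -/

theorem mainTheorem7
    -- a complex vector bundle `N` of rank `r` over `M`
    {M : Type*} [TopologicalSpace M]
    (r : ℕ) (F : Type*) [NormedAddCommGroup F] [NormedSpace ℂ F] [FiniteDimensional ℂ F]
    (hr : Module.finrank ℂ F = r)
    (N : M → Type*) [∀ x, AddCommGroup (N x)] [∀ x, Module ℂ (N x)] [∀ x, TopologicalSpace (N x)]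
    [TopologicalSpace (TotalSpace F N)] [FiberBundle F N] [VectorBundle ℂ F N]
    -- a fundamental class of dimension `d`
    (d : ℕ) (hd : ∀ n, d < n → ∀ a : Coh M, a.InDegree n → a = 0)
    (fund : Hml M) (hfund : fund.InDegree d)
    -- the universal circle bundle
    (E : Type*) [TopologicalSpace E] [MulAction Circle E] (hE : IsUniversalCircleBundle E)
    -- the universal first Chern class, the equivariant Thom class, the Chern classes of `N`
    (c : Coh (BS E)) (hc : IsUniversalChernClass E c)
    (Th : RelCoh (borelNonzero E F N)) (hTh : IsEquivariantThomClass E F N r Th)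
    (ch : ℕ → Coh M) (hch : IsChernClasses F N r ch)
    (k : ℕ) (hk : k ≤ d / 2) (α : Coh M) (hα : α.InDegree (d - 2 * k)) (m : ℕ) (hm : k + r ≤ m) :
    Coh.map (piB E F N) c ^ m * Coh.map (piM E F N) α =
      RelCoh.toCoh Th * ∑ j ∈ Finset.range (k + 1), (-1) ^ (r + j) *
        (Coh.map (piB E F N) c ^ (m - r - j) * Coh.map (piM E F N) (α * segre ch j)) ∧
    IsPushforward Th fund (Coh.map (piB E F N) c ^ m * Coh.map (piM E F N) α)
      (((-1) ^ (k + r) * pairing (α * segre ch k) fund) • c ^ (m - r - k)) := by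
  set p := (piB E F N).prodMk (piM E F N) with hp
  set C := Coh.map (ContinuousMap.fst : C(BS E × M, BS E)) c with hC
  set ch' : ℕ → Coh (BS E × M) := fun i => Coh.map ContinuousMap.snd (ch i) with hch'
  have hc2 := hc.inDegree hE
  have hCc : ∀ b, Commute C b := fun b => (hc2.map _).commute even_two b
  have hchc : ∀ i b, Commute (ch' i) b := fun i b =>
    ((hch.degree i).map _).commute (even_two_mul i) b
  have h0 : ch' 0 = 1 := by rw [hch']; dsimp only; rw [hch.zero, RingHom.map_one]
  have hv : ∀ i, r < i → ch' i = 0 := fun i hi => by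
    rw [hch']; dsimp only; rw [hch.vanish i hi, RingHom.map_zero]
  have hs : ∀ j, Coh.map ContinuousMap.snd (segre ch j) = segre ch' j := fun j => map_segre _ ch j
  -- The degree d - 2k + 2j exceeds d.
  have hαs : ∀ j, k < j → α * segre ch j = 0 := fun j hj =>
    hd _ (by omega) _ (hα.mul (segre_inDegree hch.degree j))
  have hTh' : RelCoh.toCoh Th = Coh.map p (chernPoly r C ch') := by
    rw [toCoh_thom hE hc hr hch hTh, map_chernPoly, hC, hch']
    simp only [← Coh.map_comp]
    rfl
  have key := chernPoly_mul_sum hm hCc hchc h0 hv (α := Coh.map ContinuousMap.snd α)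
    (fun j hj => by rw [← hs, ← RingHom.map_mul, hαs j hj, RingHom.map_zero])
  simp only [← hs, ← RingHom.map_mul (Coh.map (ContinuousMap.snd : C(BS E × M, M)))] at key
  -- With α = 1 and `d` in place of `k`, the Chern polynomial divides C^{d+r}, since the Segre
  -- classes with j > d vanish on M. A divisor of a non-zero-divisor is one itself.
  have hreg : ∀ y, chernPoly r C ch' * y = 0 → y = 0 := fun y hy => by
    have h1 := chernPoly_mul_sum (k := d) (le_refl (d + r)) hCc hchc h0 hv (α := 1)
      (fun j hj => by
        rw [one_mul, ← hs, hd (2 * j) (by omega) _ (segre_inDegree hch.degree j), RingHom.map_zero])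
    refine eq_zero_of_chern_pow_mul hE hc (d + r) ?_
    rw [← hC, ← mul_one (C ^ (d + r)), ← h1, (chernPoly_commute hCc hchc _).eq, mul_assoc, hy,
      mul_zero]
  obtain ⟨s, hsec⟩ := exists_borelBundle_zeroSection F N hE
  have hinj := Coh.map_injective_of_section hsec
  have hx : Coh.map (piB E F N) c ^ m * Coh.map (piM E F N) α =
      Coh.map p (C ^ m * Coh.map ContinuousMap.snd α) := by
    rw [RingHom.map_mul, RingHom.map_pow, hC, ← Coh.map_comp, ← Coh.map_comp]
    rfl
  refine ⟨?_, ∑ j ∈ Finset.range (k + 1), (-1) ^ (r + j) *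
    (C ^ (m - r - j) * Coh.map ContinuousMap.snd (α * segre ch j)), fun y' => ?_, ?_⟩
  · rw [hx, ← key, RingHom.map_mul, hTh', map_sum]
    refine congrArg _ (Finset.sum_congr rfl fun j _ => ?_)
    rw [RingHom.map_mul, RingHom.map_mul, RingHom.map_pow, RingHom.map_pow, RingHom.map_neg,
      RingHom.map_one, hC, ← Coh.map_comp, ← Coh.map_comp]
    rfl
  -- The zero section makes `Coh.map p` injective, so the equation for `y'` can be read on BS¹ × M,
  -- where the Chern polynomial can be cancelled.
  · rw [hx, ← key, hTh', ← RingHom.map_mul, hinj.eq_iff, ← sub_eq_zero, ← mul_sub]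
    exact ⟨fun h => (sub_eq_zero.1 (hreg _ h)).symm, fun h => by rw [h, sub_self, mul_zero]⟩
  -- For j ≤ k ≤ d/2 the class α s_j has degree d - 2(k - j) ≤ d, as the slant formula requires. The
  -- degree equals d only for j = k, so the other summands pair to zero with the fundamental class.
  · have hsl : ∀ j ∈ Finset.range (k + 1), slant ((-1) ^ (r + j) *
        (C ^ (m - r - j) * Coh.map ContinuousMap.snd (α * segre ch j))) fund =
          ((-1) ^ (r + j) * pairing (α * segre ch j) fund) • c ^ (m - r - j) := fun j hj => by
      rw [Finset.mem_range] at hj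
      have h1 : ∀ y : Coh (BS E × M), (-1) ^ (r + j) * y = ((-1 : ℤ) ^ (r + j)) • y := fun y => by
        rw [zsmul_eq_mul]; push_cast; rfl
      rw [h1, slant_zsmul, hC, slant_pow_mul hc2 (by omega)
        (hα.mul (segre_inDegree hch.degree j)) hfund, smul_smul]
    rw [slant_sum, Finset.sum_congr rfl hsl, Finset.sum_range_succ, Finset.sum_eq_zero, zero_add,
      add_comm k r]
    intro j hj
    rw [Finset.mem_range] at hj
    rw [pairing_eq_zero (by omega) (hα.mul (segre_inDegree hch.degree j)) hfund, mul_zero, zero_smul]
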